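/- **Setting.** Let $\mathbb{G}=(A,\delta,h)$ be a compact Kac algebra with separable predual: $A$ is a von Neumann algebra, $\delta\colon A\to A\otimes A$ is a unital faithful normal coassociative $*$-homomorphism, and $h$ is a faithful normal tracial state with $(\theta\otimes h)(\delta(a))=\theta(1)h(a)=(h\otimes\theta)(\delta(a))$ for all $a\in A$, $\theta\in A_*$. A finite-dimensional unitary representation of $\mathbb{G}$ is a unitary $v\in A\otimes B(K)$, $\dim K<\infty$, with $(\delta\otimes\mathrm{id})(v)=v_{13}v_{23}$. For two representations $v,w$ on $K_v$, $K_w$ let $(v,w)=\{S\in B(K_v,K_w): (1\otimes S)v=w(1\otimes S)\}$, and let $v\cdot w=v_{12}w_{13}$ be their tensor product. Let $\mathrm{Irr}(\mathbb{G})$ be the set of unitary equivalence classes of irreducible unitary representations (these are finite-dimensional); choose a representative $(v_\pi,H_\pi)$ of each class $\pi$, and let $\mathbf 1$ be the class of the trivial representation, represented by $v_{\mathbf 1}=1$ on a one-dimensional space. The dual discrete Kac algebra $\widehat{\mathbb{G}}$ is $\ell^\infty(\widehat{\mathbb{G}})=\bigoplus_{\pi\in\mathrm{Irr}(\mathbb{G})}B(H_\pi)$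 with the coproduct $\Delta$ whose components ${}_\pi\Delta_\rho(x)\in B(H_\pi)\otimes B(H_\rho)$ are determined by ${}_\pi\Delta_\rho(x)S=Sx_\sigma$ for all $\sigma$ and all $S\in(\sigma,\pi\cdot\rho)$. Let $M$ be a von Neumann algebra with separable predual. A *cocycle action* of $\widehat{\mathbb{G}}$ on $M$ is a pair $(\alpha,u)$ of a unital faithful normal $*$-homomorphism $\alpha\colon M\to M\otimes\ell^\infty(\widehat{\mathbb{G}})$ and a unitary $u\in M\otimes\ell^\infty(\widehat{\mathbb{G}})\otimes\ell^\infty(\widehat{\mathbb{G}})$ such that $$(\alpha\otimes\mathrm{id})\circ\alpha=\mathrm{Ad}\,u\circ(\mathrm{id}\otimes\Delta)\circ\alpha,\qquad (u\otimes1)(\mathrm{id}\otimes\Delta\otimes\mathrm{id})(u)=(\alpha\otimes\mathrm{id}\otimes\mathrm{id})(u)\,(\mathrm{id}\otimes\mathrm{id}\otimes\Delta)(u),$$ and $u_{\pi,\mathbf 1}=1$ and $u_{\mathbf 1,\pi}=1$ for all $\pi$. Write $\alpha_\pi\colon M\to M\otimes B(H_\pi)$ for the components of $\alpha$. Fix a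 free ultrafilter $\omega$ on $\mathbb{N}$. In $\ell^\infty(\mathbb{N},M)$ let $\mathcal{T}_\omega$ be the set of bounded sequences converging to $0$ $*$-strongly along $\omega$, let $\mathcal{N}(\mathcal{T}_\omega)=\{x: x\mathcal{T}_\omega\subset\mathcal{T}_\omega,\ \mathcal{T}_\omega x\subset\mathcal{T}_\omega\}$, and let $\mathcal{C}_\omega$ be the set of bounded sequences $(x_n)_n$ with $\lim_{n\to\omega}\|[\varphi,x_n]\|=0$ for all $\varphi\in M_*$, where $[\varphi,x](y)=\varphi(xy)-\varphi(yx)$. Put $M^\omega=\mathcal{N}(\mathcal{T}_\omega)/\mathcal{T}_\omega$ and $M_\omega=\mathcal{C}_\omega/\mathcal{T}_\omega\subset M^\omega$, and embed $M$ into $M^\omega$ as the constant sequences. Each $\beta=\alpha_\pi$ induces a homomorphism $\beta^\omega\colon M^\omega\to M^\omega\otimes B(H_\pi)$ by applying $\beta$ termwise to representing sequences. The cocycle action $(\alpha,u)$ is called * *free* if for every $\pi\ne\mathbf 1$ there is no nonzero $a\in M\otimes B(H_\pi)$ with $\alpha_\pi(x)a=a(x\otimes1)$ for all $x\in M$; *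 *centrally free* if for every $\pi\neq\mathbf 1$ there is no nonzero $a\in M\otimes B(H_\pi)$ with $\alpha_\pi^\omega(x)a=(x\otimes1)a$ for all $x\in M_\omega$; * *strongly free* if for every $\pi\neq\mathbf 1$ and every countably generated von Neumann subalgebra $S\subset M^\omega$ there is no nonzero $a\in M^\omega\otimes B(H_\pi)$ with $\alpha_\pi^\omega(y)a=a(y\otimes1)$ for all $y\in S'\cap M_\omega$. **Statement.** Let $(\alpha,u)$ be a cocycle action of $\widehat{\mathbb{G}}$ on $M$. Then $(\alpha,u)$ is centrally free if and only if it is strongly free. If, in addition, $M$ is the approximately finite dimensional factor of type $\mathrm{II}_1$, then central freeness, strong freeness and freeness of $(\alpha,u)$ are all equivalent. -/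

import Mathlib

open scoped InnerProductSpace TensorProduct Kronecker Topology
open Filter

namespace KacAction

/-! ### Von Neumann algebras, normal functionals and tensor products -/

section VonNeumann

set_option linter.unusedSectionVars false

variable {H K : Type*} [NormedAddCommGroup H] [InnerProductSpace ℂ H] [CompleteSpace H]
  [NormedAddCommGroup K] [InnerProductSpace ℂ K] [CompleteSpace K]

instance instSMulMemClassVonNeumannAlgebra :
    SMulMemClass (VonNeumannAlgebra H) ℂ (H →L[ℂ] H) where
  smul_mem {S} c _ hx := S.toStarSubalgebra.smul_mem hx c

/-- `φ` belongs to the predual `M_*` of `M ⊆ B(H)`: it is a σ-weakly continuous functional,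
i.e. `φ = ∑ₙ ⟨ηₙ, · ξₙ⟩` with square-summable sequences `ξ`, `η` of vectors. -/
def IsNormalFunctional (M : VonNeumannAlgebra H) (φ : M → ℂ) : Prop :=
  ∃ ξ η : ℕ → H, (Summable fun n => ‖ξ n‖ ^ 2) ∧ (Summable fun n => ‖η n‖ ^ 2) ∧
    ∀ x : M, φ x = ∑' n, ⟪η n, (x : H →L[ℂ] H) (ξ n)⟫_ℂ

/-- The Hilbert space tensor product. -/
abbrev HilbertTensor (H K : Type*) [NormedAddCommGroup H] [InnerProductSpace ℂ H]
    [NormedAddCommGroup K] [InnerProductSpace ℂ K] : Type _ :=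
  UniformSpace.Completion (H ⊗[ℂ] K)

/-- The elementary tensor `ξ ⊗ η`. -/
noncomputable def tmulVec (ξ : H) (η : K) : HilbertTensor H K :=
  ((ξ ⊗ₜ[ℂ] η : H ⊗[ℂ] K) : UniformSpace.Completion (H ⊗[ℂ] K))

/-- The operator `η ↦ ζ ⊗ η`. -/
noncomputable def tensorLeft (ζ : H) : K →L[ℂ] HilbertTensor H K :=
  UniformSpace.Completion.toComplL ∘L TensorProduct.mkL ℂ H K ζ

/-- The operator `ξ ↦ ξ ⊗ ζ`. -/
noncomputable def tensorRight (ζ : K) : H →L[ℂ] HilbertTensor H K :=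
  UniformSpace.Completion.toComplL ∘L (TensorProduct.mkL ℂ H K).flip ζ

/-- The bounded operator `a ⊗ b` on the Hilbert space tensor product. -/
noncomputable def tensorOp (a : H →L[ℂ] H) (b : K →L[ℂ] K) :
    HilbertTensor H K →L[ℂ] HilbertTensor H K :=
  (TensorProduct.mapL a b).completion

theorem tensorLeft_apply (ζ : H) (η : K) : tensorLeft ζ η = tmulVec ζ η := rfl

theorem tensorRight_apply (ξ : H) (ζ : K) : tensorRight ζ ξ = tmulVec ξ ζ := rfl

theorem tensorOp_tmulVec (a : H →L[ℂ] H) (b : K →L[ℂ] K) (ξ : H) (η : K) :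
    tensorOp a b (tmulVec ξ η) = tmulVec (a ξ) (b η) := by
  simp [tensorOp, tmulVec]

theorem inner_tmulVec (ξ ξ' : H) (η η' : K) :
    ⟪tmulVec ξ η, tmulVec ξ' η'⟫_ℂ = ⟪ξ, ξ'⟫_ℂ * ⟪η, η'⟫_ℂ := by
  simp [tmulVec]

/-- Two bounded operators agreeing on elementary tensors are equal. -/
theorem tensor_ext {E : Type*} [NormedAddCommGroup E] [NormedSpace ℂ E]
    {S T : HilbertTensor H K →L[ℂ] E}
    (h : ∀ ξ η, S (tmulVec ξ η) = T (tmulVec ξ η)) : S = T := by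
  ext x
  induction x using UniformSpace.Completion.induction_on with
  | hp => exact isClosed_eq S.continuous T.continuous
  | ih t =>
    induction t using TensorProduct.induction_on with
    | zero => simp only [UniformSpace.Completion.coe_zero, map_zero]
    | tmul x y => exact h x y
    | add x y hx hy => simp only [UniformSpace.Completion.coe_add, map_add, hx, hy]

theorem star_tensorOp (a : H →L[ℂ] H) (b : K →L[ℂ] K) :
    star (tensorOp a b) = tensorOp (star a) (star b) := by
  refine tensor_ext fun ξ η => ext_inner_left ℂ fun v => ?_
  rw [ContinuousLinearMap.star_eq_adjoint, ContinuousLinearMap.adjoint_inner_right]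
  induction v using UniformSpace.Completion.induction_on with
  | hp => exact isClosed_eq (by fun_prop) (by fun_prop)
  | ih t =>
    induction t using TensorProduct.induction_on with
    | zero => simp only [UniformSpace.Completion.coe_zero, map_zero, inner_zero_left]
    | tmul x y =>
      change ⟪tensorOp a b (tmulVec x y), tmulVec ξ η⟫_ℂ =
        ⟪tmulVec x y, tensorOp (star a) (star b) (tmulVec ξ η)⟫_ℂ
      simp [tensorOp_tmulVec, inner_tmulVec, ContinuousLinearMap.star_eq_adjoint,
        ContinuousLinearMap.adjoint_inner_right]
    | add x y hx hy => simp only [UniformSpace.Completion.coe_add, map_add, inner_add_left, hx, hy]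

/-- The set of elementary tensors `a ⊗ b` with `a ∈ A` and `b ∈ B`. -/
def elementaryTensors (A : VonNeumannAlgebra H) (B : VonNeumannAlgebra K) :
    Set (HilbertTensor H K →L[ℂ] HilbertTensor H K) :=
  {T | ∃ a ∈ A, ∃ b ∈ B, T = tensorOp a b}

/-- The von Neumann algebra tensor product: the double commutant of the elementary tensors. -/
noncomputable def vnTensor (A : VonNeumannAlgebra H) (B : VonNeumannAlgebra K) :
    VonNeumannAlgebra (HilbertTensor H K) where
  toStarSubalgebra := StarSubalgebra.centralizer ℂ
    (SetLike.coe (StarSubalgebra.centralizer ℂ (elementaryTensors A B)))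
  centralizer_centralizer' := by
    have h := StarSubalgebra.coe_centralizer_centralizer ℂ (elementaryTensors A B)
    change Set.centralizer (Set.centralizer (SetLike.coe (StarSubalgebra.centralizer ℂ
      (SetLike.coe (StarSubalgebra.centralizer ℂ (elementaryTensors A B)))))) =
      SetLike.coe (StarSubalgebra.centralizer ℂ
        (SetLike.coe (StarSubalgebra.centralizer ℂ (elementaryTensors A B))))
    rw [h, Set.centralizer_centralizer_centralizer]

/-- An operator commutes with `A ⊗ B` as soon as it and its adjoint commute with all `a ⊗ b`. -/
theorem commute_of_mem_vnTensor {A : VonNeumannAlgebra H} {B : VonNeumannAlgebra K}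
    {T c : HilbertTensor H K →L[ℂ] HilbertTensor H K} (hT : T ∈ vnTensor A B)
    (hc : ∀ a ∈ A, ∀ b ∈ B, tensorOp a b * c = c * tensorOp a b) : c * T = T * c := by
  have hT' : T ∈ StarSubalgebra.centralizer ℂ
    (StarSubalgebra.centralizer ℂ (elementaryTensors A B) :
      Set (HilbertTensor H K →L[ℂ] HilbertTensor H K)) := hT
  rw [StarSubalgebra.mem_centralizer_iff] at hT'
  refine (hT' c ?_).1
  change c ∈ StarSubalgebra.centralizer ℂ (elementaryTensors A B)
  rw [StarSubalgebra.mem_centralizer_iff]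
  rintro _ ⟨a, ha, b, hb, rfl⟩
  refine ⟨hc a ha b hb, ?_⟩
  rw [star_tensorOp]
  exact hc _ (star_mem ha) _ (star_mem hb)

theorem adjoint_tensorLeft_tmulVec (ζ ξ : H) (η : K) :
    (tensorLeft ζ).adjoint (tmulVec ξ η) = ⟪ζ, ξ⟫_ℂ • η := by
  refine ext_inner_left ℂ fun v => ?_
  rw [ContinuousLinearMap.adjoint_inner_right, tensorLeft_apply, inner_tmulVec, inner_smul_right]

theorem adjoint_tensorRight_tmulVec (ζ η : K) (ξ : H) :
    (tensorRight ζ).adjoint (tmulVec ξ η) = ⟪ζ, η⟫_ℂ • ξ := by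
  refine ext_inner_left ℂ fun v => ?_
  rw [ContinuousLinearMap.adjoint_inner_right, tensorRight_apply, inner_tmulVec, inner_smul_right,
    mul_comm]

theorem adjoint_tensorLeft_comp (ζ : H) (c : K →L[ℂ] K) :
    (tensorLeft ζ).adjoint ∘L tensorOp 1 c = c ∘L (tensorLeft ζ).adjoint :=
  tensor_ext fun ξ η => by
    simp [tensorOp_tmulVec, adjoint_tensorLeft_tmulVec]

theorem adjoint_tensorRight_comp (ζ : K) (c : H →L[ℂ] H) :
    (tensorRight ζ).adjoint ∘L tensorOp c 1 = c ∘L (tensorRight ζ).adjoint :=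
  tensor_ext fun ξ η => by
    simp [tensorOp_tmulVec, adjoint_tensorRight_tmulVec]

theorem mem_of_commute_commutant (A : VonNeumannAlgebra H) (x : H →L[ℂ] H)
    (h : ∀ c ∈ A.commutant, c * x = x * c) : x ∈ A := by
  rw [← A.commutant_commutant, VonNeumannAlgebra.mem_commutant_iff]
  exact h

/-- The slice map `ω_{ζ',ζ} ⊗ id : A ⊗ B → B`, where `ω_{ζ',ζ} = ⟨ζ', · ζ⟩`. -/
noncomputable def sliceFst {A : VonNeumannAlgebra H} {B : VonNeumannAlgebra K} (ζ' ζ : H)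
    (T : vnTensor A B) : B :=
  ⟨(tensorLeft ζ').adjoint ∘L (T : HilbertTensor H K →L[ℂ] HilbertTensor H K) ∘L tensorLeft ζ, by
    refine mem_of_commute_commutant _ _ fun c hc => ?_
    rw [VonNeumannAlgebra.mem_commutant_iff] at hc
    have h1 : tensorOp (1 : H →L[ℂ] H) c * (T : HilbertTensor H K →L[ℂ] HilbertTensor H K) =
        (T : HilbertTensor H K →L[ℂ] HilbertTensor H K) * tensorOp 1 c :=
      commute_of_mem_vnTensor T.2 fun a _ b hb => tensor_ext fun ξ η => by
        have := congrArg (fun t : K →L[ℂ] K => t η) (hc b hb)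
        simp only [mul_apply_eq_comp] at this
        simp [tensorOp_tmulVec, this]
    have h2 : tensorOp (1 : H →L[ℂ] H) c ∘L tensorLeft ζ = tensorLeft ζ ∘L c := by
      ext η
      simp [tensorLeft_apply, tensorOp_tmulVec]
    change c ∘L _ = _ ∘L c
    rw [← ContinuousLinearMap.comp_assoc, ← adjoint_tensorLeft_comp,
      ContinuousLinearMap.comp_assoc, ← ContinuousLinearMap.comp_assoc (tensorOp 1 c)]
    change _ ∘L (tensorOp 1 c * (T : HilbertTensor H K →L[ℂ] HilbertTensor H K)) ∘L _ = _
    rw [h1, ContinuousLinearMap.comp_assoc, ContinuousLinearMap.comp_assoc, ← h2]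
    rfl⟩

/-- The slice map `id ⊗ ω_{ζ',ζ} : A ⊗ B → A`, where `ω_{ζ',ζ} = ⟨ζ', · ζ⟩`. -/
noncomputable def sliceSnd {A : VonNeumannAlgebra H} {B : VonNeumannAlgebra K} (ζ' ζ : K)
    (T : vnTensor A B) : A :=
  ⟨(tensorRight ζ').adjoint ∘L (T : HilbertTensor H K →L[ℂ] HilbertTensor H K) ∘L tensorRight ζ, by
    refine mem_of_commute_commutant _ _ fun c hc => ?_
    rw [VonNeumannAlgebra.mem_commutant_iff] at hc
    have h1 : tensorOp c (1 : K →L[ℂ] K) * (T : HilbertTensor H K →L[ℂ] HilbertTensor H K) =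
        (T : HilbertTensor H K →L[ℂ] HilbertTensor H K) * tensorOp c 1 :=
      commute_of_mem_vnTensor T.2 fun a ha b _ => tensor_ext fun ξ η => by
        have := congrArg (fun t : H →L[ℂ] H => t ξ) (hc a ha)
        simp only [mul_apply_eq_comp] at this
        simp [tensorOp_tmulVec, this]
    have h2 : tensorOp c (1 : K →L[ℂ] K) ∘L tensorRight ζ = tensorRight ζ ∘L c := by
      ext η
      simp [tensorRight_apply, tensorOp_tmulVec]
    change c ∘L _ = _ ∘L c
    rw [← ContinuousLinearMap.comp_assoc, ← adjoint_tensorRight_comp,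
      ContinuousLinearMap.comp_assoc, ← ContinuousLinearMap.comp_assoc (tensorOp c 1)]
    change _ ∘L (tensorOp c 1 * (T : HilbertTensor H K →L[ℂ] HilbertTensor H K)) ∘L _ = _
    rw [h1, ContinuousLinearMap.comp_assoc, ContinuousLinearMap.comp_assoc, ← h2]
    rfl⟩

end VonNeumann

/-! ### Compact Kac algebras and their unitary representations -/

section Kac

/-- A compact Kac algebra `(A, δ, h)`: a von Neumann algebra `A` with a coproduct
`δ : A → A ⊗ A` (a unital faithful normal coassociative `*`-homomorphism) and a faithful normal
invariant tracial state `h`. The algebra `A` acts on the GNS Hilbert space `L` of `h`,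
with cyclic vector `vac`, so that `h(a) = ⟨vac, a vac⟩`. In this representation the vector
functionals `⟨ζ', · ζ⟩` exhaust the predual of `A`; accordingly coassociativity and invariance are
tested on vector functionals:
`(ω ⊗ id ⊗ θ)(δ ⊗ id)δ = (ω ⊗ id ⊗ θ)(id ⊗ δ)δ` and
`(θ ⊗ h)δ(a) = θ(1)h(a) = (h ⊗ θ)δ(a)`. -/
structure CompactKacAlgebra (L : Type*) [NormedAddCommGroup L] [InnerProductSpace ℂ L]
    [CompleteSpace L] where
  /-- the von Neumann algebra `A` -/
  alg : VonNeumannAlgebra L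
  /-- the coproduct `δ` -/
  comul : alg →⋆ₐ[ℂ] vnTensor alg alg
  comul_injective : Function.Injective comul
  comul_normal : ∀ Φ : vnTensor alg alg → ℂ, IsNormalFunctional (vnTensor alg alg) Φ →
    IsNormalFunctional alg fun a => Φ (comul a)
  coassoc : ∀ (a : alg) (ζ' ζ η' η : L),
    sliceFst ζ' ζ (comul (sliceSnd η' η (comul a))) =
      sliceSnd η' η (comul (sliceFst ζ' ζ (comul a)))
  /-- the cyclic vector of the GNS representation of `h` -/
  vac : L
  norm_vac : ‖vac‖ = 1
  cyclic : Dense (Set.range fun a : alg => (a : L →L[ℂ] L) vac)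
  faithful : ∀ a : alg, (a : L →L[ℂ] L) vac = 0 → a = 0
  tracial : ∀ a b : alg, ⟪vac, ((a * b : alg) : L →L[ℂ] L) vac⟫_ℂ =
    ⟪vac, ((b * a : alg) : L →L[ℂ] L) vac⟫_ℂ
  invariant_left : ∀ (a : alg) (ζ' ζ : L),
    ⟪vac, (sliceFst ζ' ζ (comul a) : L →L[ℂ] L) vac⟫_ℂ =
      ⟪ζ', ζ⟫_ℂ * ⟪vac, (a : L →L[ℂ] L) vac⟫_ℂ
  invariant_right : ∀ (a : alg) (ζ' ζ : L),
    ⟪vac, (sliceSnd ζ' ζ (comul a) : L →L[ℂ] L) vac⟫_ℂ =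
      ⟪ζ', ζ⟫_ℂ * ⟪vac, (a : L →L[ℂ] L) vac⟫_ℂ

variable {L : Type*} [NormedAddCommGroup L] [InnerProductSpace ℂ L] [CompleteSpace L]

/-- `S` is an intertwiner from `v` to `w`: `(1 ⊗ S) v = w (1 ⊗ S)`. Here `A ⊗ B(ℂᵐ)` is
identified with the `m × m` matrices over `A`. -/
def IsIntertwiner {A : Type*} [Ring A] [Algebra ℂ A] {m n : Type*} [Fintype m] [Fintype n]
    (v : Matrix m m A) (w : Matrix n n A) (S : Matrix n m ℂ) : Prop :=
  S.map (algebraMap ℂ A) * v = w * S.map (algebraMap ℂ A)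

/-- The matrix `v₁₂ v'₁₃` of the tensor product of two representations. -/
def tensorRep {A : Type*} [Mul A] {m n : Type*} (v : Matrix m m A) (w : Matrix n n A) :
    Matrix (m × n) (m × n) A :=
  Matrix.of fun p q => v p.1 q.1 * w p.2 q.2

/-- An irreducible unitary representation `π = (v, ℂᵈ)` of a compact Kac algebra: a unitary
`v ∈ A ⊗ B(ℂᵈ)` with `(δ ⊗ id)(v) = v₁₃ v₂₃`, i.e. `δ(vᵢⱼ) = ∑ₖ vᵢₖ ⊗ vₖⱼ`, such that
`(π, π) = ℂ`. (Irreducible unitary representations of compact Kac algebras are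
finite-dimensional.) -/
structure IrrRep (G : CompactKacAlgebra L) where
  /-- the dimension `d_π` -/
  dim : ℕ
  dim_pos : 0 < dim
  /-- the unitary matrix `v_π` -/
  mat : Matrix (Fin dim) (Fin dim) G.alg
  mat_unitary : mat ∈ unitary (Matrix (Fin dim) (Fin dim) G.alg)
  comul_mat : ∀ i j, (G.comul (mat i j) : HilbertTensor L L →L[ℂ] HilbertTensor L L) =
    ∑ k, tensorOp (mat i k : L →L[ℂ] L) (mat k j : L →L[ℂ] L)
  irreducible : ∀ S : Matrix (Fin dim) (Fin dim) ℂ, IsIntertwiner mat mat S →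
    ∃ c : ℂ, S = c • (1 : Matrix (Fin dim) (Fin dim) ℂ)

variable {G : CompactKacAlgebra L}

/-- Unitary equivalence: there is a unitary intertwiner. -/
def IrrRep.Equivalent (π ρ : IrrRep G) : Prop :=
  ∃ S : Matrix (Fin ρ.dim) (Fin π.dim) ℂ, IsIntertwiner π.mat ρ.mat S ∧
    S.conjTranspose * S = 1 ∧ S * S.conjTranspose = 1

instance irrRepSetoid (G : CompactKacAlgebra L) : Setoid (IrrRep G) where
  r := IrrRep.Equivalent
  iseqv :=
    { refl := fun π => ⟨1, by simp [IsIntertwiner], by simp, by simp⟩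
      symm := by
        rintro π ρ ⟨S, hS, h1, h2⟩
        refine ⟨S.conjTranspose, ?_, by simpa using h2, by simpa using h1⟩
        have e1 : S.conjTranspose.map (algebraMap ℂ G.alg) * S.map (algebraMap ℂ G.alg) = 1 := by
          rw [← Matrix.map_mul, h1]; simp
        have e2 : S.map (algebraMap ℂ G.alg) * S.conjTranspose.map (algebraMap ℂ G.alg) = 1 := by
          rw [← Matrix.map_mul, h2]; simp
        unfold IsIntertwiner at hS ⊢
        calc S.conjTranspose.map (algebraMap ℂ G.alg) * ρ.mat
            = S.conjTranspose.map (algebraMap ℂ G.alg) * (ρ.mat * S.map (algebraMap ℂ G.alg)) *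
                S.conjTranspose.map (algebraMap ℂ G.alg) := by
              rw [Matrix.mul_assoc, Matrix.mul_assoc, e2, Matrix.mul_one]
          _ = π.mat * S.conjTranspose.map (algebraMap ℂ G.alg) := by
              rw [← hS, ← Matrix.mul_assoc, e1, Matrix.one_mul]
      trans := by
        rintro π ρ σ ⟨S, hS, h1, h2⟩ ⟨T, hT, h3, h4⟩
        refine ⟨T * S, ?_, ?_, ?_⟩
        · unfold IsIntertwiner at *
          rw [Matrix.map_mul, Matrix.mul_assoc, hS, ← Matrix.mul_assoc, hT, Matrix.mul_assoc]
        · rw [Matrix.conjTranspose_mul, Matrix.mul_assoc, ← Matrix.mul_assoc _ T, h3,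
            Matrix.one_mul, h1]
        · rw [Matrix.conjTranspose_mul, Matrix.mul_assoc, ← Matrix.mul_assoc S, h2,
            Matrix.one_mul, h4] }

/-- `Irr(G)`: the set of equivalence classes of irreducible unitary representations. -/
def Irr (G : CompactKacAlgebra L) : Type _ := Quotient (irrRepSetoid G)

theorem tensorOp_one_one : tensorOp (1 : L →L[ℂ] L) (1 : L →L[ℂ] L) = 1 :=
  tensor_ext fun ξ η => by simp [tensorOp_tmulVec]

/-- The trivial representation `(1, ℂ)`. -/
noncomputable def trivialRep (G : CompactKacAlgebra L) : IrrRep G where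
  dim := 1
  dim_pos := one_pos
  mat := 1
  mat_unitary := one_mem _
  comul_mat i j := by
    have hi : i = 0 := Subsingleton.elim _ _
    have hj : j = 0 := Subsingleton.elim _ _
    subst hi; subst hj
    simp [tensorOp_one_one]
  irreducible S _ := ⟨S 0 0, by ext i j; fin_cases i; fin_cases j; simp⟩

/-- The class of the trivial representation. -/
noncomputable def Irr.triv (G : CompactKacAlgebra L) : Irr G :=
  Quotient.mk (irrRepSetoid G) (trivialRep G)

/-- A choice of a representative `π = (v_π, H_π)`, `H_π = ℂ^{d_π}`, for each class in `Irr(G)`. -/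
structure IrrSystem (G : CompactKacAlgebra L) where
  /-- the chosen representative -/
  rep : Irr G → IrrRep G
  mk_rep : ∀ π, Quotient.mk (irrRepSetoid G) (rep π) = π

/-- The index set of the standard basis of `H_π`. -/
abbrev IrrSystem.Ix (R : IrrSystem G) (π : Irr G) : Type := Fin (R.rep π).dim

/-- The intertwiner space `(σ, π·ρ)`. -/
def IrrSystem.Hom₂ (R : IrrSystem G) (σ π ρ : Irr G) :
    Set (Matrix (R.Ix π × R.Ix ρ) (R.Ix σ) ℂ) :=
  {S | IsIntertwiner (R.rep σ).mat (tensorRep (R.rep π).mat (R.rep ρ).mat) S}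

end Kac

/-! ### Cocycle actions of the dual discrete Kac algebra

For a compact Kac algebra `G` with a system of representatives of `Irr(G)`, the dual discrete Kac
algebra is `ℓ^∞(Ĝ) = ⨁_π B(H_π)` with the coproduct `Δ` determined on each block
`B(H_π) ⊗ B(H_ρ)` by `Δ(x)_{π,ρ} S = S x_σ` for all `σ` and all intertwiners `S ∈ (σ, π·ρ)`.
An element of `M ⊗ ℓ^∞(Ĝ)` is a bounded family of elements of `M ⊗ B(H_π)`, that is, of
`d_π × d_π` matrices over `M`; an element of `M ⊗ ℓ^∞(Ĝ) ⊗ ℓ^∞(Ĝ)` is a bounded family of elements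
of `M ⊗ B(H_π) ⊗ B(H_ρ)`. (Families of unitaries and families `(α_π(x))_π` of images of `x` under
`*`-homomorphisms are automatically bounded.) -/

section Action

variable {H : Type*} [NormedAddCommGroup H] [InnerProductSpace ℂ H] [CompleteSpace H]
variable {L : Type*} [NormedAddCommGroup L] [InnerProductSpace ℂ L] [CompleteSpace L]
variable {G : CompactKacAlgebra L}

/-- The matrix `1 ⊗ S` over `M` of a scalar matrix `S`. -/
noncomputable def scal (M : VonNeumannAlgebra H) {m n : Type*} (S : Matrix m n ℂ) : Matrix m n M :=
  S.map (algebraMap ℂ M)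

/-- `x ⊗ 1`, for `x` in a ring `N`, as a diagonal matrix over `N`. -/
def amp {N : Type*} [Zero N] (n : Type*) [DecidableEq n] (x : N) : Matrix n n N :=
  Matrix.diagonal fun _ => x

/-- `U ⊗ 1`, for `U ∈ M ⊗ B(ℂᵐ)`, in `M ⊗ B(ℂᵐ) ⊗ B(ℂⁿ)`. -/
def ampRight {N : Type*} [Zero N] {m : Type*} (n : Type*) [DecidableEq n] (U : Matrix m m N) :
    Matrix (m × n) (m × n) N :=
  Matrix.of fun p q => if p.2 = q.2 then U p.1 q.1 else 0

/-- `(β ⊗ id)(A) ∈ M ⊗ B(ℂᵐ) ⊗ B(ℂⁿ)` for `β : M → M ⊗ B(ℂᵐ)` and `A ∈ M ⊗ B(ℂⁿ)`. -/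
def applyFirst {N : Type*} {m n : Type*} (β : N → Matrix m m N) (A : Matrix n n N) :
    Matrix (m × n) (m × n) N :=
  Matrix.of fun p q => β (A p.2 q.2) p.1 q.1

/-- Normality of a map `β : M → M ⊗ B(ℂᵐ)`: all its matrix entries are σ-weakly continuous. -/
def IsNormalMap (M : VonNeumannAlgebra H) {m : Type*} (β : M → Matrix m m M) : Prop :=
  ∀ i j, ∀ φ : M → ℂ, IsNormalFunctional M φ → IsNormalFunctional M fun x => φ (β x i j)

/-- `Y` is the block `(id ⊗ _πΔ_ρ)(y)` of `(id ⊗ Δ)(y)`, where `y ∈ M ⊗ ℓ^∞(Ĝ)`. -/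
def IsComulBlock (R : IrrSystem G) (M : VonNeumannAlgebra H)
    (y : ∀ σ, Matrix (R.Ix σ) (R.Ix σ) M) (π ρ : Irr G)
    (Y : Matrix (R.Ix π × R.Ix ρ) (R.Ix π × R.Ix ρ) M) : Prop :=
  ∀ σ, ∀ S ∈ R.Hom₂ σ π ρ, Y * scal M S = scal M S * y σ

/-- `Y` is the block `(id ⊗ _πΔ_ρ ⊗ id_σ)(u)` of `(id ⊗ Δ ⊗ id)(u)`, where
`u ∈ M ⊗ ℓ^∞(Ĝ) ⊗ ℓ^∞(Ĝ)`. -/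
def IsComulBlockLeft (R : IrrSystem G) (M : VonNeumannAlgebra H)
    (u : ∀ π ρ, Matrix (R.Ix π × R.Ix ρ) (R.Ix π × R.Ix ρ) M) (π ρ σ : Irr G)
    (Y : Matrix ((R.Ix π × R.Ix ρ) × R.Ix σ) ((R.Ix π × R.Ix ρ) × R.Ix σ) M) : Prop :=
  ∀ τ, ∀ S ∈ R.Hom₂ τ π ρ,
    Y * scal M (S ⊗ₖ (1 : Matrix (R.Ix σ) (R.Ix σ) ℂ)) =
      scal M (S ⊗ₖ (1 : Matrix (R.Ix σ) (R.Ix σ) ℂ)) * u τ σ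

/-- `Z` is the block `(id ⊗ id_π ⊗ _ρΔ_σ)(u)` of `(id ⊗ id ⊗ Δ)(u)`, where
`u ∈ M ⊗ ℓ^∞(Ĝ) ⊗ ℓ^∞(Ĝ)`. -/
def IsComulBlockRight (R : IrrSystem G) (M : VonNeumannAlgebra H)
    (u : ∀ π ρ, Matrix (R.Ix π × R.Ix ρ) (R.Ix π × R.Ix ρ) M) (π ρ σ : Irr G)
    (Z : Matrix (R.Ix π × (R.Ix ρ × R.Ix σ)) (R.Ix π × (R.Ix ρ × R.Ix σ)) M) : Prop :=
  ∀ τ, ∀ S ∈ R.Hom₂ τ ρ σ,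
    Z * scal M ((1 : Matrix (R.Ix π) (R.Ix π) ℂ) ⊗ₖ S) =
      scal M ((1 : Matrix (R.Ix π) (R.Ix π) ℂ) ⊗ₖ S) * u π τ

/-- A cocycle action `(α, u)` on `M` of the discrete Kac algebra dual to `G`:
a unital faithful normal `*`-homomorphism `α : M → M ⊗ ℓ^∞(Ĝ)`, given by its components `α_π`, and a
unitary `u ∈ M ⊗ ℓ^∞(Ĝ) ⊗ ℓ^∞(Ĝ)`, given by its components `u_{π,ρ}`, with
* `(α ⊗ id) ∘ α = Ad u ∘ (id ⊗ Δ) ∘ α`,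
* `(u ⊗ 1)(id ⊗ Δ ⊗ id)(u) = (α ⊗ id ⊗ id)(u)(id ⊗ id ⊗ Δ)(u)`,
* `u_{1,π} = 1` and `u_{π,1} = 1`. -/
structure CocycleAction (R : IrrSystem G) (M : VonNeumannAlgebra H) where
  /-- the components `α_π` -/
  α : ∀ π : Irr G, M →⋆ₐ[ℂ] Matrix (R.Ix π) (R.Ix π) M
  normal : ∀ π, IsNormalMap M (α π)
  faithful : ∀ x : M, (∀ π, α π x = 0) → x = 0
  /-- the components `u_{π,ρ}` -/
  u : ∀ π ρ : Irr G, Matrix (R.Ix π × R.Ix ρ) (R.Ix π × R.Ix ρ) M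
  unitary_u : ∀ π ρ, u π ρ ∈ unitary (Matrix (R.Ix π × R.Ix ρ) (R.Ix π × R.Ix ρ) M)
  twisted : ∀ π ρ x, ∃ Y, IsComulBlock R M (fun σ => α σ x) π ρ Y ∧
    applyFirst (α π) (α ρ x) = u π ρ * Y * star (u π ρ)
  cocycle : ∀ π ρ σ, ∃ Y Z, IsComulBlockLeft R M u π ρ σ Y ∧ IsComulBlockRight R M u π ρ σ Z ∧
    ampRight (R.Ix σ) (u π ρ) * Y =
      (applyFirst (α π) (u ρ σ) * Z).submatrix (Equiv.prodAssoc _ _ _) (Equiv.prodAssoc _ _ _)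
  u_triv_left : ∀ π, u (Irr.triv G) π = 1
  u_triv_right : ∀ π, u π (Irr.triv G) = 1

/-- `(α, u)` is free: for every `π ≠ 1` there is no nonzero `a ∈ M ⊗ B(H_π)` with
`a (x ⊗ 1) = α_π(x) a` for all `x ∈ M`. -/
def CocycleAction.IsFree {R : IrrSystem G} {M : VonNeumannAlgebra H} (c : CocycleAction R M) :
    Prop :=
  ∀ π, π ≠ Irr.triv G → ¬ ∃ a : Matrix (R.Ix π) (R.Ix π) M, a ≠ 0 ∧
    ∀ x : M, a * amp (R.Ix π) x = c.α π x * a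

end Action

/-! ### Ultraproducts -/

section Ultra

variable {H : Type*} [NormedAddCommGroup H] [InnerProductSpace ℂ H] [CompleteSpace H]
variable (ω : Ultrafilter ℕ) (M : VonNeumannAlgebra H)

variable {M} in
/-- The sequence `s` is bounded, i.e. `s ∈ ℓ^∞(ℕ, M)`. -/
def IsBddSeq (s : ℕ → M) : Prop := ∃ C : ℝ, ∀ n, ‖(s n : H →L[ℂ] H)‖ ≤ C

variable {M} in
/-- `s ∈ 𝒯_ω`: the sequence `s` is bounded and converges to `0` strongly* along `ω`. -/
def IsNullSeq (s : ℕ → M) : Prop :=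
  IsBddSeq s ∧ (∀ ξ : H, Tendsto (fun n => (s n : H →L[ℂ] H) ξ) ω (𝓝 0)) ∧
    ∀ ξ : H, Tendsto (fun n => (star (s n : H →L[ℂ] H)) ξ) ω (𝓝 0)

variable {M} in
/-- `s ∈ 𝒞_ω`: the sequence `s` is bounded and `ω`-centralizing, i.e. `‖[φ, sₙ]‖ → 0` along `ω`
for all `φ ∈ M_*`, where `[φ, x](y) = φ(xy) - φ(yx)`. -/
def IsCentralizingSeq (s : ℕ → M) : Prop :=
  IsBddSeq s ∧ ∀ φ : M → ℂ, IsNormalFunctional M φ → ∀ ε > 0, ∀ᶠ n in (ω : Filter ℕ),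
    ∀ y : M, ‖(y : H →L[ℂ] H)‖ ≤ 1 → ‖φ (s n * y) - φ (y * s n)‖ ≤ ε

section lemmas

variable {ω M}

theorem IsBddSeq.add {s t : ℕ → M} (hs : IsBddSeq s) (ht : IsBddSeq t) : IsBddSeq (s + t) := by
  obtain ⟨C, hC⟩ := hs
  obtain ⟨D, hD⟩ := ht
  exact ⟨C + D, fun n => (norm_add_le _ _).trans (add_le_add (hC n) (hD n))⟩

theorem IsBddSeq.mul {s t : ℕ → M} (hs : IsBddSeq s) (ht : IsBddSeq t) : IsBddSeq (s * t) := by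
  obtain ⟨C, hC⟩ := hs
  obtain ⟨D, hD⟩ := ht
  exact ⟨C * D, fun n => (norm_mul_le _ _).trans
    (mul_le_mul (hC n) (hD n) (norm_nonneg _) ((norm_nonneg _).trans (hC n)))⟩

theorem IsBddSeq.star {s : ℕ → M} (hs : IsBddSeq s) : IsBddSeq (star s) := by
  obtain ⟨C, hC⟩ := hs
  refine ⟨C, fun n => ?_⟩
  change ‖Star.star (s n : H →L[ℂ] H)‖ ≤ C
  rw [norm_star]
  exact hC n

theorem isBddSeq_const (x : M) : IsBddSeq fun _ => x := ⟨_, fun _ => le_rfl⟩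

theorem IsNullSeq.add {s t : ℕ → M} (hs : IsNullSeq ω s) (ht : IsNullSeq ω t) :
    IsNullSeq ω (s + t) := by
  refine ⟨hs.1.add ht.1, fun ξ => ?_, fun ξ => ?_⟩
  · simpa using (hs.2.1 ξ).add (ht.2.1 ξ)
  · simpa using (hs.2.2 ξ).add (ht.2.2 ξ)

theorem isNullSeq_zero : IsNullSeq ω (0 : ℕ → M) :=
  ⟨⟨0, fun n => by simp⟩, fun ξ => by simp, fun ξ => by simp⟩

theorem IsNullSeq.star {s : ℕ → M} (hs : IsNullSeq ω s) : IsNullSeq ω (star s) :=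
  ⟨hs.1.star, hs.2.2, fun ξ => by simpa using hs.2.1 ξ⟩

theorem IsNullSeq.const_mul {s : ℕ → M} (x : M) (hs : IsNullSeq ω s) :
    IsNullSeq ω ((fun _ => x) * s) := by
  refine ⟨(isBddSeq_const x).mul hs.1, fun ξ => ?_, fun ξ => ?_⟩
  · have := ((x : H →L[ℂ] H).continuous.tendsto 0).comp (hs.2.1 ξ)
    simpa [Function.comp_def] using this
  · simpa using hs.2.2 (Star.star (x : H →L[ℂ] H) ξ)

theorem IsNullSeq.mul_const {s : ℕ → M} (x : M) (hs : IsNullSeq ω s) :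
    IsNullSeq ω (s * fun _ => x) := by
  have := (hs.star.const_mul (Star.star x)).star
  convert this using 1
  ext n
  simp

end lemmas

/-- `𝒩(𝒯_ω)`: the bounded sequences normalizing `𝒯_ω`, i.e. `s 𝒯_ω ⊆ 𝒯_ω` and
`𝒯_ω s ⊆ 𝒯_ω`. -/
def normalizerAlg : StarSubalgebra ℂ (ℕ → M) where
  carrier := {s | IsBddSeq s ∧ ∀ t, IsNullSeq ω t → IsNullSeq ω (s * t) ∧ IsNullSeq ω (t * s)}
  mul_mem' := by
    rintro a b ⟨ha, ha'⟩ ⟨hb, hb'⟩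
    refine ⟨ha.mul hb, fun t ht => ⟨?_, ?_⟩⟩
    · rw [mul_assoc]; exact (ha' _ (hb' t ht).1).1
    · rw [← mul_assoc]; exact (hb' _ (ha' t ht).2).2
  add_mem' := by
    rintro a b ⟨ha, ha'⟩ ⟨hb, hb'⟩
    refine ⟨ha.add hb, fun t ht => ⟨?_, ?_⟩⟩
    · rw [add_mul]; exact (ha' t ht).1.add (hb' t ht).1
    · rw [mul_add]; exact (ha' t ht).2.add (hb' t ht).2
  algebraMap_mem' := fun r =>
    ⟨isBddSeq_const (algebraMap ℂ M r), fun _ ht => ⟨ht.const_mul _, ht.mul_const _⟩⟩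
  star_mem' := by
    rintro a ⟨ha, ha'⟩
    refine ⟨ha.star, fun t ht => ⟨?_, ?_⟩⟩
    · simpa using (ha' _ ht.star).2.star
    · simpa using (ha' _ ht.star).1.star

/-- The ideal `𝒯_ω` of `𝒩(𝒯_ω)`. -/
def nullIdeal : Ideal (normalizerAlg ω M) where
  carrier := {s | IsNullSeq ω (s : ℕ → M)}
  add_mem' := fun hs ht => hs.add ht
  zero_mem' := isNullSeq_zero
  smul_mem' := fun s _ ht => (s.2.2 _ ht).1

instance : (nullIdeal ω M).IsTwoSided where
  mul_mem_of_left s ht := (s.2.2 _ ht).2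

/-- The ultraproduct von Neumann algebra `M^ω = 𝒩(𝒯_ω) / 𝒯_ω`. -/
def Ultraproduct : Type _ := normalizerAlg ω M ⧸ nullIdeal ω M

noncomputable instance : Ring (Ultraproduct ω M) :=
  inferInstanceAs (Ring (normalizerAlg ω M ⧸ nullIdeal ω M))

noncomputable instance : Algebra ℂ (Ultraproduct ω M) :=
  inferInstanceAs (Algebra ℂ (normalizerAlg ω M ⧸ nullIdeal ω M))

variable {ω M} in
/-- The class `q(s)` in `M^ω` of the sequence `s`. -/
noncomputable def Ultraproduct.mk : normalizerAlg ω M →+* Ultraproduct ω M := Ideal.Quotient.mk (nullIdeal ω M)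

noncomputable instance : Star (Ultraproduct ω M) where
  star := Quotient.map' star (by
    intro a b hab
    rw [Submodule.quotientRel_def] at hab ⊢
    have h : IsNullSeq ω (star ((a - b : normalizerAlg ω M) : ℕ → M)) := IsNullSeq.star hab
    have e : star ((a - b : normalizerAlg ω M) : ℕ → M) =
        ((star a - star b : normalizerAlg ω M) : ℕ → M) := by
      funext n
      exact star_sub _ _
    rw [e] at h
    exact h)

theorem Ultraproduct.star_mk (s : normalizerAlg ω M) :
    star (Ultraproduct.mk s) = Ultraproduct.mk (star s) := rfl

theorem Ultraproduct.mk_surjective :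
    Function.Surjective (Ultraproduct.mk : normalizerAlg ω M →+* Ultraproduct ω M) :=
  Ideal.Quotient.mk_surjective

noncomputable instance : StarRing (Ultraproduct ω M) where
  star_involutive x := by
    obtain ⟨s, rfl⟩ := Ultraproduct.mk_surjective ω M x
    exact congrArg Ultraproduct.mk (star_star s)
  star_mul x y := by
    obtain ⟨s, rfl⟩ := Ultraproduct.mk_surjective ω M x
    obtain ⟨t, rfl⟩ := Ultraproduct.mk_surjective ω M y
    exact congrArg Ultraproduct.mk (star_mul s t)
  star_add x y := by
    obtain ⟨s, rfl⟩ := Ultraproduct.mk_surjective ω M x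
    obtain ⟨t, rfl⟩ := Ultraproduct.mk_surjective ω M y
    exact congrArg Ultraproduct.mk (star_add s t)

instance : StarModule ℂ (Ultraproduct ω M) where
  star_smul c x := by
    obtain ⟨s, rfl⟩ := Ultraproduct.mk_surjective ω M x
    have h : ∀ (c : ℂ) (s : normalizerAlg ω M),
        c • Ultraproduct.mk s = Ultraproduct.mk (c • s) := fun _ _ => rfl
    rw [h, Ultraproduct.star_mk, star_smul, Ultraproduct.star_mk, h]

/-- The embedding of `M` into `M^ω` as the (classes of) constant sequences. -/
noncomputable def constEmb (x : M) : Ultraproduct ω M :=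
  Ultraproduct.mk ⟨fun _ => x, isBddSeq_const x, fun _ ht => ⟨ht.const_mul x, ht.mul_const x⟩⟩

/-- `M_ω = 𝒞_ω / 𝒯_ω ⊆ M^ω`: the classes of `ω`-centralizing sequences. -/
def centralPart : Set (Ultraproduct ω M) :=
  {x | ∃ s : normalizerAlg ω M, IsCentralizingSeq ω (s : ℕ → M) ∧ Ultraproduct.mk s = x}

variable {ω M}

/-- The unital `*`-subalgebra `S` of `M^ω` is a von Neumann subalgebra: it contains every `x ∈ M^ω`
which is a limit of a bounded net from `S` in the strong operator topology. On bounded sets that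
topology is given by the seminorms `q((sₙ)ₙ) ↦ lim_ω ‖sₙ ξ‖`, `ξ ∈ H`, which come from the normal
positive functionals `⟨ξ, τ^ω(·) ξ⟩`. -/
def IsVNSubalgebra (S : StarSubalgebra ℂ (Ultraproduct ω M)) : Prop :=
  ∀ (x : Ultraproduct ω M) (C : ℝ),
    (∀ (F : Finset H) (ε : ℝ), 0 < ε → ∃ y ∈ S, ∃ s : normalizerAlg ω M,
      Ultraproduct.mk s = x - y ∧ (∀ n, ‖((s : ℕ → M) n : H →L[ℂ] H)‖ ≤ C) ∧
        ∀ ξ ∈ F, ∀ᶠ n in (ω : Filter ℕ), ‖((s : ℕ → M) n : H →L[ℂ] H) ξ‖ < ε) → x ∈ S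

/-- `S` is a countably generated von Neumann subalgebra of `M^ω`: it is the smallest von Neumann
subalgebra containing some countable set. -/
def IsCountablyGeneratedVN (S : StarSubalgebra ℂ (Ultraproduct ω M)) : Prop :=
  IsVNSubalgebra S ∧ ∃ D : Set (Ultraproduct ω M), D.Countable ∧ D ⊆ S ∧
    ∀ S' : StarSubalgebra ℂ (Ultraproduct ω M), IsVNSubalgebra S' → D ⊆ S' → S ≤ S'

variable {m : Type*} [Fintype m] [DecidableEq m]

open Classical in
/-- The lift `β^ω : M^ω → M^ω ⊗ B(ℂᵐ)` of a unital normal `*`-homomorphism `β : M → M ⊗ B(ℂᵐ)`,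
`q((sₙ)ₙ) ↦ q((β(sₙ))ₙ)`. When `β` has a left inverse, as is the case for the
components of a cocycle action, `(β(sₙ))ₙ` lies in `𝒩(𝒯_ω) ⊗ B(ℂᵐ)` and its class only depends
on `q((sₙ)ₙ)`. -/
noncomputable def ultraLift (ω : Ultrafilter ℕ) (β : M → Matrix m m M) (x : Ultraproduct ω M) :
    Matrix m m (Ultraproduct ω M) :=
  Matrix.of fun i j =>
    if h : (fun n => β (((Quotient.out x : normalizerAlg ω M) : ℕ → M) n) i j) ∈ normalizerAlg ω M
    then Ultraproduct.mk ⟨_, h⟩ else 0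

/-- `β` is properly centrally nontrivial: there is no nonzero `a ∈ M ⊗ B(ℂᵐ)` such that
`β^ω(x) a = (x ⊗ 1) a` for all `x ∈ M_ω`. -/
def IsProperlyCentrallyNontrivial (ω : Ultrafilter ℕ) (β : M → Matrix m m M) : Prop :=
  ¬ ∃ a : Matrix m m M, a ≠ 0 ∧ ∀ x ∈ centralPart ω M,
    ultraLift ω β x * a.map (constEmb ω M) = amp m x * a.map (constEmb ω M)

/-- `β` is strongly outer: for every countably generated von Neumann subalgebra `S ⊆ M^ω`
there is no nonzero `a ∈ M^ω ⊗ B(ℂᵐ)` such that `β^ω(y) a = a (y ⊗ 1)` for all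
`y ∈ S' ∩ M_ω`. -/
def IsStronglyOuter (ω : Ultrafilter ℕ) (β : M → Matrix m m M) : Prop :=
  ∀ S : StarSubalgebra ℂ (Ultraproduct ω M), IsCountablyGeneratedVN S →
    ¬ ∃ a : Matrix m m (Ultraproduct ω M), a ≠ 0 ∧
      ∀ y ∈ centralPart ω M, (∀ s ∈ S, s * y = y * s) → ultraLift ω β y * a = a * amp m y

variable {L : Type*} [NormedAddCommGroup L] [InnerProductSpace ℂ L] [CompleteSpace L]
  {G : CompactKacAlgebra L} {R : IrrSystem G}

/-- `(α, u)` is centrally free: `α_π` is properly centrally nontrivial for every `π ≠ 1`. -/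
def CocycleAction.IsCentrallyFree (ω : Ultrafilter ℕ) (c : CocycleAction R M) : Prop :=
  ∀ π, π ≠ Irr.triv G → IsProperlyCentrallyNontrivial ω (c.α π)

/-- `(α, u)` is strongly free: `α_π` is strongly outer for every `π ≠ 1`. -/
def CocycleAction.IsStronglyFree (ω : Ultrafilter ℕ) (c : CocycleAction R M) : Prop :=
  ∀ π, π ≠ Irr.triv G → IsStronglyOuter ω (c.α π)

end Ultra

/-! ### The AFD factor of type II₁ -/

section Factor

variable {H : Type*} [NormedAddCommGroup H] [InnerProductSpace ℂ H] [CompleteSpace H]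

/-- `M` is an approximately finite dimensional factor of type II₁: an infinite-dimensional factor
with a faithful normal tracial state, generated as a von Neumann algebra by an increasing sequence
of finite-dimensional `*`-subalgebras. -/
structure IsAFDFactorTypeIIOne (M : VonNeumannAlgebra H) : Prop where
  factor : ∀ z : M, (∀ x : M, z * x = x * z) → ∃ c : ℂ, z = algebraMap ℂ M c
  infinite_dimensional : ¬ FiniteDimensional ℂ M
  exists_trace : ∃ τ : M →ₗ[ℂ] ℂ, IsNormalFunctional M τ ∧ τ 1 = 1 ∧
    (∀ x y, τ (x * y) = τ (y * x)) ∧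
    (∀ x, ∃ r : ℝ, 0 ≤ r ∧ τ (star x * x) = (r : ℂ)) ∧
    ∀ x, τ (star x * x) = 0 → x = 0
  approximately_finite : ∃ N : ℕ → StarSubalgebra ℂ (H →L[ℂ] H), Monotone N ∧
    (∀ n, FiniteDimensional ℂ (N n)) ∧
    Set.centralizer (Set.centralizer (⋃ n, (N n : Set (H →L[ℂ] H)))) = (M : Set (H →L[ℂ] H))

end Factor

end KacAction

/-! Statements about `M^ω` become statements about bounded sequences in `M`: a sequence is
centralizing when its commutator with every bounded sequence is weakly null, and the lift of `β =
α_π` acts termwise. For this lift to make sense, `β` must send the normalizer of the null sequences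
to itself (`CocycleAction.preservesNormalizer`). Let `ρ` be conjugate to `π`. Applying the unitary
`u` to invariant vectors of `ρ·π` and `π·ρ` gives columns `W`, `W'` intertwining the identity with
`α_ρ α_π` and `α_π α_ρ`, and the cocycle identity makes them satisfy a conjugate equation. With it,
a product of a null sequence and entries of `α_π(s)` is rewritten so that `s` itself multiplies a
null sequence. The invariant vectors exist because traciality of `h` makes the matrix of adjoints of
a unitary representation unitary; complete reducibility is used to apply the coproduct blocks.

Strong freeness implies central freeness because constants commute with `M_ω`, so for a constant `a`
the two intertwining relations coincide.

For the converse (`IsProperlyCentrallyNontrivial.isStronglyOuter`), suppose `a` over `M^ω`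
intertwines `β^ω` on `S' ∩ M_ω`, and let `b` over `M` be the weak limit of `aa*`; it is nonzero.
Given `x` in `M_ω`, a fast reindexing of `x` gives `y` in `M_ω` commuting with `S` and with the
entries of `a`, so `(β^ω(y) - y ⊗ 1)aa* = 0`. Since the reindexing can be as fast as desired, the
limits along the index of `x` and that of `a` can be separated, and `(β^ω(x) - x ⊗ 1)b = 0` follows,
against central freeness.

On the AFD factor of type II₁ with finite-dimensional algebras `N n`, central freeness gives
freeness by applying a global intertwiner termwise. Conversely
(`IsAFDFactorTypeIIOne.isProperlyCentrallyNontrivial`), let `a ≠ 0` be an intertwiner on `M_ω`.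
Unitaries commuting with larger and larger `N n` form centralizing sequences, so for one `n` every
`β(v)a(v* ⊗ 1)`, with `v` a unitary of `(N n)' ∩ M`, has inner product at least half of `‖a‖₂²` with
`a`. Averaging over these `v` gives a nonzero intertwiner on `(N n)' ∩ M` (`exists_average`). A
minimal projection `p` of `N n` turns it into one on the corner `pMp` (`exists_corner_intertwiner`),
and a second averaging, over all unitaries of `M`, makes it global (`exists_intertwiner_of_corner`).
-/

namespace KacAction

/-! ### Weak limits of bounded sequences along an ultrafilter -/

section WeakLimits

variable {H : Type*} [NormedAddCommGroup H] [InnerProductSpace ℂ H]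

theorem norm_inner_apply_le (T : H →L[ℂ] H) {C : ℝ} (hT : ‖T‖ ≤ C) (η ξ : H) :
    ‖⟪η, T ξ⟫_ℂ‖ ≤ C * ‖η‖ * ‖ξ‖ :=
  calc ‖⟪η, T ξ⟫_ℂ‖ ≤ ‖η‖ * ‖T ξ‖ := norm_inner_le_norm _ _
    _ ≤ ‖η‖ * (C * ‖ξ‖) := by gcongr; exact T.le_of_opNorm_le hT ξ
    _ = C * ‖η‖ * ‖ξ‖ := by ring

theorem exists_tendsto_of_norm_le (ω : Ultrafilter ℕ) {f : ℕ → ℂ} {C : ℝ} (hf : ∀ n, ‖f n‖ ≤ C) :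
    ∃ z, Tendsto f ω (𝓝 z) ∧ ‖z‖ ≤ C := by
  obtain ⟨z, hz, h⟩ := isCompact_iff_ultrafilter_le_nhds.1
    (isCompact_closedBall (0 : ℂ) C) (ω.map f) (by
      rw [le_principal_iff]
      exact mem_map.2 (Filter.univ_mem' fun n => by simpa using hf n))
  exact ⟨z, h, by simpa using hz⟩

variable [CompleteSpace H]

/-- Bounded sequences of operators converge in the weak operator topology along ultrafilters. -/
theorem exists_weak_limit_operator (ω : Ultrafilter ℕ) {T : ℕ → H →L[ℂ] H} {C : ℝ}
    (hT : ∀ n, ‖T n‖ ≤ C) :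
    ∃ S : H →L[ℂ] H, ∀ η ξ, Tendsto (fun n => ⟪η, T n ξ⟫_ℂ) ω (𝓝 ⟪η, S ξ⟫_ℂ) := by
  -- The matrix coefficients converge by compactness of discs; their limits form a bounded
  -- sesquilinear form, and Riesz representation returns the operator.
  have key : ∀ ξ η, ∃ z, Tendsto (fun n => ⟪T n ξ, η⟫_ℂ) ω (𝓝 z) ∧ ‖z‖ ≤ C * ‖ξ‖ * ‖η‖ := by
    intro ξ η
    refine exists_tendsto_of_norm_le ω fun n => ?_
    rw [norm_inner_symm]
    calc _ ≤ C * ‖η‖ * ‖ξ‖ := norm_inner_apply_le _ (hT n) η ξ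
      _ = _ := by ring
  choose B hB hBn using key
  have add1 : ∀ ξ ξ' η, B (ξ + ξ') η = B ξ η + B ξ' η := fun ξ ξ' η =>
    tendsto_nhds_unique (hB _ _) (by simpa [inner_add_left] using (hB ξ η).add (hB ξ' η))
  have smul1 : ∀ (c : ℂ) ξ η, B (c • ξ) η = (starRingEnd ℂ) c * B ξ η := fun c ξ η =>
    tendsto_nhds_unique (hB _ _) (by
      simpa [inner_smul_left, mul_comm] using (hB ξ η).const_mul ((starRingEnd ℂ) c))
  have add2 : ∀ ξ η η', B ξ (η + η') = B ξ η + B ξ η' := fun ξ η η' =>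
    tendsto_nhds_unique (hB _ _) (by simpa [inner_add_right] using (hB ξ η).add (hB ξ η'))
  have smul2 : ∀ (c : ℂ) ξ η, B ξ (c • η) = c * B ξ η := fun c ξ η =>
    tendsto_nhds_unique (hB _ _) (by simpa [inner_smul_right] using (hB ξ η).const_mul _)
  let B₁ : H →ₗ⋆[ℂ] H →ₗ[ℂ] ℂ := LinearMap.mk₂'ₛₗ (starRingEnd ℂ) (RingHom.id ℂ) B add1 smul1 add2
    smul2
  let B₂ : H →L⋆[ℂ] H →L[ℂ] ℂ := LinearMap.mkContinuous₂ B₁ C hBn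
  refine ⟨InnerProductSpace.continuousLinearMapOfBilin B₂, fun η ξ => ?_⟩
  have h := (hB ξ η).star
  have e : star (B ξ η) = ⟪η, InnerProductSpace.continuousLinearMapOfBilin B₂ ξ⟫_ℂ := by
    rw [← inner_conj_symm, InnerProductSpace.continuousLinearMapOfBilin_apply]
    rfl
  rw [e] at h
  simpa using h

variable {M : VonNeumannAlgebra H} {ω : Ultrafilter ℕ}

/-- Convergence of a sequence in `M` along `ω` in the weak operator topology. -/
def WeakTendsto (ω : Ultrafilter ℕ) (s : ℕ → M) (x : M) : Prop :=
  ∀ η ξ : H, Tendsto (fun n => ⟪η, (s n : H →L[ℂ] H) ξ⟫_ℂ) ω (𝓝 ⟪η, (x : H →L[ℂ] H) ξ⟫_ℂ)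

/-- Commutation with the commutant of `M` passes to weak limits, so the limit operator stays in `M`
by the double commutant property. -/
theorem exists_weakTendsto (ω : Ultrafilter ℕ) {s : ℕ → M} (hs : IsBddSeq s) :
    ∃ x, WeakTendsto ω s x := by
  obtain ⟨C, hC⟩ := hs
  obtain ⟨S, hS⟩ := exists_weak_limit_operator ω hC
  refine ⟨⟨S, mem_of_commute_commutant _ _ fun c hc => ?_⟩, hS⟩
  rw [VonNeumannAlgebra.mem_commutant_iff] at hc
  ext ξ
  refine ext_inner_left ℂ fun η => ?_
  have h1 := hS η (c ξ)
  have h2 := hS (star c η) ξ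
  simp only [ContinuousLinearMap.star_eq_adjoint, ContinuousLinearMap.adjoint_inner_left] at h2
  refine tendsto_nhds_unique h2 (h1.congr fun n => ?_)
  have := congrArg (fun t : H →L[ℂ] H => t ξ) (hc (s n) (s n).2)
  simp only [mul_apply_eq_comp] at this
  rw [this]

namespace WeakTendsto

variable {s t : ℕ → M} {x y : M}

theorem unique (h : WeakTendsto ω s x) (h' : WeakTendsto ω s y) : x = y :=
  Subtype.ext <| ContinuousLinearMap.ext fun ξ => ext_inner_left ℂ fun η =>
    tendsto_nhds_unique (h η ξ) (h' η ξ)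

theorem const (x : M) : WeakTendsto ω (fun _ => x) x := fun _ _ => tendsto_const_nhds

theorem add (h : WeakTendsto ω s x) (h' : WeakTendsto ω t y) :
    WeakTendsto ω (fun n => s n + t n) (x + y) := fun η ξ => by
  simpa [inner_add_right] using (h η ξ).add (h' η ξ)

theorem sub (h : WeakTendsto ω s x) (h' : WeakTendsto ω t y) :
    WeakTendsto ω (fun n => s n - t n) (x - y) := fun η ξ => by
  simpa [inner_sub_right] using (h η ξ).sub (h' η ξ)

theorem sum {ι : Type*} {I : Finset ι} {s : ι → ℕ → M} {x : ι → M}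
    (h : ∀ i ∈ I, WeakTendsto ω (s i) (x i)) :
    WeakTendsto ω (fun n => ∑ i ∈ I, s i n) (∑ i ∈ I, x i) := by
  classical
  induction I using Finset.induction_on with
  | empty => simpa using const (0 : M)
  | insert a I ha ih =>
    simp only [Finset.sum_insert ha]
    exact (h a (by simp)).add (ih fun i hi => h i (by simp [hi]))

theorem mul_const (h : WeakTendsto ω s x) (y : M) : WeakTendsto ω (fun n => s n * y) (x * y) :=
  fun η ξ => by simpa using h η ((y : H →L[ℂ] H) ξ)

theorem const_mul (y : M) (h : WeakTendsto ω s x) : WeakTendsto ω (fun n => y * s n) (y * x) :=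
  fun η ξ => by
    simpa [ContinuousLinearMap.star_eq_adjoint, ContinuousLinearMap.adjoint_inner_left]
      using h (star (y : H →L[ℂ] H) η) ξ

theorem star (h : WeakTendsto ω s x) : WeakTendsto ω (fun n => star (s n)) (star x) := fun η ξ => by
  have := (h ξ η).star
  simpa [ContinuousLinearMap.star_eq_adjoint, ContinuousLinearMap.adjoint_inner_right] using this

/-- Normal functionals are continuous along bounded weakly convergent sequences. -/
theorem map_normal (h : WeakTendsto ω s x) (hs : IsBddSeq s) {φ : M → ℂ}
    (hφ : IsNormalFunctional M φ) : Tendsto (fun n => φ (s n)) ω (𝓝 (φ x)) := by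
  obtain ⟨ξ, η, hξ, hη, hφ⟩ := hφ
  obtain ⟨C, hC⟩ := hs
  simp only [hφ]
  refine tendsto_tsum_of_dominated_convergence
    (bound := fun k => C * (‖η k‖ ^ 2 + ‖ξ k‖ ^ 2)) ((hη.add hξ).mul_left C)
    (fun k => h (η k) (ξ k)) (Eventually.of_forall fun n k => ?_)
  have hC0 : 0 ≤ C := (norm_nonneg _).trans (hC n)
  calc _ ≤ C * ‖η k‖ * ‖ξ k‖ := norm_inner_apply_le _ (hC n) _ _
    _ = C * (‖η k‖ * ‖ξ k‖) := by ring
    _ ≤ _ := by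
      gcongr
      nlinarith [sq_nonneg (‖η k‖ - ‖ξ k‖), sq_nonneg (‖η k‖), sq_nonneg (‖ξ k‖)]

theorem of_strong (h : ∀ ξ, Tendsto (fun n => (s n : H →L[ℂ] H) ξ) ω (𝓝 ((x : H →L[ℂ] H) ξ))) :
    WeakTendsto ω s x := fun _ ξ => tendsto_const_nhds.inner (h ξ)

end WeakTendsto

theorem inner_star_mul_self (x : M) (ξ : H) :
    ⟪ξ, ((star x * x : M) : H →L[ℂ] H) ξ⟫_ℂ = (‖(x : H →L[ℂ] H) ξ‖ ^ 2 : ℝ) := by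
  have : ((star x * x : M) : H →L[ℂ] H) ξ
      = star (x : H →L[ℂ] H) ((x : H →L[ℂ] H) ξ) := rfl
  rw [this, ContinuousLinearMap.star_eq_adjoint, ContinuousLinearMap.adjoint_inner_right,
    inner_self_eq_norm_sq_to_K]
  norm_cast

/-- The coefficient of `s*s` at `ξ` is `‖sξ‖²`. This is the usual route below from algebraic
identities between weak limits to strong convergence. -/
theorem WeakTendsto.strong_of_star_mul {s : ℕ → M}
    (h : WeakTendsto ω (fun n => Star.star (s n) * s n) 0) (ξ : H) :
    Tendsto (fun n => (s n : H →L[ℂ] H) ξ) ω (𝓝 0) := by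
  have h1 := h ξ ξ
  simp only [inner_star_mul_self] at h1
  have h2 : Tendsto (fun n => ‖(s n : H →L[ℂ] H) ξ‖ ^ 2) ω (𝓝 0) := by
    have := (Complex.continuous_re.tendsto _).comp h1
    simpa [Function.comp_def, ← Complex.ofReal_pow] using this
  rw [tendsto_zero_iff_norm_tendsto_zero]
  have h3 := h2.sqrt
  simpa using h3

theorem tendsto_apply_of_strong {s : ℕ → M} (hs : IsBddSeq s) {v : ℕ → H}
    (hv : Tendsto v ω (𝓝 0)) : Tendsto (fun n => (s n : H →L[ℂ] H) (v n)) ω (𝓝 0) := by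
  obtain ⟨C, hC⟩ := hs
  rw [tendsto_zero_iff_norm_tendsto_zero] at hv ⊢
  refine squeeze_zero (fun _ => norm_nonneg _)
    (fun n => (s n : H →L[ℂ] H).le_of_opNorm_le (hC n) (v n)) ?_
  simpa using hv.const_mul C

end WeakLimits

/-! ### Vector functionals and square roots in `M` -/

section NormalFunctionals

variable {H : Type*} [NormedAddCommGroup H] [InnerProductSpace ℂ H] [CompleteSpace H]
  {M : VonNeumannAlgebra H}

/-- Vector functionals are normal. -/
theorem isNormalFunctional_inner (η ξ : H) :
    IsNormalFunctional M fun x => ⟪η, (x : H →L[ℂ] H) ξ⟫_ℂ := by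
  refine ⟨fun n => if n = 0 then ξ else 0, fun n => if n = 0 then η else 0, ?_, ?_, fun x => ?_⟩
  · exact summable_of_ne_finset_zero (s := {0}) (by intro b hb; simp at hb; simp [hb])
  · exact summable_of_ne_finset_zero (s := {0}) (by intro b hb; simp at hb; simp [hb])
  · rw [tsum_eq_single 0 (by intro b hb; simp [hb])]
    simp

/-- A positive operator of `M` has a square root in `M` commuting with everything that commutes with it. -/
theorem exists_sqrt_mem (t : M) (ht : ∀ ξ, ∃ r : ℝ, 0 ≤ r ∧ ⟪(t : H →L[ℂ] H) ξ, ξ⟫_ℂ = r) :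
    ∃ y : M, star y = y ∧ y * y = t ∧ ∀ z : H →L[ℂ] H, Commute z (t : H →L[ℂ] H) →
      Commute z (y : H →L[ℂ] H) := by
  have ht' : (0 : H →L[ℂ] H) ≤ (t : H →L[ℂ] H) := by
    rw [ContinuousLinearMap.nonneg_iff_isPositive,
      ContinuousLinearMap.isPositive_iff_complex]
    intro ξ
    obtain ⟨r, hr, h⟩ := ht ξ
    rw [h]
    exact ⟨rfl, hr⟩
  have hc : ∀ z : H →L[ℂ] H, Commute z (t : H →L[ℂ] H) →
      Commute z (CFC.sqrt (t : H →L[ℂ] H)) := fun z hz => by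
    rw [CFC.sqrt_eq_cfc]
    exact (hz.symm.cfc_nnreal _).symm
  refine ⟨⟨CFC.sqrt (t : H →L[ℂ] H), mem_of_commute_commutant _ _ fun c hc' => ?_⟩,
    Subtype.ext ?_, Subtype.ext ?_, hc⟩
  · rw [VonNeumannAlgebra.mem_commutant_iff] at hc'
    exact hc c (hc' t t.2).symm
  · exact (IsSelfAdjoint.of_nonneg (CFC.sqrt_nonneg (t : H →L[ℂ] H))).star_eq
  · exact CFC.sqrt_mul_sqrt_self (t : H →L[ℂ] H) ht'

end NormalFunctionals

end KacAction
namespace KacAction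

/-! ### Null, normalizing and centralizing sequences -/

section Sequences

variable {H : Type*} [NormedAddCommGroup H] [InnerProductSpace ℂ H] [CompleteSpace H]
  {M : VonNeumannAlgebra H} {ω : Ultrafilter ℕ}

theorem coe_mul_apply (x y : M) (ξ : H) :
    ((x * y : M) : H →L[ℂ] H) ξ = (x : H →L[ℂ] H) ((y : H →L[ℂ] H) ξ) := rfl

theorem norm_star_coe (x : M) : ‖((star x : M) : H →L[ℂ] H)‖ = ‖(x : H →L[ℂ] H)‖ := norm_star _

theorem inner_star_apply (x : M) (η ξ : H) :
    ⟪((star x : M) : H →L[ℂ] H) η, ξ⟫_ℂ = ⟪η, (x : H →L[ℂ] H) ξ⟫_ℂ := by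
  change ⟪star (x : H →L[ℂ] H) η, ξ⟫_ℂ = _
  rw [ContinuousLinearMap.star_eq_adjoint, ContinuousLinearMap.adjoint_inner_left]

theorem inner_apply_star (x : M) (η ξ : H) :
    ⟪η, ((star x : M) : H →L[ℂ] H) ξ⟫_ℂ = ⟪(x : H →L[ℂ] H) η, ξ⟫_ℂ := by
  rw [← inner_conj_symm, inner_star_apply, inner_conj_symm]

theorem IsBddSeq.neg {s : ℕ → M} (hs : IsBddSeq s) : IsBddSeq (-s) := by
  obtain ⟨C, hC⟩ := hs
  exact ⟨C, fun n => by simpa using hC n⟩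

theorem IsBddSeq.sub {s t : ℕ → M} (hs : IsBddSeq s) (ht : IsBddSeq t) : IsBddSeq (s - t) := by
  rw [sub_eq_add_neg]
  exact hs.add ht.neg

theorem isBddSeq_sum {ι : Type*} {I : Finset ι} {s : ι → ℕ → M} (h : ∀ i ∈ I, IsBddSeq (s i)) :
    IsBddSeq (fun n => ∑ i ∈ I, s i n) := by
  classical
  induction I using Finset.induction_on with
  | empty => simpa using isBddSeq_const (0 : M)
  | insert a I ha ih =>
    simp only [Finset.sum_insert ha]
    exact (h a (by simp)).add (ih fun i hi => h i (by simp [hi]))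

theorem IsBddSeq.comp {s : ℕ → M} (hs : IsBddSeq s) (k : ℕ → ℕ) : IsBddSeq fun n => s (k n) := by
  obtain ⟨C, hC⟩ := hs
  exact ⟨C, fun n => hC _⟩

theorem isNullSeq_sum {ι : Type*} {I : Finset ι} {s : ι → ℕ → M}
    (h : ∀ i ∈ I, IsNullSeq ω (s i)) : IsNullSeq ω (fun n => ∑ i ∈ I, s i n) := by
  classical
  induction I using Finset.induction_on with
  | empty => simp only [Finset.sum_empty]; exact isNullSeq_zero
  | insert a I ha ih =>
    simp only [Finset.sum_insert ha]
    exact (h a (by simp)).add (ih fun i hi => h i (by simp [hi]))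

theorem WeakTendsto.isNullSeq_of_star_mul {s : ℕ → M} (hs : IsBddSeq s)
    (h : WeakTendsto ω (fun n => Star.star (s n) * s n) 0)
    (h' : WeakTendsto ω (fun n => s n * Star.star (s n)) 0) : IsNullSeq ω s :=
  ⟨hs, h.strong_of_star_mul, fun ξ =>
    WeakTendsto.strong_of_star_mul (s := fun n => Star.star (s n)) (by simpa using h') ξ⟩

/-- Moving `t` to the other side of the inner product, `⟪t*η, bξ⟫` is small because `t*η → 0` and
`bξ` is bounded. -/
theorem IsNullSeq.weakTendsto_mul {t b : ℕ → M} (ht : IsNullSeq ω t) (hb : IsBddSeq b) :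
    WeakTendsto ω (fun n => t n * b n) 0 := by
  intro η ξ
  obtain ⟨C, hC⟩ := hb
  have h1 := (ht.2.2 η).norm.mul_const (C * ‖ξ‖)
  simp only [norm_zero, zero_mul] at h1
  have : Tendsto (fun n => ⟪η, ((t n * b n : M) : H →L[ℂ] H) ξ⟫_ℂ) ω (𝓝 0) := by
    refine squeeze_zero_norm (fun n => ?_) h1
    rw [coe_mul_apply, ← inner_star_apply]
    exact (norm_inner_le_norm _ _).trans
      (mul_le_mul_of_nonneg_left ((b n : H →L[ℂ] H).le_of_opNorm_le (hC n) ξ) (norm_nonneg _))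
  simpa using this

theorem IsNullSeq.weakTendsto {t : ℕ → M} (ht : IsNullSeq ω t) : WeakTendsto ω t 0 := by
  simpa using ht.weakTendsto_mul (isBddSeq_const 1)

theorem const_mem_normalizerAlg (x : M) : (fun _ => x) ∈ normalizerAlg ω M :=
  ⟨isBddSeq_const x, fun _ ht => ⟨ht.const_mul x, ht.mul_const x⟩⟩

/-- In `M^ω` a sequence converging strongly to zero converges `*`-strongly to zero. -/
theorem isNullSeq_of_strong {s : ℕ → M} (hs : s ∈ normalizerAlg ω M)
    (h : ∀ ξ, Tendsto (fun n => (s n : H →L[ℂ] H) ξ) ω (𝓝 0)) : IsNullSeq ω s := by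
  have hstar : star s ∈ normalizerAlg ω M := star_mem hs
  have ht : IsNullSeq ω (star s * s) := by
    have h1 : ∀ ξ, Tendsto (fun n => ((star s * s) n : H →L[ℂ] H) ξ) ω (𝓝 0) := fun ξ =>
      tendsto_apply_of_strong hs.1.star (h ξ)
    refine ⟨hs.1.star.mul hs.1, h1, fun ξ => ?_⟩
    refine (h1 ξ).congr fun n => ?_
    have : (star (((star s * s) n : M) : H →L[ℂ] H)) = ((star ((star s * s) n) : M) : H →L[ℂ] H) :=
      rfl
    rw [this]
    simp
  -- The normalizer property makes `s(s*s)s* = (ss*)²` null. Hence `ss*`, and then `s*`, tends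
  -- strongly to zero.
  have h2 := (hs.2 _ ((hstar.2 _ ht).2)).1
  refine WeakTendsto.isNullSeq_of_star_mul hs.1 ht.weakTendsto ?_
  have h3 : ∀ ξ, Tendsto (fun n => ((s n * star (s n) : M) : H →L[ℂ] H) ξ) ω (𝓝 0) := by
    refine WeakTendsto.strong_of_star_mul (s := fun n => s n * star (s n)) ?_
    convert h2.weakTendsto using 2 with n
    simp [mul_assoc]
  exact WeakTendsto.of_strong (by simpa using h3)

/-- The uniformity over the unit ball comes for free: if it failed, one could choose for each bad
`n` a violating `y n`, and the resulting bounded sequence would contradict the weak convergence. -/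
theorem isCentralizingSeq_of_weakTendsto {s : ℕ → M} (hs : IsBddSeq s)
    (h : ∀ y : ℕ → M, (∀ n, ‖(y n : H →L[ℂ] H)‖ ≤ 1) →
      WeakTendsto ω (fun n => s n * y n - y n * s n) 0) : IsCentralizingSeq ω s := by
  refine ⟨hs, fun φ hφ ε hε => ?_⟩
  by_contra hcon
  rw [← Ultrafilter.eventually_not] at hcon
  have : ∀ n, ∃ y : M, ‖(y : H →L[ℂ] H)‖ ≤ 1 ∧
      ((¬ ∀ y : M, ‖(y : H →L[ℂ] H)‖ ≤ 1 → ‖φ (s n * y) - φ (y * s n)‖ ≤ ε) →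
        ε < ‖φ (s n * y) - φ (y * s n)‖) := fun n => by
    by_cases hn : ∀ y : M, ‖(y : H →L[ℂ] H)‖ ≤ 1 → ‖φ (s n * y) - φ (y * s n)‖ ≤ ε
    · exact ⟨0, by simp, fun h => absurd hn h⟩
    · push Not at hn
      obtain ⟨y, hy, hy'⟩ := hn
      exact ⟨y, hy, fun _ => hy'⟩
  choose y hy hy' using this
  have hyb : IsBddSeq y := ⟨1, hy⟩
  have h1 := (h y hy).map_normal ((hs.mul hyb).sub (hyb.mul hs)) hφ
  have hadd : ∀ a b : M, φ (a - b) = φ a - φ b := by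
    obtain ⟨ξ, η, hξ, hη, hφ⟩ := hφ
    have sm : ∀ a : M, Summable fun n => ⟪η n, (a : H →L[ℂ] H) (ξ n)⟫_ℂ := fun a => by
      refine Summable.of_norm_bounded ((hη.add hξ).mul_left ‖(a : H →L[ℂ] H)‖) fun n => ?_
      refine (norm_inner_apply_le _ le_rfl _ _).trans ?_
      rw [mul_assoc]
      gcongr
      nlinarith [sq_nonneg (‖η n‖ - ‖ξ n‖), sq_nonneg (‖η n‖), sq_nonneg (‖ξ n‖)]
    intro a b
    rw [hφ, hφ, hφ, ← (sm a).tsum_sub (sm b)]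
    refine tsum_congr fun n => ?_
    rw [← inner_sub_right]; rfl
  have h0 : φ 0 = 0 := by simpa using hadd 0 0
  rw [h0] at h1
  have h2 := (Metric.tendsto_nhds.1 h1) ε hε
  obtain ⟨n, hn1, hn2⟩ := (hcon.and h2).exists
  have h3 := hy' n hn1
  rw [dist_zero_right, hadd] at hn2
  exact absurd h3 (not_lt.2 hn2.le)

/-- The working form of the definition: it is algebraic in the sequences and refers to no
functional. -/
theorem isCentralizingSeq_iff {s : ℕ → M} : IsCentralizingSeq ω s ↔
    IsBddSeq s ∧ ∀ y : ℕ → M, IsBddSeq y → WeakTendsto ω (fun n => s n * y n - y n * s n) 0 := by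
  constructor
  · rintro ⟨hs, h⟩
    refine ⟨hs, fun y ⟨C, hC⟩ η ξ => ?_⟩
    have hC0 : 0 ≤ C := (norm_nonneg _).trans (hC 0)
    simp only [ZeroMemClass.coe_zero, zero_apply, inner_zero_right]
    rw [Metric.tendsto_nhds]
    intro ε hε
    -- The bound `C` may be zero, so `y` is scaled into the unit ball by `C + 1`.
    have hC1 : 0 < C + 1 := by positivity
    filter_upwards [h _ (isNormalFunctional_inner η ξ) (ε / 2 / (C + 1)) (by positivity)] with n hn
    have h1 := hn (((C + 1 : ℝ) : ℂ)⁻¹ • y n) (by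
      change ‖((C + 1 : ℝ) : ℂ)⁻¹ • (y n : H →L[ℂ] H)‖ ≤ 1
      rw [norm_smul, norm_inv, Complex.norm_real, Real.norm_of_nonneg hC1.le, inv_mul_le_iff₀ hC1]
      linarith [hC n])
    have e : ∀ z : M, ⟪η, ((((C + 1 : ℝ) : ℂ)⁻¹ • z : M) : H →L[ℂ] H) ξ⟫_ℂ =
        ((C + 1 : ℝ) : ℂ)⁻¹ * ⟪η, (z : H →L[ℂ] H) ξ⟫_ℂ := fun z => by
      rw [← inner_smul_right]; rfl
    rw [mul_smul_comm, smul_mul_assoc, e, e, ← mul_sub, norm_mul, norm_inv, Complex.norm_real,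
      Real.norm_of_nonneg hC1.le, inv_mul_le_iff₀ hC1, mul_div_cancel₀ _ hC1.ne'] at h1
    rw [dist_zero_right]
    have e2 : ⟪η, ((s n * y n - y n * s n : M) : H →L[ℂ] H) ξ⟫_ℂ =
      ⟪η, ((s n * y n : M) : H →L[ℂ] H) ξ⟫_ℂ - ⟪η, ((y n * s n : M) : H →L[ℂ] H) ξ⟫_ℂ := by
      rw [← inner_sub_right]; rfl
    rw [e2]
    linarith
  · rintro ⟨hs, h⟩
    exact isCentralizingSeq_of_weakTendsto hs fun y hy => h y ⟨1, hy⟩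

theorem IsCentralizingSeq.star {s : ℕ → M} (hs : IsCentralizingSeq ω s) :
    IsCentralizingSeq ω (star s) := by
  rw [isCentralizingSeq_iff] at hs ⊢
  refine ⟨hs.1.star, fun y hy => ?_⟩
  have h := ((hs.2 _ hy.star).star.const_mul (-1))
  simpa using h

/-- For null `t`, `(ts)*(ts) = s*(t*ts)` differs from `(t*ts)s*` by a weakly null commutator, and
the latter is weakly null because `t` is. The adjoint `s*t*` needs only boundedness of `s`; the
product on the other side follows by taking adjoints. -/
theorem IsCentralizingSeq.mem_normalizerAlg {s : ℕ → M} (hs : IsCentralizingSeq ω s) :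
    s ∈ normalizerAlg ω M := by
  have key : ∀ s : ℕ → M, IsCentralizingSeq ω s → ∀ t, IsNullSeq ω t → IsNullSeq ω (t * s) := by
    intro s hs t ht
    refine ⟨ht.1.mul hs.1, ?_, fun ξ => ?_⟩
    · refine WeakTendsto.strong_of_star_mul ?_
      have h1 := (isCentralizingSeq_iff.1 hs.star).2 _ ((ht.1.star.mul ht.1).mul hs.1)
      have h2 : WeakTendsto ω (fun n => Star.star (t n) * (t n * s n * Star.star (s n))) 0 :=
        ht.star.weakTendsto_mul ((ht.1.mul hs.1).mul hs.1.star)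
      have h3 := h1.add h2
      simp only [add_zero] at h3
      convert h3 using 2 with n
      simp [mul_assoc]
    · have := tendsto_apply_of_strong hs.1.star (ht.2.2 ξ)
      refine this.congr fun n => ?_
      change _ = ((Star.star (t n * s n) : M) : H →L[ℂ] H) ξ
      rw [star_mul]
      rfl
  refine ⟨hs.1, fun t ht => ⟨?_, key s hs t ht⟩⟩
  have := (key _ hs.star _ ht.star).star
  simpa using this

/-- With `z = sa - as` one has `z*z = [s, z*a] - [s, z*]a`, and both commutators are weakly null. -/
theorem IsCentralizingSeq.isNullSeq_commutator {s : ℕ → M} (hs : IsCentralizingSeq ω s) (a : M) :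
    IsNullSeq ω (s * (fun _ => a) - (fun _ => a) * s) := by
  have ha := const_mem_normalizerAlg (ω := ω) a
  have hm := hs.mem_normalizerAlg
  refine isNullSeq_of_strong (sub_mem (mul_mem hm ha) (mul_mem ha hm)) ?_
  refine WeakTendsto.strong_of_star_mul ?_
  set z : ℕ → M := s * (fun _ => a) - (fun _ => a) * s with hz
  have hzb : IsBddSeq z := (hs.1.mul ha.1).sub (ha.1.mul hs.1)
  have h1 := (isCentralizingSeq_iff.1 hs).2 _ (hzb.star.mul ha.1)
  have h2 := ((isCentralizingSeq_iff.1 hs).2 _ hzb.star).mul_const a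
  have h3 := h1.sub h2
  simp only [zero_mul, sub_zero] at h3
  convert h3 using 2 with n
  have : z n = s n * a - a * s n := rfl
  simp only [Pi.mul_apply, Pi.star_apply]
  rw [sub_mul, mul_assoc, mul_assoc, sub_sub_sub_cancel_left, mul_assoc, ← mul_sub, this]

theorem Ultraproduct.mk_eq_mk {s t : normalizerAlg ω M} :
    Ultraproduct.mk s = Ultraproduct.mk t ↔ IsNullSeq ω ((s : ℕ → M) - (t : ℕ → M)) := by
  change Ideal.Quotient.mk (nullIdeal ω M) s = Ideal.Quotient.mk (nullIdeal ω M) t ↔ _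
  rw [Ideal.Quotient.mk_eq_mk_iff_sub_mem]
  rfl

theorem Ultraproduct.mk_eq_zero {s : normalizerAlg ω M} :
    Ultraproduct.mk s = 0 ↔ IsNullSeq ω (s : ℕ → M) := by
  rw [← map_zero (Ultraproduct.mk (ω := ω) (M := M)), Ultraproduct.mk_eq_mk]
  simp

theorem constEmb_mul_comm {y : Ultraproduct ω M} (hy : y ∈ centralPart ω M) (a : M) :
    constEmb ω M a * y = y * constEmb ω M a := by
  obtain ⟨s, hs, rfl⟩ := hy
  rw [constEmb, ← map_mul, ← map_mul, eq_comm, Ultraproduct.mk_eq_mk]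
  exact hs.isNullSeq_commutator a

theorem constEmb_eq_zero {a : M} : constEmb ω M a = 0 ↔ a = 0 := by
  rw [constEmb, Ultraproduct.mk_eq_zero]
  constructor
  · intro h
    exact h.weakTendsto.unique (WeakTendsto.const a) |>.symm
  · rintro rfl
    exact isNullSeq_zero

/-- The `w*`-continuity of left multiplication by centralizing sequences. -/
theorem IsCentralizingSeq.weakTendsto_mul {y s : ℕ → M} (hy : IsCentralizingSeq ω y)
    (hs : IsBddSeq s) : WeakTendsto ω (fun n => Star.star (s n * y n) * (s n * y n) -
      Star.star (s n) * (s n * y n * Star.star (y n))) 0 := by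
  have h1 := (isCentralizingSeq_iff.1 hy.star).2 _ ((hs.star.mul hs).mul hy.1)
  convert h1 using 2 with n
  simp [mul_assoc]

/-- The commutant of a centralizing self-adjoint set in `M^ω` is a von Neumann subalgebra. -/
theorem isVNSubalgebra_centralizer {y : Ultraproduct ω M} (hy : y ∈ centralPart ω M) :
    IsVNSubalgebra (StarSubalgebra.centralizer ℂ {y}) := by
  have main : ∀ y ∈ centralPart ω M, ∀ (x : Ultraproduct ω M) (C : ℝ),
      (∀ (F : Finset H) (ε : ℝ), 0 < ε → ∃ z, (z * y = y * z) ∧ ∃ s : normalizerAlg ω M,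
        Ultraproduct.mk s = x - z ∧ (∀ n, ‖((s : ℕ → M) n : H →L[ℂ] H)‖ ≤ C) ∧
        ∀ ξ ∈ F, ∀ᶠ n in (ω : Filter ℕ), ‖((s : ℕ → M) n : H →L[ℂ] H) ξ‖ < ε) →
      x * y = y * x := by
    intro y hy x C h
    obtain ⟨y, hyc, rfl⟩ := hy
    obtain ⟨x, rfl⟩ := Ultraproduct.mk_surjective ω M x
    have hC0 : 0 ≤ C := by
      obtain ⟨z, -, s, -, hs, -⟩ := h ∅ 1 one_pos
      exact (norm_nonneg _).trans (hs 0)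
    rw [← map_mul, ← map_mul, Ultraproduct.mk_eq_mk]
    refine isNullSeq_of_strong (x * y - y * x : normalizerAlg ω M).2 fun ξ => ?_
    rw [tendsto_zero_iff_norm_tendsto_zero, Metric.tendsto_nhds]
    intro ε hε
    obtain ⟨D, hD⟩ := hyc.1
    have hD0 : 0 ≤ D := (norm_nonneg _).trans (hD 0)
    -- `K` dominates both the bound `CD²‖ξ‖` for `syy*ξ` and the bound `D` for `y`; the summand `1`
    -- makes it positive.
    set K : ℝ := C * D * D * ‖ξ‖ + D + 1 with hK
    have hK1 : 1 ≤ K := by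
      have : 0 ≤ C * D * D * ‖ξ‖ := by positivity
      linarith
    have hKD : D ≤ K := by
      have : 0 ≤ C * D * D * ‖ξ‖ := by positivity
      linarith
    have hK0 : 0 < K := by linarith
    obtain ⟨z, hz, s, hs, hsC, hsξ⟩ := h {ξ} (min (ε ^ 2 / 16 / K) (ε / 4 / K)) (by positivity)
    obtain ⟨z, rfl⟩ := Ultraproduct.mk_surjective ω M z
    -- Since `z` commutes with `y`, the commutator of `x` with `y` equals that of the small
    -- difference `s = x - z`.
    have hcomm : IsNullSeq ω ((x * y - y * x : normalizerAlg ω M) -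
        (s * y - y * s : normalizerAlg ω M) : ℕ → M) := by
      rw [← Ultraproduct.mk_eq_mk]
      simp only [map_sub, map_mul, hs, sub_mul, mul_sub, hz]
      abel
    -- Right multiplication by `y` is the delicate half: as `y` is centralizing, `‖syξ‖²` is
    -- asymptotically `⟪sξ, syy*ξ⟫`, which is small when `sξ` is.
    have h1 := (hyc.weakTendsto_mul (s := (s : ℕ → M)) ⟨C, hsC⟩) ξ ξ
    have h2 := hcomm.2.1 ξ
    rw [Metric.tendsto_nhds] at h1 h2
    filter_upwards [h1 (ε ^ 2 / 16) (by positivity), h2 (ε / 4) (by positivity),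
      hsξ ξ (by simp)] with n h1 h2 h3
    have e1 : ⟪ξ, ((star ((s : ℕ → M) n * (y : ℕ → M) n) * ((s : ℕ → M) n * (y : ℕ → M) n) -
      star ((s : ℕ → M) n) * ((s : ℕ → M) n * (y : ℕ → M) n * star ((y : ℕ → M) n)) : M) :
        H →L[ℂ] H) ξ⟫_ℂ = (‖(((s : ℕ → M) n * (y : ℕ → M) n : M) : H →L[ℂ] H) ξ‖ ^ 2 : ℝ) -
        ⟪(((s : ℕ → M) n : M) : H →L[ℂ] H) ξ,
          (((s : ℕ → M) n * (y : ℕ → M) n * star ((y : ℕ → M) n) : M) : H →L[ℂ] H) ξ⟫_ℂ := by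
      rw [← inner_star_mul_self, ← inner_apply_star, ← inner_sub_right]; rfl
    rw [e1] at h1
    simp only [ZeroMemClass.coe_zero, zero_apply, inner_zero_right, dist_zero_right] at h1
    have e2 : ‖⟪(((s : ℕ → M) n : M) : H →L[ℂ] H) ξ,
          (((s : ℕ → M) n * (y : ℕ → M) n * star ((y : ℕ → M) n) : M) : H →L[ℂ] H) ξ⟫_ℂ‖ ≤
        (ε ^ 2 / 16 / K) * K := by
      refine (norm_inner_le_norm _ _).trans (mul_le_mul (h3.le.trans (min_le_left _ _)) ?_
        (norm_nonneg _) (by positivity))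
      calc ‖(((s : ℕ → M) n * (y : ℕ → M) n * star ((y : ℕ → M) n) : M) : H →L[ℂ] H) ξ‖
          ≤ C * (D * (D * ‖ξ‖)) := by
            refine (ContinuousLinearMap.le_of_opNorm_le _ (hsC n) _).trans ?_
            gcongr
            refine (ContinuousLinearMap.le_of_opNorm_le _ (hD n) _).trans ?_
            gcongr
            exact ContinuousLinearMap.le_of_opNorm_le _ (by rw [norm_star_coe]; exact hD n) _
        _ ≤ K := by
            have : C * (D * (D * ‖ξ‖)) = C * D * D * ‖ξ‖ := by ring
            rw [hK, this]
            linarith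
    rw [div_mul_cancel₀ _ hK0.ne'] at e2
    have e3 : ‖(((s : ℕ → M) n * (y : ℕ → M) n : M) : H →L[ℂ] H) ξ‖ ^ 2 ≤ ε ^ 2 / 8 := by
      have := norm_sub_norm_le
        ((‖(((s : ℕ → M) n * (y : ℕ → M) n : M) : H →L[ℂ] H) ξ‖ ^ 2 : ℝ) : ℂ)
        (⟪(((s : ℕ → M) n : M) : H →L[ℂ] H) ξ,
          (((s : ℕ → M) n * (y : ℕ → M) n * star ((y : ℕ → M) n) : M) : H →L[ℂ] H) ξ⟫_ℂ)
      rw [Complex.norm_real, Real.norm_of_nonneg (by positivity)] at this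
      linarith
    have e4 : ‖(((s : ℕ → M) n * (y : ℕ → M) n : M) : H →L[ℂ] H) ξ‖ < ε / 2 := by
      refine lt_of_pow_lt_pow_left₀ 2 (by positivity) ?_
      nlinarith [sq_pos_of_pos hε]
    have e5 : ‖(((y : ℕ → M) n * (s : ℕ → M) n : M) : H →L[ℂ] H) ξ‖ ≤ ε / 4 := by
      calc _ ≤ D * ‖(((s : ℕ → M) n : M) : H →L[ℂ] H) ξ‖ :=
            ContinuousLinearMap.le_of_opNorm_le _ (hD n) _
        _ ≤ K * (ε / 4 / K) := by
            gcongr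
            exact h3.le.trans (min_le_right _ _)
        _ = ε / 4 := by field_simp
    rw [dist_zero_right] at h2
    rw [Real.dist_0_eq_abs, abs_of_nonneg (norm_nonneg _)]
    have e6 : (((x * y - y * x : normalizerAlg ω M) : ℕ → M) n : H →L[ℂ] H) ξ =
        ((((x * y - y * x : normalizerAlg ω M) : ℕ → M) -
          ((s * y - y * s : normalizerAlg ω M) : ℕ → M)) n : H →L[ℂ] H) ξ +
        ((((s : ℕ → M) n * (y : ℕ → M) n : M) : H →L[ℂ] H) ξ -
          (((y : ℕ → M) n * (s : ℕ → M) n : M) : H →L[ℂ] H) ξ) := by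
      exact (sub_add_cancel _ _).symm
    calc _ = ‖(((x * y - y * x : normalizerAlg ω M) : ℕ → M) n : H →L[ℂ] H) ξ‖ := rfl
      _ < ε / 4 + (ε / 2 + ε / 4) := by
        rw [e6]
        refine (norm_add_le _ _).trans_lt (add_lt_add_of_lt_of_le h2 ?_)
        exact (norm_sub_le _ _).trans (add_le_add e4.le e5)
      _ = ε := by ring
  intro x C h
  -- Membership in the centralizer as a `*`-subalgebra requires commuting with `star y` too.
  have hstar : star y ∈ centralPart ω M := by
    obtain ⟨s, hs, rfl⟩ := hy
    exact ⟨star s, hs.star, rfl⟩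
  rw [StarSubalgebra.mem_centralizer_iff]
  rintro _ rfl
  constructor
  · refine (main _ hy x C fun F ε hε => ?_).symm
    obtain ⟨z, hz, s, h⟩ := h F ε hε
    exact ⟨z, ((StarSubalgebra.mem_centralizer_iff ℂ).1 hz _ rfl).1.symm, s, h⟩
  · refine (main _ hstar x C fun F ε hε => ?_).symm
    obtain ⟨z, hz, s, h⟩ := h F ε hε
    exact ⟨z, ((StarSubalgebra.mem_centralizer_iff ℂ).1 hz _ rfl).2.symm, s, h⟩

end Sequences

end KacAction
namespace KacAction

/-! ### Termwise application of a normal homomorphism -/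

section Homomorphisms

variable {H : Type*} [NormedAddCommGroup H] [InnerProductSpace ℂ H] [CompleteSpace H]
  {M : VonNeumannAlgebra H} {ω : Ultrafilter ℕ} {m : Type*} [Fintype m] [DecidableEq m]
  (β : M →⋆ₐ[ℂ] Matrix m m M)

theorem map_star_apply (x : M) (i j : m) : β (star x) i j = star (β x j i) := by
  rw [map_star]; rfl

theorem map_mul_apply (x y : M) (i j : m) : β (x * y) i j = ∑ k, β x i k * β y k j := by
  rw [map_mul]; rfl

theorem coe_sum_apply {ι : Type*} (I : Finset ι) (f : ι → M) (ξ : H) :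
    ((∑ i ∈ I, f i : M) : H →L[ℂ] H) ξ = ∑ i ∈ I, (f i : H →L[ℂ] H) ξ := by
  rw [AddSubmonoidClass.coe_finsetSum, sum_apply]

theorem inner_map_star_mul (x : M) (j : m) (ξ : H) :
    ⟪ξ, (β (star x * x) j j : H →L[ℂ] H) ξ⟫_ℂ =
      (∑ i, ‖(β x i j : H →L[ℂ] H) ξ‖ ^ 2 : ℝ) := by
  rw [map_mul_apply, coe_sum_apply, inner_sum, Complex.ofReal_sum]
  refine Finset.sum_congr rfl fun i _ => ?_
  rw [map_star_apply, inner_star_mul_self]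

/-- Contractivity of `β`, column by column: with `C = ‖x‖`, the positive element `C² - x*x` is `y²`
for a self-adjoint `y` in `M`, and the diagonal coefficients of `β(y*y)` are sums of squares. -/
theorem sum_norm_map_apply_le (x : M) (j : m) (ξ : H) :
    ∑ i, ‖(β x i j : H →L[ℂ] H) ξ‖ ^ 2 ≤ ‖(x : H →L[ℂ] H)‖ ^ 2 * ‖ξ‖ ^ 2 := by
  set C : ℝ := ‖(x : H →L[ℂ] H)‖ with hC
  obtain ⟨y, hy, hyy, -⟩ := exists_sqrt_mem (((C ^ 2 : ℝ) : ℂ) • (1 : M) - star x * x) (fun ξ => by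
    refine ⟨C ^ 2 * ‖ξ‖ ^ 2 - ‖(x : H →L[ℂ] H) ξ‖ ^ 2, ?_, ?_⟩
    · rw [sub_nonneg, ← mul_pow]
      gcongr
      exact (x : H →L[ℂ] H).le_opNorm ξ
    · rw [← inner_conj_symm]
      have : (((((C ^ 2 : ℝ) : ℂ) • (1 : M) - star x * x : M)) : H →L[ℂ] H) ξ =
        ((C ^ 2 : ℝ) : ℂ) • ξ - ((star x * x : M) : H →L[ℂ] H) ξ := rfl
      rw [this, inner_sub_right, inner_star_mul_self, inner_smul_right, inner_self_eq_norm_sq_to_K]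
      simp)
  have h1 := inner_map_star_mul β y j ξ
  rw [hy, hyy, map_sub, map_smul, map_one] at h1
  have e : (((((C ^ 2 : ℝ) : ℂ) • (1 : Matrix m m M) - β (star x * x)) j j : M) : H →L[ℂ] H) ξ =
      ((C ^ 2 : ℝ) : ℂ) • ξ - (β (star x * x) j j : H →L[ℂ] H) ξ := by
    simp
  have hK : ⟪ξ, ξ⟫_ℂ = ((‖ξ‖ ^ 2 : ℝ) : ℂ) := by
    rw [inner_self_eq_norm_sq_to_K]
    norm_cast
  rw [e, inner_sub_right, inner_map_star_mul, inner_smul_right, hK] at h1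
  have h2 : C ^ 2 * ‖ξ‖ ^ 2 - ∑ i, ‖(β x i j : H →L[ℂ] H) ξ‖ ^ 2 =
      ∑ i, ‖(β y i j : H →L[ℂ] H) ξ‖ ^ 2 := by
    have := congrArg Complex.re h1
    rw [Complex.sub_re, Complex.ofReal_re, Complex.ofReal_re] at this
    rw [← this, ← Complex.ofReal_mul, Complex.ofReal_re]
  have h3 : 0 ≤ ∑ i, ‖(β y i j : H →L[ℂ] H) ξ‖ ^ 2 := by positivity
  linarith

theorem norm_map_apply_le (x : M) (i j : m) :
    ‖(β x i j : H →L[ℂ] H)‖ ≤ ‖(x : H →L[ℂ] H)‖ := by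
  refine ContinuousLinearMap.opNorm_le_bound _ (norm_nonneg _) fun ξ => ?_
  have h1 := sum_norm_map_apply_le β x j ξ
  have h2 := Finset.single_le_sum (f := fun i => ‖(β x i j : H →L[ℂ] H) ξ‖ ^ 2)
    (fun i _ => by positivity) (Finset.mem_univ i)
  rw [← mul_pow] at h1
  exact le_of_sq_le_sq (h2.trans h1) (by positivity)

theorem isBddSeq_map {s : ℕ → M} (hs : IsBddSeq s) (i j : m) : IsBddSeq fun n => β (s n) i j := by
  obtain ⟨C, hC⟩ := hs
  exact ⟨C, fun n => (norm_map_apply_le β _ i j).trans (hC n)⟩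

variable {β}

/-- Normality is applied to `s*s`, which is weakly null: the diagonal coefficient of `β(s*s)` is the
sum of the squares `‖β(s)ᵢⱼξ‖²` over a column. -/
theorem isNullSeq_map (hβ : IsNormalMap M β) {s : ℕ → M} (hs : IsNullSeq ω s) (i j : m) :
    IsNullSeq ω fun n => β (s n) i j := by
  have key : ∀ s : ℕ → M, IsNullSeq ω s → ∀ i j ξ,
      Tendsto (fun n => (β (s n) i j : H →L[ℂ] H) ξ) ω (𝓝 0) := by
    intro s hs i j ξ
    have h1 : Tendsto (fun n => ⟪ξ, (β (star (s n) * s n) j j : H →L[ℂ] H) ξ⟫_ℂ) ω (𝓝 0) := by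
      have := (hs.star.weakTendsto_mul hs.1).map_normal (hs.1.star.mul hs.1)
        (hβ j j _ (isNormalFunctional_inner ξ ξ))
      simpa using this
    simp only [inner_map_star_mul] at h1
    have h2 : Tendsto (fun n => ∑ i, ‖(β (s n) i j : H →L[ℂ] H) ξ‖ ^ 2) ω (𝓝 0) := by
      have := (Complex.continuous_re.tendsto _).comp h1
      simpa only [Function.comp_def, Complex.ofReal_re, Complex.zero_re] using this
    have h3 : Tendsto (fun n => ‖(β (s n) i j : H →L[ℂ] H) ξ‖ ^ 2) ω (𝓝 0) :=
      squeeze_zero (fun n => by positivity) (fun n =>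
        Finset.single_le_sum (f := fun i => ‖(β (s n) i j : H →L[ℂ] H) ξ‖ ^ 2)
          (fun i _ => by positivity) (Finset.mem_univ i)) h2
    rw [tendsto_zero_iff_norm_tendsto_zero]
    simpa using h3.sqrt
  refine ⟨isBddSeq_map β hs.1 i j, key s hs i j, fun ξ => ?_⟩
  refine (key _ hs.star j i ξ).congr fun n => ?_
  change (β (star (s n)) j i : H →L[ℂ] H) ξ = _
  rw [map_star_apply]
  rfl

/-- `β` maps the entries of `𝒩(𝒯_ω)` to `𝒩(𝒯_ω)`. -/
def PreservesNormalizer (ω : Ultrafilter ℕ) (β : M → Matrix m m M) : Prop :=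
  ∀ s ∈ normalizerAlg ω M, ∀ i j, (fun n => β (s n) i j) ∈ normalizerAlg ω M

/-- The representative chosen in `ultraLift` differs from `s` by a null sequence, whose image has
null entries; the default value `0` is never reached. -/
theorem ultraLift_mk (hβ : IsNormalMap M β) (hp : PreservesNormalizer ω β)
    (s : normalizerAlg ω M) (i j : m) :
    ultraLift ω β (Ultraproduct.mk s) i j = Ultraproduct.mk ⟨_, hp s s.2 i j⟩ := by
  set t : normalizerAlg ω M := Quotient.out (Ultraproduct.mk s) with ht
  have hts : Ultraproduct.mk t = Ultraproduct.mk s := Quotient.out_eq _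
  have h1 := hp t t.2 i j
  unfold ultraLift
  rw [Matrix.of_apply, dif_pos h1, Ultraproduct.mk_eq_mk]
  rw [Ultraproduct.mk_eq_mk] at hts
  convert isNullSeq_map hβ hts i j using 2 with n
  simp [ht]

end Homomorphisms

end KacAction
namespace KacAction

/-! ### The easy implications between the notions of freeness -/

section Freeness

variable {H : Type*} [NormedAddCommGroup H] [InnerProductSpace ℂ H] [CompleteSpace H]
  {M : VonNeumannAlgebra H} {ω : Ultrafilter ℕ} {m : Type*} [Fintype m] [DecidableEq m]

theorem amp_mul_apply {N : Type*} [Ring N] (x : N) (a : Matrix m m N) (i j : m) :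
    (amp m x * a) i j = x * a i j := by
  rw [amp, Matrix.diagonal_mul]

theorem mul_amp_apply {N : Type*} [Ring N] (x : N) (a : Matrix m m N) (i j : m) :
    (a * amp m x) i j = a i j * x := by
  rw [amp, Matrix.mul_diagonal]

/-- The smallest von Neumann subalgebra of `M^ω` is countably generated. -/
theorem isCountablyGeneratedVN_sInf :
    IsCountablyGeneratedVN (sInf {S : StarSubalgebra ℂ (Ultraproduct ω M) | IsVNSubalgebra S}) := by
  refine ⟨fun x C h => ?_, ∅, Set.countable_empty, Set.empty_subset _, fun S' hS' _ => sInf_le hS'⟩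
  rw [StarSubalgebra.mem_sInf]
  intro S hS
  refine hS x C fun F ε hε => ?_
  obtain ⟨y, hy, h⟩ := h F ε hε
  exact ⟨y, StarSubalgebra.mem_sInf.1 hy S hS, h⟩

omit [Fintype m] [DecidableEq m] in
theorem map_constEmb_ne_zero {a : Matrix m m M} (ha : a ≠ 0) : a.map (constEmb ω M) ≠ 0 := by
  intro h
  apply ha
  ext1 i j
  exact constEmb_eq_zero.1 (congrFun (congrFun h i) j)

theorem amp_mul_map_constEmb {x : Ultraproduct ω M} (hx : x ∈ centralPart ω M)
    (a : Matrix m m M) :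
    amp m x * a.map (constEmb ω M) = a.map (constEmb ω M) * amp m x := by
  ext1 i j
  rw [amp_mul_apply, mul_amp_apply, Matrix.map_apply, constEmb_mul_comm hx]

/-- Constants commute with `M_ω`, so `(x ⊗ 1)a = a(x ⊗ 1)` for constant `a`; the choice of `S` plays
no role, and the smallest one is taken. -/
theorem IsStronglyOuter.isProperlyCentrallyNontrivial {β : M → Matrix m m M}
    (h : IsStronglyOuter ω β) : IsProperlyCentrallyNontrivial ω β := by
  rintro ⟨a, ha, hx⟩
  refine h _ isCountablyGeneratedVN_sInf ⟨a.map (constEmb ω M), map_constEmb_ne_zero ha, ?_⟩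
  intro y hy _
  rw [hx y hy, amp_mul_map_constEmb hy]

variable {β : M →⋆ₐ[ℂ] Matrix m m M}

theorem ultraLift_mul_map_constEmb_apply (hβ : IsNormalMap M β) (hp : PreservesNormalizer ω β)
    (s : normalizerAlg ω M) (a : Matrix m m M) (i j : m)
    (h : (fun n => (β ((s : ℕ → M) n) * a) i j) ∈ normalizerAlg ω M) :
    (ultraLift ω β (Ultraproduct.mk s) * a.map (constEmb ω M)) i j = Ultraproduct.mk ⟨_, h⟩ := by
  rw [Matrix.mul_apply]
  simp only [ultraLift_mk hβ hp, Matrix.map_apply, constEmb, ← map_mul, ← map_sum]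
  congr 1
  ext1
  funext n
  rw [AddSubmonoidClass.coe_finsetSum, Finset.sum_apply]
  exact (Matrix.mul_apply (M := β ((s : ℕ → M) n)) (N := a)).symm

theorem mul_apply_mem_normalizerAlg (hp : PreservesNormalizer ω β) (s : normalizerAlg ω M)
    (a : Matrix m m M) (i j : m) :
    (fun n => (β ((s : ℕ → M) n) * a) i j) ∈ normalizerAlg ω M := by
  have : (fun n => (β ((s : ℕ → M) n) * a) i j) =
      ∑ k, (fun n => β ((s : ℕ → M) n) i k) * (fun _ => a k j) := by
    funext n
    rw [Matrix.mul_apply, Finset.sum_apply]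
    rfl
  rw [this]
  exact sum_mem fun k _ => mul_mem (hp s s.2 i k) (const_mem_normalizerAlg _)

/-- A properly centrally nontrivial homomorphism admits no nonzero intertwiner with the trivial
one. -/
theorem IsProperlyCentrallyNontrivial.not_exists_intertwiner (hβ : IsNormalMap M β)
    (hp : PreservesNormalizer ω β) (h : IsProperlyCentrallyNontrivial ω β) :
    ¬ ∃ a : Matrix m m M, a ≠ 0 ∧ ∀ x : M, a * amp m x = β x * a := by
  rintro ⟨a, ha, hx⟩
  refine h ⟨a, ha, fun x hxc => ?_⟩
  rw [amp_mul_map_constEmb hxc]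
  obtain ⟨s, hs, rfl⟩ := hxc
  ext1 i j
  rw [ultraLift_mul_map_constEmb_apply hβ hp s a i j (mul_apply_mem_normalizerAlg hp s a i j),
    mul_amp_apply, Matrix.map_apply, constEmb, ← map_mul]
  congr 1
  ext1
  funext n
  change (β ((s : ℕ → M) n) * a) i j = a i j * (s : ℕ → M) n
  rw [← hx, mul_amp_apply]

end Freeness

/-! ### Fast reindexing and iterated limits -/

section Reindexing

variable {H : Type*} [NormedAddCommGroup H] [InnerProductSpace ℂ H] [CompleteSpace H]
  {M : VonNeumannAlgebra H} {ω : Ultrafilter ℕ}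

omit [InnerProductSpace ℂ H] [CompleteSpace H] in
theorem tendsto_zero_of_dense {E : Type*} [NormedAddCommGroup E] {f : ℕ → H → E} {C : ℝ}
    (hC : ∀ n ξ ξ', ‖f n ξ - f n ξ'‖ ≤ C * ‖ξ - ξ'‖) {D : Set H} (hD : Dense D)
    (h : ∀ ξ ∈ D, Tendsto (fun n => f n ξ) ω (𝓝 0)) (ξ : H) :
    Tendsto (fun n => f n ξ) ω (𝓝 0) := by
  rw [Metric.tendsto_nhds]
  intro ε hε
  have hC1 : 0 < |C| + 1 := by positivity
  obtain ⟨ζ, hζ, hd⟩ := hD.exists_dist_lt ξ (ε := ε / 2 / (|C| + 1)) (by positivity)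
  filter_upwards [Metric.tendsto_nhds.1 (h ζ hζ) (ε / 2) (by positivity)] with n hn
  rw [dist_zero_right] at hn ⊢
  rw [dist_eq_norm, lt_div_iff₀ hC1] at hd
  have h1 : ‖f n ξ - f n ζ‖ ≤ ‖ξ - ζ‖ * (|C| + 1) := by
    refine (hC n ξ ζ).trans ?_
    rw [mul_comm]
    gcongr
    linarith [le_abs_self C]
  have h2 : ‖f n ξ‖ ≤ ‖f n ξ - f n ζ‖ + ‖f n ζ‖ := by
    simpa using norm_add_le (f n ξ - f n ζ) (f n ζ)
  linarith

theorem strong_of_dense {s : ℕ → M} (hs : IsBddSeq s) {D : Set H} (hD : Dense D)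
    (h : ∀ ξ ∈ D, Tendsto (fun n => (s n : H →L[ℂ] H) ξ) ω (𝓝 0)) (ξ : H) :
    Tendsto (fun n => (s n : H →L[ℂ] H) ξ) ω (𝓝 0) := by
  obtain ⟨C, hC⟩ := hs
  refine tendsto_zero_of_dense (f := fun n ξ => (s n : H →L[ℂ] H) ξ) (C := C) (fun n ξ ξ' => ?_)
    hD h ξ
  rw [← map_sub]
  exact ContinuousLinearMap.le_of_opNorm_le _ (hC n) _

theorem weakTendsto_of_dense {s : ℕ → M} (hs : IsBddSeq s) {D : Set H} (hD : Dense D)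
    (h : ∀ η ∈ D, ∀ ξ ∈ D, Tendsto (fun n => ⟪η, (s n : H →L[ℂ] H) ξ⟫_ℂ) ω (𝓝 0)) :
    WeakTendsto ω s 0 := by
  obtain ⟨C, hC⟩ := hs
  have h1 : ∀ η ∈ D, ∀ ξ, Tendsto (fun n => ⟪η, (s n : H →L[ℂ] H) ξ⟫_ℂ) ω (𝓝 0) := by
    intro η hη ξ
    refine tendsto_zero_of_dense (f := fun n ξ => ⟪η, (s n : H →L[ℂ] H) ξ⟫_ℂ) (C := C * ‖η‖)
      (fun n ξ ξ' => ?_) hD (h η hη) ξ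
    rw [← inner_sub_right, ← map_sub]
    exact norm_inner_apply_le _ (hC n) _ _
  intro η ξ
  have := tendsto_zero_of_dense (f := fun n η => ⟪η, (s n : H →L[ℂ] H) ξ⟫_ℂ) (C := C * ‖ξ‖)
      (fun n η η' => by
        rw [← inner_sub_left]
        refine (norm_inner_apply_le _ (hC n) _ _).trans (le_of_eq (by ring))) hD
      (fun η hη => h1 η hη ξ) η
  simpa using this

theorem tendsto_of_le_one_div (hω : (ω : Filter ℕ) ≤ cofinite) {f : ℕ → ℝ} (hf : ∀ n, 0 ≤ f n)
    (N : ℕ) (h : ∀ n, N ≤ n → f n ≤ 1 / ((n : ℝ) + 1)) : Tendsto f ω (𝓝 0) := by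
  rw [Nat.cofinite_eq_atTop] at hω
  refine Tendsto.mono_left ?_ hω
  refine squeeze_zero' (Eventually.of_forall hf) ?_ tendsto_one_div_add_atTop_nhds_zero_nat
  filter_upwards [eventually_ge_atTop N] with n hn using h n hn

/-- Fast reindexing of a centralizing sequence. -/
theorem IsCentralizingSeq.exists_reindex [TopologicalSpace.SeparableSpace H]
    (hω : (ω : Filter ℕ) ≤ cofinite) {x : ℕ → M} (hx : IsCentralizingSeq ω x)
    (d : ℕ → ℕ → M) (hd : ∀ j, IsBddSeq (d j)) (P : ℕ → ℕ → Prop)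
    (hP : ∀ n, ∀ᶠ k in (ω : Filter ℕ), P n k) :
    ∃ k : ℕ → ℕ, IsCentralizingSeq ω (fun n => x (k n)) ∧
      (∀ j, IsNullSeq ω ((fun n => x (k n)) * d j - d j * fun n => x (k n))) ∧
      ∀ n, P n (k n) := by
  set ζ := TopologicalSpace.denseSeq H with hζ
  have hζd : Dense (Set.range ζ) := TopologicalSpace.denseRange_denseSeq H
  -- At stage `n` only finitely many conditions are imposed on `k`. Uniformity in `y` is kept, since
  -- the reindexed sequence must again be centralizing.
  have h1 : ∀ n, ∀ᶠ k in (ω : Filter ℕ), ∀ i ∈ Set.Iic n, ∀ j ∈ Set.Iic n, ∀ y : M,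
      ‖(y : H →L[ℂ] H)‖ ≤ 1 → ‖⟪ζ i, ((x k * y : M) : H →L[ℂ] H) (ζ j)⟫_ℂ -
        ⟪ζ i, ((y * x k : M) : H →L[ℂ] H) (ζ j)⟫_ℂ‖ ≤ 1 / ((n : ℝ) + 1) := by
    intro n
    rw [eventually_all_finite (Set.finite_Iic n)]
    intro i _
    rw [eventually_all_finite (Set.finite_Iic n)]
    intro j _
    exact hx.2 _ (isNormalFunctional_inner (ζ i) (ζ j)) _ (by positivity)
  -- For fixed `n` the element `d j n` is a constant, with which `x k` commutes asymptotically in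
  -- `k`.
  have h2 : ∀ n, ∀ᶠ k in (ω : Filter ℕ), ∀ i ∈ Set.Iic n, ∀ j ∈ Set.Iic n,
      ‖((x k * d j n - d j n * x k : M) : H →L[ℂ] H) (ζ i)‖ ≤ 1 / ((n : ℝ) + 1) ∧
      ‖(Star.star (x k * d j n - d j n * x k : M) : H →L[ℂ] H) (ζ i)‖ ≤ 1 / ((n : ℝ) + 1) := by
    intro n
    rw [eventually_all_finite (Set.finite_Iic n)]
    intro i _
    rw [eventually_all_finite (Set.finite_Iic n)]
    intro j _
    have h := hx.isNullSeq_commutator (d j n)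
    have hpos : 0 < 1 / ((n : ℝ) + 1) := by positivity
    filter_upwards [Metric.tendsto_nhds.1 (h.2.1 (ζ i)) _ hpos,
      Metric.tendsto_nhds.1 (h.2.2 (ζ i)) _ hpos] with k hk1 hk2
    rw [dist_zero_right] at hk1 hk2
    exact ⟨hk1.le, hk2.le⟩
  choose k hk using fun n => ((h1 n).and ((h2 n).and (hP n))).exists
  have hb : IsBddSeq fun n => x (k n) := hx.1.comp k
  refine ⟨k, isCentralizingSeq_of_weakTendsto hb fun y hy => ?_, fun j => ?_, fun n => (hk n).2.2⟩
  · have hyb : IsBddSeq y := ⟨1, hy⟩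
    refine weakTendsto_of_dense ((hb.mul hyb).sub (hyb.mul hb)) hζd ?_
    rintro _ ⟨i, rfl⟩ _ ⟨j, rfl⟩
    rw [tendsto_zero_iff_norm_tendsto_zero]
    refine tendsto_of_le_one_div hω (fun _ => norm_nonneg _) (max i j) fun n hn => ?_
    have := (hk n).1 i ((le_max_left _ _).trans hn) j ((le_max_right _ _).trans hn) (y n) (hy n)
    rw [← inner_sub_right] at this
    exact this
  · have hb' := (hb.mul (hd j)).sub ((hd j).mul hb)
    refine ⟨hb', fun ξ => ?_, fun ξ => ?_⟩
    · refine strong_of_dense hb' hζd ?_ ξ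
      rintro _ ⟨i, rfl⟩
      rw [tendsto_zero_iff_norm_tendsto_zero]
      refine tendsto_of_le_one_div hω (fun _ => norm_nonneg _) (max i j) fun n hn => ?_
      exact ((hk n).2.1 i ((le_max_left _ _).trans hn) j ((le_max_right _ _).trans hn)).1
    · refine strong_of_dense hb'.star hζd ?_ ξ
      rintro _ ⟨i, rfl⟩
      rw [tendsto_zero_iff_norm_tendsto_zero]
      refine tendsto_of_le_one_div hω (fun _ => norm_nonneg _) (max i j) fun n hn => ?_
      exact ((hk n).2.1 i ((le_max_left _ _).trans hn) j ((le_max_right _ _).trans hn)).2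

/-- If `∑ e_q(k) X_q(n)` is small for large `k` and `n`, taken successively, then so is
`∑ e_q(k) b_q` for the weak limits `b_q` of `X_q`. -/
theorem tendsto_of_iterated {m : Type*} [Fintype m] {e X : m → ℕ → M} {b : m → M}
    (he : ∀ q, IsBddSeq (e q)) (hX : ∀ q, WeakTendsto ω (X q) (b q)) (ξ : H)
    (h : ∀ ε > 0, ∀ᶠ n in (ω : Filter ℕ), ∀ᶠ k in (ω : Filter ℕ),
      ‖((∑ q, e q k * X q n : M) : H →L[ℂ] H) ξ‖ ≤ ε) :
    Tendsto (fun k => ((∑ q, e q k * b q : M) : H →L[ℂ] H) ξ) ω (𝓝 0) := by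
  -- The weak limits `D p q` of `e_p*e_q` decouple the indices: with them the limit in `k` of the
  -- pairing is computed for an arbitrary fixed right factor `c`, and only then is `c = X(n)` sent
  -- to `b`.
  choose D hD using fun p q => exists_weakTendsto ω ((he p).star.mul (he q))
  have hT : IsBddSeq fun k => ∑ q, e q k * b q :=
    isBddSeq_sum fun q _ => (he q).mul (isBddSeq_const (b q))
  obtain ⟨K, hK⟩ := hT
  have hexp : ∀ (k : ℕ) (c : m → M), star (∑ q, e q k * b q) * (∑ q, e q k * c q) =
      ∑ p, ∑ q, star (b p) * ((star (e p) * e q) k * c q) := by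
    intro k c
    rw [star_sum, Finset.sum_mul]
    refine Finset.sum_congr rfl fun p _ => ?_
    rw [Finset.mul_sum]
    refine Finset.sum_congr rfl fun q _ => ?_
    simp [mul_assoc]
  have hlim : ∀ c : m → M, WeakTendsto ω
      (fun k => star (∑ q, e q k * b q) * (∑ q, e q k * c q))
      (∑ p, ∑ q, star (b p) * (D p q * c q)) := by
    intro c
    simp only [hexp]
    exact WeakTendsto.sum fun p _ => WeakTendsto.sum fun q _ => ((hD p q).mul_const _).const_mul _
  have hn : WeakTendsto ω (fun n => ∑ p, ∑ q, star (b p) * (D p q * X q n))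
      (∑ p, ∑ q, star (b p) * (D p q * b q)) :=
    WeakTendsto.sum fun p _ => WeakTendsto.sum fun q _ => ((hX q).const_mul _).const_mul _
  have hzero : ⟪ξ, ((∑ p, ∑ q, star (b p) * (D p q * b q) : M) : H →L[ℂ] H) ξ⟫_ℂ = 0 := by
    refine tendsto_nhds_unique (hn ξ ξ) ?_
    rw [Metric.tendsto_nhds]
    intro ε hε
    -- `|K|‖ξ‖ + 1` is a positive bound for the other factor `∑ e_q(k) b_q ξ` of the pairing.
    have hK1 : 0 < |K| * ‖ξ‖ + 1 := by positivity
    filter_upwards [h (ε / 2 / (|K| * ‖ξ‖ + 1)) (by positivity)] with n hn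
    rw [dist_zero_right]
    refine lt_of_le_of_lt ?_ (half_lt_self hε)
    refine le_of_tendsto (hlim (fun q => X q n) ξ ξ).norm (hn.mono fun k hk => ?_)
    rw [coe_mul_apply, inner_apply_star]
    calc _ ≤ (|K| * ‖ξ‖ + 1) * (ε / 2 / (|K| * ‖ξ‖ + 1)) := by
          refine (norm_inner_le_norm _ _).trans (mul_le_mul ?_ hk (norm_nonneg _) hK1.le)
          refine (ContinuousLinearMap.le_of_opNorm_le _ (hK k) _).trans ?_
          have := mul_le_mul_of_nonneg_right (le_abs_self K) (norm_nonneg ξ)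
          linarith
      _ = ε / 2 := by field_simp
  have h1 := hlim b ξ ξ
  rw [hzero] at h1
  simp only [inner_star_mul_self] at h1
  have h2 := (Complex.continuous_re.tendsto _).comp h1
  simp only [Function.comp_def, Complex.ofReal_re, Complex.zero_re] at h2
  rw [tendsto_zero_iff_norm_tendsto_zero]
  simpa using h2.sqrt

end Reindexing

/-! ### Central nontriviality implies strong outerness -/

section StronglyOuter

variable {H : Type*} [NormedAddCommGroup H] [InnerProductSpace ℂ H] [CompleteSpace H]
  [TopologicalSpace.SeparableSpace H]
  {M : VonNeumannAlgebra H} {ω : Ultrafilter ℕ} {m : Type*} [Fintype m] [DecidableEq m]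
  {β : M →⋆ₐ[ℂ] Matrix m m M}

-- Each `‖s_l*ξ‖²` is dominated by the coefficient of the sum at `ξ`, so every `s_l*` tends strongly
-- to zero; inside the normalizer this is already `*`-strong convergence.
omit [TopologicalSpace.SeparableSpace H] [DecidableEq m] in
theorem isNullSeq_of_weakTendsto_sum {s : m → ℕ → M} (hs : ∀ l, s l ∈ normalizerAlg ω M)
    (h : WeakTendsto ω (fun n => ∑ l, s l n * star (s l n)) 0) (l : m) : IsNullSeq ω (s l) := by
  have h2 : ∀ ξ, Tendsto (fun n => (star (s l n) : H →L[ℂ] H) ξ) ω (𝓝 0) := by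
    intro ξ
    have h3 := h ξ ξ
    have h4 : ∀ n, ⟪ξ, ((∑ l, s l n * star (s l n) : M) : H →L[ℂ] H) ξ⟫_ℂ
        = (∑ l, ‖((star (s l n) : M) : H →L[ℂ] H) ξ‖ ^ 2 : ℝ) := fun n => by
      rw [coe_sum_apply, inner_sum, Complex.ofReal_sum]
      refine Finset.sum_congr rfl fun l _ => ?_
      rw [← inner_star_mul_self, star_star]
    simp only [h4] at h3
    have h5 := (Complex.continuous_re.tendsto _).comp h3
    simp only [Function.comp_def, Complex.ofReal_re, ZeroMemClass.coe_zero, zero_apply,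
      inner_zero_right, Complex.zero_re] at h5
    have h6 : Tendsto (fun n => ‖((star (s l n) : M) : H →L[ℂ] H) ξ‖ ^ 2) ω (𝓝 0) :=
      squeeze_zero (fun n => by positivity) (fun n =>
        Finset.single_le_sum (f := fun l => ‖((star (s l n) : M) : H →L[ℂ] H) ξ‖ ^ 2)
          (fun l _ => by positivity) (Finset.mem_univ l)) h5
    rw [tendsto_zero_iff_norm_tendsto_zero]
    simpa using h6.sqrt
  have h3 := (isNullSeq_of_strong (star_mem (hs l)) h2).star
  simpa using h3

-- The commutant of `y` is itself a von Neumann subalgebra, so commuting with the generators and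
-- their adjoints is enough.
omit [TopologicalSpace.SeparableSpace H] in
theorem commute_of_generates {S : StarSubalgebra ℂ (Ultraproduct ω M)}
    {D : Set (Ultraproduct ω M)}
    (hDS : ∀ S' : StarSubalgebra ℂ (Ultraproduct ω M), IsVNSubalgebra S' → D ⊆ S' → S ≤ S')
    {y : Ultraproduct ω M} (hy : y ∈ centralPart ω M) (h : ∀ z ∈ D, y * z = z * y)
    (h' : ∀ z ∈ D, y * star z = star z * y) (z : Ultraproduct ω M) (hz : z ∈ S) :
    z * y = y * z := by
  have hle := hDS _ (isVNSubalgebra_centralizer hy) (fun z hz => by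
    rw [SetLike.mem_coe, StarSubalgebra.mem_centralizer_iff]
    rintro _ rfl
    refine ⟨h z hz, ?_⟩
    have := congrArg star (h' z hz)
    rw [star_mul, star_mul, star_star] at this
    exact this.symm)
  exact (((StarSubalgebra.mem_centralizer_iff ℂ).1 (hle hz)) _ rfl).1.symm

-- The weak limit `b` of `aa*` violates proper central nontriviality. If `(β(x) - x ⊗ 1)b` did not
-- vanish for some `x`, a fast reindexing of `x` would lie in `S' ∩ M_ω`, commute with the entries
-- of `a`, and still have `(β(y) - y ⊗ 1)aa*` bounded away from zero at one vector.
set_option maxHeartbeats 1000000 in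
theorem IsProperlyCentrallyNontrivial.isStronglyOuter (hω : (ω : Filter ℕ) ≤ cofinite)
    (hβ : IsNormalMap M β) (hp : PreservesNormalizer ω β)
    (hc : IsProperlyCentrallyNontrivial ω β) : IsStronglyOuter ω β := by
  rintro S ⟨-, D, hDc, -, hDS⟩ ⟨a, ha, hS⟩
  choose A hA using fun i j => Ultraproduct.mk_surjective ω M (a i j)
  have hAb : ∀ i j, IsBddSeq (A i j : ℕ → M) := fun i j => (A i j).2.1
  -- a countable set generating `S` and the entries of `a`
  obtain ⟨i₀, j₀, -⟩ : ∃ i j, a i j ≠ 0 := by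
    by_contra hcon
    push Not at hcon
    exact ha (Matrix.ext hcon)
  obtain ⟨e, he⟩ : ∃ e : ℕ → Ultraproduct ω M,
      (D ∪ star '' D) ∪ Set.range (fun p : m × m => a p.1 p.2) = Set.range e :=
    ((hDc.union (hDc.image _)).union (Set.countable_range _)).exists_eq_range
      ⟨a i₀ j₀, Or.inr ⟨(i₀, j₀), rfl⟩⟩
  choose d hd using fun j => Ultraproduct.mk_surjective ω M (e j)
  -- the weak limit of `a a*`
  have hXb : ∀ i j, IsBddSeq fun n => ∑ l, (A i l : ℕ → M) n * star ((A j l : ℕ → M) n) :=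
    fun i j => isBddSeq_sum fun l _ => (hAb i l).mul (hAb j l).star
  choose b hb using fun i j => exists_weakTendsto ω (hXb i j)
  refine hc ⟨Matrix.of b, fun hb0 => ha ?_, fun x hx => ?_⟩
  · ext1 i l
    have hbii : b i i = 0 := congrFun (congrFun hb0 i) i
    rw [← hA, Matrix.zero_apply, Ultraproduct.mk_eq_zero]
    exact isNullSeq_of_weakTendsto_sum (fun l => (A i l).2) (hbii ▸ hb i i) l
  · obtain ⟨s, hs, rfl⟩ := hx
    ext1 i j
    rw [ultraLift_mul_map_constEmb_apply hβ hp s _ i j (mul_apply_mem_normalizerAlg hp s _ i j),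
      amp_mul_apply, Matrix.map_apply, constEmb, ← map_mul, Ultraproduct.mk_eq_mk]
    -- `E` is row `i` of `β(x) - x ⊗ 1`, so the goal is that `∑ q, E q k * b q j` is null.
    set E : m → ℕ → M := fun q k => β ((s : ℕ → M) k) i q - if i = q then (s : ℕ → M) k else 0
      with hE
    have hEb : ∀ q, IsBddSeq (E q) := fun q => by
      refine (isBddSeq_map β hs.1 i q).sub ?_
      by_cases hq : i = q
      · simpa [hq] using hs.1
      · simpa [hq] using isBddSeq_const (0 : M)
    have hEsum : ∀ k (c : m → M), ∑ q, E q k * c q =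
        ∑ q, β ((s : ℕ → M) k) i q * c q - (s : ℕ → M) k * c i := fun k c => by
      simp [hE, sub_mul, Finset.sum_sub_distrib]
    refine isNullSeq_of_strong (sub_mem (mul_apply_mem_normalizerAlg hp s _ i j)
      (mul_mem s.2 (const_mem_normalizerAlg _))) fun ξ => ?_
    have key := tendsto_of_iterated hEb (fun q => hb q j) ξ ?_
    · refine key.congr fun k => ?_
      rw [hEsum]
      rfl
    -- Along an ultrafilter, not being almost always at most `ε` means being almost always larger
    -- than `ε`, for `k` as well as for `n`.
    by_contra hcon
    push Not at hcon
    obtain ⟨ε, hε, hcon⟩ := hcon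
    -- The extra requirement is an implication, so that it can be met for every `n`, also for those
    -- where the failure does not occur.
    obtain ⟨k, hk1, hk2, hk3⟩ := hs.exists_reindex hω (fun j => (d j : ℕ → M))
      (fun j => (d j).2.1)
      (fun n k => (∀ᶠ k in (ω : Filter ℕ),
        ε < ‖((∑ q, E q k * ∑ l, (A q l : ℕ → M) n * star ((A j l : ℕ → M) n) : M) :
          H →L[ℂ] H) ξ‖) →
        ε < ‖((∑ q, E q k * ∑ l, (A q l : ℕ → M) n * star ((A j l : ℕ → M) n) : M) :
          H →L[ℂ] H) ξ‖) (fun n => by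
        by_cases hn : ∀ᶠ k in (ω : Filter ℕ),
          ε < ‖((∑ q, E q k * ∑ l, (A q l : ℕ → M) n * star ((A j l : ℕ → M) n) : M) :
            H →L[ℂ] H) ξ‖
        · filter_upwards [hn] with k hk _ using hk
        · exact Eventually.of_forall fun k h => absurd h hn)
    set y : normalizerAlg ω M := ⟨fun n => (s : ℕ → M) (k n), hk1.mem_normalizerAlg⟩ with hy
    have hyc : Ultraproduct.mk y ∈ centralPart ω M := ⟨y, hk1, rfl⟩
    have hyd : ∀ z ∈ Set.range e, Ultraproduct.mk y * z = z * Ultraproduct.mk y := by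
      rintro _ ⟨l, rfl⟩
      rw [← hd, ← map_mul, ← map_mul, Ultraproduct.mk_eq_mk]
      exact hk2 l
    rw [← he] at hyd
    have hyS : ∀ z ∈ S, z * Ultraproduct.mk y = Ultraproduct.mk y * z :=
      commute_of_generates hDS hyc (fun z hz => hyd z (Or.inl (Or.inl hz)))
        fun z hz => hyd _ (Or.inl (Or.inr ⟨z, hz, rfl⟩))
    have hya := hS _ hyc hyS
    -- As `y` commutes with the entries of `a`, the relation `β^ω(y)a = a(y ⊗ 1)` reads `(β^ω(y) - y
    -- ⊗ 1)a = 0`.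
    have hnull : ∀ l, IsNullSeq ω (fun n => ∑ q, E q (k n) * (A q l : ℕ → M) n) := by
      intro l
      have h1 := congrFun (congrFun hya i) l
      rw [mul_amp_apply, ← hyd _ (Or.inr ⟨(i, l), rfl⟩), Matrix.mul_apply] at h1
      simp only [ultraLift_mk hβ hp, ← hA, ← map_mul, ← map_sum] at h1
      rw [Ultraproduct.mk_eq_mk] at h1
      convert h1 using 2 with n
      rw [hEsum, AddSubmonoidClass.coe_finsetSum, Pi.sub_apply, Finset.sum_apply]
      rfl
    have hnull2 : IsNullSeq ω (fun n => ∑ q, E q (k n) *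
        ∑ l, (A q l : ℕ → M) n * star ((A j l : ℕ → M) n)) := by
      have h1 : IsNullSeq ω fun n => ∑ l, ((fun n => ∑ q, E q (k n) * (A q l : ℕ → M) n) *
        (star (A j l : ℕ → M))) n :=
        isNullSeq_sum fun l _ => ((star_mem (A j l).2 : star (A j l : ℕ → M) ∈ _).2 _ (hnull l)).2
      convert h1 using 2 with n
      simp only [Pi.mul_apply, Pi.star_apply, Finset.mul_sum, Finset.sum_mul, mul_assoc]
      rw [Finset.sum_comm]
    obtain ⟨n, hn1, hn2⟩ :=
      (hcon.and (Metric.tendsto_nhds.1 (hnull2.2.1 ξ) ε hε)).exists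
    rw [dist_zero_right] at hn2
    exact lt_asymm hn2 (hk3 n hn1)

end StronglyOuter

end KacAction
namespace KacAction

/-! ### Minimal projections in finite-dimensional `*`-algebras -/

section MinimalProjections

variable {A : Type*} [CStarAlgebra A] {N : StarSubalgebra ℂ A}

/-- Elements of a finite-dimensional algebra are algebraic, and the spectrum lies among the roots of
an annihilating polynomial. -/
theorem finite_spectrum_of_mem [FiniteDimensional ℂ N] {y : A} (hy : y ∈ N) :
    (spectrum ℝ y).Finite := by
  obtain ⟨P, hP0, hP⟩ := (Algebra.IsAlgebraic.isAlgebraic (R := ℂ) (⟨y, hy⟩ : N))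
  have hP' : Polynomial.aeval y P = 0 := by
    have := congrArg N.subtype hP
    rw [← Polynomial.aeval_algHom_apply] at this
    simpa using this
  have h1 : (spectrum ℂ y).Finite := by
    cases subsingleton_or_nontrivial A
    · rw [spectrum.of_subsingleton]
      exact Set.finite_empty
    refine (P.roots.toFinset.finite_toSet).subset fun z hz => ?_
    have := spectrum.subset_polynomial_aeval y P ⟨z, hz, rfl⟩
    rw [hP', spectrum.zero_eq] at this
    simpa [hP0] using this
  rw [← spectrum.preimage_algebraMap ℂ]
  exact h1.preimage (FaithfulSMul.algebraMap_injective ℝ ℂ).injOn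

/-- A nonzero self-adjoint element of a finite-dimensional `*`-algebra has a spectral projection for
a nonzero eigenvalue. -/
theorem exists_spectral_projection [FiniteDimensional ℂ N] {y : A} (hy : y ∈ N)
    (hsa : IsSelfAdjoint y) (h0 : y ≠ 0) :
    ∃ q ∈ N, ∃ t : ℝ, t ≠ 0 ∧ star q = q ∧ q * q = q ∧ q ≠ 0 ∧ y * q = (t : ℂ) • q := by
  have hfin := finite_spectrum_of_mem hy
  obtain ⟨t, ht, ht0⟩ : ∃ t ∈ spectrum ℝ y, t ≠ 0 := by
    by_contra hcon
    push Not at hcon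
    apply h0
    rw [← cfc_id' ℝ y, cfc_congr (g := fun _ => 0) hcon, cfc_const_zero]
  -- The indicator of `{t}` is continuous on the spectrum because the spectrum is finite.
  set f : ℝ → ℝ := fun s => if s = t then 1 else 0 with hf
  have hfc : ContinuousOn f (spectrum ℝ y) := hfin.continuousOn f
  have : IsClosed (N : Set A) := (N.toSubalgebra.toSubmodule).closed_of_finiteDimensional
  refine ⟨cfc f y, ?_, t, ht0, (cfc_predicate f y : IsSelfAdjoint _).star_eq, ?_, ?_, ?_⟩
  · exact cfc_mem (𝕜' := ℂ) (hs := this) f hy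
  · rw [← cfc_mul f f y hfc hfc]
    congr 1
    ext s
    simp [hf]
  · intro h
    cases subsingleton_or_nontrivial A
    · exact h0 (Subsingleton.elim _ _)
    have h1 := cfc_map_spectrum f y hsa hfc
    rw [h, spectrum.zero_eq] at h1
    have : f t ∈ f '' spectrum ℝ y := ⟨t, ht, rfl⟩
    rw [← h1] at this
    simp [hf] at this
  · have e : y * cfc f y = cfc (fun s => s * f s) y := by
      rw [cfc_mul (fun s => s) f y (continuousOn_id) hfc, cfc_id' ℝ y]
    rw [e]
    have : (fun s => s * f s) = fun s => t • f s := by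
      ext s
      by_cases h : s = t <;> simp [hf, h]
    rw [this, cfc_smul t f y hfc]
    exact (Complex.coe_smul t _).symm

/-- `p` is a projection of `N`. -/
def IsProjIn (N : StarSubalgebra ℂ A) (p : A) : Prop := p ∈ N ∧ star p = p ∧ p * p = p

/-- `p` is a projection of `N` with `p N p = ℂ p`. -/
def IsMinimalProjIn (N : StarSubalgebra ℂ A) (p : A) : Prop :=
  IsProjIn N p ∧ ∀ x ∈ N, ∃ c : ℂ, p * x * p = c • p

/-- A non-scalar element of `pNp` has a non-scalar self-adjoint part `y`. A spectral projection `q`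
of `y` for an eigenvalue `t ≠ 0` satisfies `q = t⁻¹yq`, hence lies under `p`, and `q = p` would
force `y = tp`. -/
theorem IsProjIn.exists_of_not_minimal [FiniteDimensional ℂ N] {p : A} (hp : IsProjIn N p)
    (hm : ¬ IsMinimalProjIn N p) : ∃ q, IsProjIn N q ∧ p * q = q ∧ q * p = q ∧ q ≠ 0 ∧ q ≠ p := by
  obtain ⟨hpN, hps, hpp⟩ := hp
  obtain ⟨x, hx, hxc⟩ : ∃ x ∈ N, ∀ c : ℂ, p * x * p ≠ c • p := by
    by_contra hcon
    push Not at hcon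
    exact hm ⟨⟨hpN, hps, hpp⟩, hcon⟩
  obtain ⟨y, hy, hsa, hpy, hyp, hyc⟩ : ∃ y ∈ N, IsSelfAdjoint y ∧ p * y = y ∧ y * p = y ∧
      ∀ c : ℂ, y ≠ c • p := by
    have hzN : p * x * p ∈ N := mul_mem (mul_mem hpN hx) hpN
    have hz1 : p * (p * x * p) = p * x * p := by rw [← mul_assoc, ← mul_assoc, hpp]
    have hz2 : (p * x * p) * p = p * x * p := by rw [mul_assoc, hpp]
    generalize p * x * p = z at *
    have hz1' : p * star z = star z := by
      have := congrArg star hz2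
      rwa [star_mul, hps] at this
    have hz2' : star z * p = star z := by
      have := congrArg star hz1
      rwa [star_mul, hps] at this
    -- If the real and imaginary parts were both scalar multiples of `p`, so would be `z`.
    by_contra hcon
    push Not at hcon
    obtain ⟨c, hc⟩ := hcon (z + star z) (add_mem hzN (star_mem hzN))
      (IsSelfAdjoint.add_star_self z) (by rw [mul_add, hz1, hz1']) (by rw [add_mul, hz2, hz2'])
    obtain ⟨d, hd⟩ := hcon (Complex.I • (z - star z))
      (SMulMemClass.smul_mem _ (sub_mem hzN (star_mem hzN)))
      (by simp [IsSelfAdjoint, star_sub, smul_sub, neg_add_eq_sub])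
      (by rw [mul_smul_comm, mul_sub, hz1, hz1']) (by rw [smul_mul_assoc, sub_mul, hz2, hz2'])
    refine hxc (2⁻¹ * (c - Complex.I * d)) ?_
    have h2 : z - star z = -(Complex.I * d) • p := by
      rw [neg_smul, mul_smul, ← hd, smul_smul, Complex.I_mul_I, neg_smul, one_smul, neg_neg]
    have h3 : (2 : ℂ) • z = (c - Complex.I * d) • p := by
      rw [two_smul, sub_smul, ← hc]
      have : z + z = (z + star z) + (z - star z) := by abel
      rw [this, h2, neg_smul]
      abel
    rw [mul_smul, ← h3, smul_smul, inv_mul_cancel₀ two_ne_zero, one_smul]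
  have hy0 : y ≠ 0 := fun h => hyc 0 (by rw [h, zero_smul])
  obtain ⟨q, hqN, t, ht, hqs, hqq, hq0, hyq⟩ := exists_spectral_projection hy hsa hy0
  have ht' : (t : ℂ) ≠ 0 := by exact_mod_cast ht
  have hpq : p * q = q := by
    have : q = (t : ℂ)⁻¹ • (y * q) := by rw [hyq, smul_smul, inv_mul_cancel₀ ht', one_smul]
    rw [this, mul_smul_comm, ← mul_assoc, hpy]
  have hqp : q * p = q := by
    have := congrArg star hpq
    rwa [star_mul, hps, hqs] at this
  refine ⟨q, ⟨hqN, hqs, hqq⟩, hpq, hqp, hq0, fun h => hyc t ?_⟩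
  rw [← h, ← hyq, h, hyp]

theorem IsProjIn.sub {p q : A} (hp : IsProjIn N p) (hq : IsProjIn N q) (hpq : p * q = q)
    (hqp : q * p = q) : IsProjIn N (p - q) :=
  ⟨sub_mem hp.1 hq.1, by rw [star_sub, hp.2.1, hq.2.1], by
    rw [sub_mul, mul_sub, mul_sub, hp.2.2, hq.2.2, hpq, hqp, sub_self, sub_zero]⟩

/-- The corner `p N p`. -/
def corner (N : StarSubalgebra ℂ A) (p : A) : Submodule ℂ A where
  carrier := {x | x ∈ N ∧ p * x = x ∧ x * p = x}
  add_mem' := fun {a b} ha hb => ⟨add_mem ha.1 hb.1, by rw [mul_add, ha.2.1, hb.2.1],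
    by rw [add_mul, ha.2.2, hb.2.2]⟩
  zero_mem' := ⟨zero_mem _, mul_zero _, zero_mul _⟩
  smul_mem' := fun c a ha => ⟨SMulMemClass.smul_mem c ha.1, by rw [mul_smul_comm, ha.2.1],
    by rw [smul_mul_assoc, ha.2.2]⟩

/-- The dimension of the corner is the measure for the descent to a minimal projection: `p` lies in
its own corner but not in that of a proper subprojection. -/
theorem finrank_corner_lt [FiniteDimensional ℂ N] {p q : A} (hp : IsProjIn N p)
    (hpq : p * q = q) (hqp : q * p = q) (hne : q ≠ p) :
    Module.finrank ℂ (corner N q) < Module.finrank ℂ (corner N p) := by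
  have hle : corner N p ≤ N.toSubalgebra.toSubmodule := fun x hx => hx.1
  have : FiniteDimensional ℂ N.toSubalgebra.toSubmodule := ‹FiniteDimensional ℂ N›
  have : FiniteDimensional ℂ (corner N p) := Submodule.finiteDimensional_of_le hle
  refine Submodule.finrank_lt_finrank_of_lt (lt_of_le_of_ne ?_ fun h => hne ?_)
  · rintro x ⟨hx, h1, h2⟩
    refine ⟨hx, ?_, ?_⟩
    · rw [← h1, ← mul_assoc, hpq]
    · rw [← h2, mul_assoc, hqp]
  · have : p ∈ corner N q := by
      rw [h]
      exact ⟨hp.1, hp.2.2, hp.2.2⟩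
    exact hqp.symm.trans this.2.1

/-- A property of projections that passes from `p` to one of `q`, `p - q` for every subprojection
`q ≤ p` holds for some minimal projection. -/
theorem IsProjIn.exists_minimal [FiniteDimensional ℂ N] {T : A → Prop}
    (hT : ∀ p q, T p → T q ∨ T (p - q)) {p : A} (hp : IsProjIn N p) (hTp : T p) :
    ∃ q, IsMinimalProjIn N q ∧ T q := by
  induction hn : Module.finrank ℂ (corner N p) using Nat.strong_induction_on generalizing p with
  | _ n ih =>
    by_cases hm : IsMinimalProjIn N p
    · exact ⟨p, hm, hTp⟩
    obtain ⟨q, hq, hpq, hqp, hq0, hqne⟩ := hp.exists_of_not_minimal hm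
    rcases hT p q hTp with h | h
    · exact ih _ (hn ▸ finrank_corner_lt hp hpq hqp hqne) hq h rfl
    · refine ih _ (hn ▸ finrank_corner_lt hp (q := p - q) ?_ ?_ ?_) (hp.sub hq hpq hqp) h rfl
      · rw [mul_sub, hp.2.2, hpq]
      · rw [sub_mul, hp.2.2, hqp]
      · simpa using hq0

/-- In a finite-dimensional `*`-algebra, `1` is a sum of minimal projections. -/
theorem exists_list_minimal_sum [FiniteDimensional ℂ N] :
    ∃ l : List A, (∀ p ∈ l, IsMinimalProjIn N p) ∧ l.sum = 1 := by
  by_contra hcon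
  -- Not being a sum of minimal projections passes from `p` to `q` or `p - q`, so it would hold for
  -- a minimal projection, which is absurd.
  obtain ⟨q, hq, hTq⟩ := IsProjIn.exists_minimal (N := N)
    (T := fun p => ¬ ∃ l : List A, (∀ p ∈ l, IsMinimalProjIn N p) ∧ l.sum = p)
    (fun p q h => by
      by_contra hc
      push Not at hc
      obtain ⟨⟨l, hl, hs⟩, l', hl', hs'⟩ := hc
      refine h ⟨l ++ l', fun p hp => ?_, ?_⟩
      · rcases List.mem_append.1 hp with hp | hp
        · exact hl p hp
        · exact hl' p hp
      · rw [List.sum_append, hs, hs', add_sub_cancel])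
    (p := 1) ⟨one_mem _, star_one _, one_mul _⟩ hcon
  exact hTq ⟨[q], by simpa using hq, by simp⟩

end MinimalProjections

end KacAction
namespace KacAction

/-! ### Scalar matrices over `M` and finite sums of elementary tensors -/

section Scalars

variable {H : Type*} [NormedAddCommGroup H] [InnerProductSpace ℂ H] [CompleteSpace H]
  {M : VonNeumannAlgebra H} {l m n : Type*}

theorem scal_apply (S : Matrix m n ℂ) (i : m) (j : n) : scal M S i j = algebraMap ℂ M (S i j) := rfl

theorem scal_mul [Fintype m] (S : Matrix l m ℂ) (T : Matrix m n ℂ) :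
    scal M (S * T) = scal M S * scal M T := Matrix.map_mul

theorem scal_one [DecidableEq m] : scal M (1 : Matrix m m ℂ) = 1 :=
  Matrix.map_one _ (map_zero _) (map_one _)

theorem scal_zero : scal M (0 : Matrix m n ℂ) = 0 := Matrix.map_zero _ (map_zero _)

theorem scal_add (S T : Matrix m n ℂ) : scal M (S + T) = scal M S + scal M T :=
  Matrix.map_add _ (map_add _) S T

theorem scal_smul (c : ℂ) (S : Matrix m n ℂ) : scal M (c • S) = c • scal M S := by
  ext1 i j
  simp [scal_apply, Algebra.smul_def]

theorem scal_conjTranspose (S : Matrix m n ℂ) :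
    (scal M S).conjTranspose = scal M S.conjTranspose := by
  ext1 i j
  simp only [Matrix.conjTranspose_apply, scal_apply, algebraMap_star_comm]

end Scalars

section TensorOperators

set_option linter.unusedSectionVars false

variable {H K : Type*} [NormedAddCommGroup H] [InnerProductSpace ℂ H] [CompleteSpace H]
  [NormedAddCommGroup K] [InnerProductSpace ℂ K] [CompleteSpace K]

theorem tensorOp_mul (a c : H →L[ℂ] H) (b d : K →L[ℂ] K) :
    tensorOp a b * tensorOp c d = tensorOp (a * c) (b * d) :=
  tensor_ext fun ξ η => by simp [tensorOp_tmulVec]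

theorem tmulVec_sum_left {ι : Type*} (I : Finset ι) (f : ι → H) (η : K) :
    tmulVec (∑ i ∈ I, f i) η = ∑ i ∈ I, tmulVec (f i) η := by
  simp only [← tensorRight_apply, map_sum]

theorem tmulVec_sum_right {ι : Type*} (I : Finset ι) (ξ : H) (f : ι → K) :
    tmulVec ξ (∑ i ∈ I, f i) = ∑ i ∈ I, tmulVec ξ (f i) := by
  simp only [← tensorLeft_apply, map_sum]

theorem tmulVec_smul_left (c : ℂ) (ξ : H) (η : K) : tmulVec (c • ξ) η = c • tmulVec ξ η := by
  simp only [← tensorRight_apply, map_smul]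

theorem tmulVec_smul_right (c : ℂ) (ξ : H) (η : K) : tmulVec ξ (c • η) = c • tmulVec ξ η := by
  simp only [← tensorLeft_apply, map_smul]

theorem tensorOp_sum_left {ι : Type*} (I : Finset ι) (f : ι → H →L[ℂ] H) (b : K →L[ℂ] K) :
    tensorOp (∑ i ∈ I, f i) b = ∑ i ∈ I, tensorOp (f i) b :=
  tensor_ext fun ξ η => by simp [tensorOp_tmulVec, tmulVec_sum_left, sum_apply]

theorem tensorOp_sum_right {ι : Type*} (I : Finset ι) (a : H →L[ℂ] H) (f : ι → K →L[ℂ] K) :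
    tensorOp a (∑ i ∈ I, f i) = ∑ i ∈ I, tensorOp a (f i) :=
  tensor_ext fun ξ η => by simp [tensorOp_tmulVec, tmulVec_sum_right, sum_apply]

theorem tensorOp_smul_left (c : ℂ) (a : H →L[ℂ] H) (b : K →L[ℂ] K) :
    tensorOp (c • a) b = c • tensorOp a b :=
  tensor_ext fun ξ η => by simp [tensorOp_tmulVec, tmulVec_smul_left]

theorem tensorOp_smul_right (c : ℂ) (a : H →L[ℂ] H) (b : K →L[ℂ] K) :
    tensorOp a (c • b) = c • tensorOp a b :=
  tensor_ext fun ξ η => by simp [tensorOp_tmulVec, tmulVec_smul_right]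

theorem coe_sliceFst_of_eq_sum {A : VonNeumannAlgebra H} {B : VonNeumannAlgebra K} {ι : Type*}
    {I : Finset ι} {x : ι → H →L[ℂ] H} {y : ι → K →L[ℂ] K} {T : vnTensor A B}
    (hT : (T : HilbertTensor H K →L[ℂ] HilbertTensor H K) = ∑ i ∈ I, tensorOp (x i) (y i))
    (ζ' ζ : H) :
    (sliceFst ζ' ζ T : K →L[ℂ] K) = ∑ i ∈ I, ⟪ζ', x i ζ⟫_ℂ • y i := by
  ext η
  change (tensorLeft ζ').adjoint ((T : HilbertTensor H K →L[ℂ] HilbertTensor H K)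
    (tmulVec ζ η)) = _
  rw [hT]
  simp [sum_apply, tensorOp_tmulVec, adjoint_tensorLeft_tmulVec]

theorem coe_sliceSnd_of_eq_sum {A : VonNeumannAlgebra H} {B : VonNeumannAlgebra K} {ι : Type*}
    {I : Finset ι} {x : ι → H →L[ℂ] H} {y : ι → K →L[ℂ] K} {T : vnTensor A B}
    (hT : (T : HilbertTensor H K →L[ℂ] HilbertTensor H K) = ∑ i ∈ I, tensorOp (x i) (y i))
    (ζ' ζ : K) :
    (sliceSnd ζ' ζ T : H →L[ℂ] H) = ∑ i ∈ I, ⟪ζ', y i ζ⟫_ℂ • x i := by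
  ext ξ
  change (tensorRight ζ').adjoint ((T : HilbertTensor H K →L[ℂ] HilbertTensor H K)
    (tmulVec ξ ζ)) = _
  rw [hT]
  simp [sum_apply, tensorOp_tmulVec, adjoint_tensorRight_tmulVec]

end TensorOperators

/-! ### Conjugates of unitary representations -/

section Representations

variable {L : Type*} [NormedAddCommGroup L] [InnerProductSpace ℂ L] [CompleteSpace L]
  {G : CompactKacAlgebra L}

/-- `w` is a finite-dimensional unitary representation of `G`. -/
structure IsUnitaryRep (G : CompactKacAlgebra L) {m : Type*} [Fintype m] [DecidableEq m]
    (w : Matrix m m G.alg) : Prop where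
  mem_unitary : w ∈ unitary (Matrix m m G.alg)
  comul_apply : ∀ i j, (G.comul (w i j) : HilbertTensor L L →L[ℂ] HilbertTensor L L) =
    ∑ k, tensorOp (w i k : L →L[ℂ] L) (w k j : L →L[ℂ] L)

theorem IrrRep.isUnitaryRep (π : IrrRep G) : IsUnitaryRep G π.mat := ⟨π.mat_unitary, π.comul_mat⟩

section Conjugate

variable {m : Type*} [Fintype m] [DecidableEq m] {v : Matrix m m G.alg}

theorem IsUnitaryRep.sum_star_mul (hv : IsUnitaryRep G v) (i j : m) :
    ∑ k, star (v k i) * v k j = if i = j then 1 else 0 := by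
  have := congrFun (congrFun (Unitary.mem_iff.1 hv.mem_unitary).1 i) j
  rw [Matrix.mul_apply, Matrix.one_apply] at this
  exact this

theorem IsUnitaryRep.sum_mul_star (hv : IsUnitaryRep G v) (i j : m) :
    ∑ k, v i k * star (v j k) = if i = j then 1 else 0 := by
  have := congrFun (congrFun (Unitary.mem_iff.1 hv.mem_unitary).2 i) j
  rw [Matrix.mul_apply, Matrix.one_apply] at this
  exact this

theorem coe_comul_star (a : G.alg) :
    (G.comul (star a) : HilbertTensor L L →L[ℂ] HilbertTensor L L) =
      star (G.comul a : HilbertTensor L L →L[ℂ] HilbertTensor L L) := by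
  rw [map_star]; rfl

theorem coe_comul_mul (a b : G.alg) :
    (G.comul (a * b) : HilbertTensor L L →L[ℂ] HilbertTensor L L) =
      (G.comul a : HilbertTensor L L →L[ℂ] HilbertTensor L L) * G.comul b := by
  rw [map_mul]; rfl

theorem IsUnitaryRep.comul_star (hv : IsUnitaryRep G v) (i j : m) :
    (G.comul (star (v i j)) : HilbertTensor L L →L[ℂ] HilbertTensor L L) =
      ∑ k, tensorOp (star (v i k : L →L[ℂ] L)) (star (v k j : L →L[ℂ] L)) := by
  rw [coe_comul_star, hv.comul_apply, star_sum]
  simp only [star_tensorOp]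

theorem sum_inner_vac {ι : Type*} (I : Finset ι) (f : ι → G.alg) :
    ∑ i ∈ I, ⟪G.vac, (f i : L →L[ℂ] L) G.vac⟫_ℂ =
      ⟪G.vac, ((∑ i ∈ I, f i : G.alg) : L →L[ℂ] L) G.vac⟫_ℂ := by
  rw [AddSubmonoidClass.coe_finsetSum, sum_apply, inner_sum]

theorem inner_vac_ite (p : Prop) [Decidable p] :
    ⟪G.vac, ((if p then 1 else 0 : G.alg) : L →L[ℂ] L) G.vac⟫_ℂ = if p then 1 else 0 := by
  split_ifs
  · simp [inner_self_eq_norm_sq_to_K, G.norm_vac]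
  · simp

/-- The matrix of adjoints of a unitary representation satisfies the first unitarity relation. -/
theorem IsUnitaryRep.sum_conj_mul (hv : IsUnitaryRep G v) (i j : m) :
    ∑ k, v k i * star (v k j) = if i = j then 1 else 0 := by
  have hT : ∀ k, (G.comul (v k i * star (v k j)) : HilbertTensor L L →L[ℂ] HilbertTensor L L) =
      ∑ x : m × m, tensorOp ((v k x.1 * star (v k x.2) : G.alg) : L →L[ℂ] L)
        ((v x.1 i * star (v x.2 j) : G.alg) : L →L[ℂ] L) := by
    intro k
    rw [coe_comul_mul, hv.comul_apply, hv.comul_star, Finset.sum_mul_sum, Fintype.sum_prod_type]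
    simp only [tensorOp_mul]
    rfl
  have key : ∀ ζ' ζ : L, ⟪ζ', ((∑ k, v k i * star (v k j) : G.alg) : L →L[ℂ] L) ζ⟫_ℂ =
      ⟪ζ', ((if i = j then 1 else 0 : G.alg) : L →L[ℂ] L) ζ⟫_ℂ := by
    intro ζ' ζ
    -- The functional `h ⊗ ω_{ζ',ζ}` is evaluated on `∑ₖ δ(vₖᵢ vₖⱼ*)` in two ways. Invariance of `h`
    -- together with traciality and unitarity of `v` gives `ω(1)δᵢⱼ`.
    have h1 : ∑ k, ⟪G.vac, (sliceSnd ζ' ζ (G.comul (v k i * star (v k j))) : L →L[ℂ] L) G.vac⟫_ℂ =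
        ⟪ζ', ζ⟫_ℂ * (if i = j then 1 else 0) := by
      have htr : ∀ k, ⟪G.vac, ((v k i * star (v k j) : G.alg) : L →L[ℂ] L) G.vac⟫_ℂ =
          ⟪G.vac, ((star (v k j) * v k i : G.alg) : L →L[ℂ] L) G.vac⟫_ℂ := fun k => G.tracial _ _
      simp only [G.invariant_right, ← Finset.mul_sum, htr]
      rw [sum_inner_vac, hv.sum_star_mul, inner_vac_ite]
      simp only [eq_comm]
    -- Expanding the coproduct, traciality collapses the first leg to a Kronecker delta, leaving
    -- `ω(∑ₓ vₓᵢ vₓⱼ*)`.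
    have h2 : ∑ k, ⟪G.vac, (sliceSnd ζ' ζ (G.comul (v k i * star (v k j))) : L →L[ℂ] L) G.vac⟫_ℂ =
        ∑ x : m × m, ⟪ζ', ((v x.1 i * star (v x.2 j) : G.alg) : L →L[ℂ] L) ζ⟫_ℂ *
          (if x.1 = x.2 then 1 else 0) := by
      simp only [fun k => coe_sliceSnd_of_eq_sum (hT k) ζ' ζ, sum_apply, inner_sum, smul_apply,
        inner_smul_right]
      rw [Finset.sum_comm]
      refine Finset.sum_congr rfl fun x _ => ?_
      rw [← Finset.mul_sum]
      simp only [fun k => G.tracial (v k x.1) (star (v k x.2))]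
      rw [sum_inner_vac, hv.sum_star_mul, inner_vac_ite]
      simp only [eq_comm]
    rw [h2, Fintype.sum_prod_type] at h1
    simp only [mul_ite, mul_one, mul_zero, Finset.sum_ite_eq, Finset.mem_univ, if_true] at h1
    rw [AddSubmonoidClass.coe_finsetSum, sum_apply, inner_sum, h1]
    split_ifs <;> simp
  exact Subtype.ext (ContinuousLinearMap.ext fun ζ => ext_inner_left ℂ fun ζ' => key ζ' ζ)

/-- The matrix of adjoints of a unitary representation satisfies the second unitarity relation. -/
theorem IsUnitaryRep.sum_mul_conj (hv : IsUnitaryRep G v) (i j : m) :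
    ∑ k, star (v i k) * v j k = if i = j then 1 else 0 := by
  have hT : ∀ k, (G.comul (star (v i k) * v j k) : HilbertTensor L L →L[ℂ] HilbertTensor L L) =
      ∑ x : m × m, tensorOp ((star (v i x.1) * v j x.2 : G.alg) : L →L[ℂ] L)
        ((star (v x.1 k) * v x.2 k : G.alg) : L →L[ℂ] L) := by
    intro k
    rw [coe_comul_mul, hv.comul_apply, hv.comul_star, Finset.sum_mul_sum, Fintype.sum_prod_type]
    simp only [tensorOp_mul]
    rfl
  have key : ∀ ζ' ζ : L, ⟪ζ', ((∑ k, star (v i k) * v j k : G.alg) : L →L[ℂ] L) ζ⟫_ℂ =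
      ⟪ζ', ((if i = j then 1 else 0 : G.alg) : L →L[ℂ] L) ζ⟫_ℂ := by
    intro ζ' ζ
    -- The mirror image of the previous argument: `h` is applied to the second leg.
    have h1 : ∑ k, ⟪G.vac, (sliceFst ζ' ζ (G.comul (star (v i k) * v j k)) : L →L[ℂ] L) G.vac⟫_ℂ =
        ⟪ζ', ζ⟫_ℂ * (if i = j then 1 else 0) := by
      have htr : ∀ k, ⟪G.vac, ((star (v i k) * v j k : G.alg) : L →L[ℂ] L) G.vac⟫_ℂ =
          ⟪G.vac, ((v j k * star (v i k) : G.alg) : L →L[ℂ] L) G.vac⟫_ℂ := fun k => G.tracial _ _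
      simp only [G.invariant_left, ← Finset.mul_sum, htr]
      rw [sum_inner_vac, hv.sum_mul_star, inner_vac_ite]
      simp only [eq_comm]
    have h2 : ∑ k, ⟪G.vac, (sliceFst ζ' ζ (G.comul (star (v i k) * v j k)) : L →L[ℂ] L) G.vac⟫_ℂ =
        ∑ x : m × m, ⟪ζ', ((star (v i x.1) * v j x.2 : G.alg) : L →L[ℂ] L) ζ⟫_ℂ *
          (if x.1 = x.2 then 1 else 0) := by
      simp only [fun k => coe_sliceFst_of_eq_sum (hT k) ζ' ζ, sum_apply, inner_sum, smul_apply,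
        inner_smul_right]
      rw [Finset.sum_comm]
      refine Finset.sum_congr rfl fun x _ => ?_
      rw [← Finset.mul_sum]
      simp only [fun k => G.tracial (star (v x.1 k)) (v x.2 k)]
      rw [sum_inner_vac, hv.sum_mul_star, inner_vac_ite]
      simp only [eq_comm]
    rw [h2, Fintype.sum_prod_type] at h1
    simp only [mul_ite, mul_one, mul_zero, Finset.sum_ite_eq, Finset.mem_univ, if_true] at h1
    rw [AddSubmonoidClass.coe_finsetSum, sum_apply, inner_sum, h1]
    split_ifs <;> simp
  exact Subtype.ext (ContinuousLinearMap.ext fun ζ => ext_inner_left ℂ fun ζ' => key ζ' ζ)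

/-- The conjugate representation. -/
noncomputable def IrrRep.conj (π : IrrRep G) : IrrRep G where
  dim := π.dim
  dim_pos := π.dim_pos
  mat := π.mat.map star
  mat_unitary := by
    rw [Unitary.mem_iff]
    constructor
    · ext1 i j
      rw [Matrix.mul_apply, Matrix.one_apply, ← π.isUnitaryRep.sum_conj_mul i j]
      simp
    · ext1 i j
      rw [Matrix.mul_apply, Matrix.one_apply, ← π.isUnitaryRep.sum_mul_conj i j]
      simp
  comul_mat i j := π.isUnitaryRep.comul_star i j
  irreducible S hS := by
    have h : IsIntertwiner π.mat π.mat (S.map star) := by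
      ext1 i j
      have := congrArg star (congrFun (congrFun hS i) j)
      simp only [Matrix.mul_apply, Matrix.map_apply, star_sum, star_mul, star_star,
        ← algebraMap_star_comm] at this ⊢
      simpa only [Algebra.commutes] using this
    obtain ⟨c, hc⟩ := π.irreducible _ h
    refine ⟨star c, ?_⟩
    ext1 i j
    have := congrArg star (congrFun (congrFun hc i) j)
    rw [Matrix.map_apply, star_star] at this
    rw [this]
    by_cases hij : i = j <;> simp [hij]

end Conjugate

end Representations

end KacAction
namespace KacAction

/-! ### Complete reducibility of finite-dimensional unitary representations -/

section CompleteReducibility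

open scoped Matrix.Norms.L2Operator

variable {L : Type*} [NormedAddCommGroup L] [InnerProductSpace ℂ L] [CompleteSpace L]
  {G : CompactKacAlgebra L} {m : Type*} [Fintype m] [DecidableEq m] {w : Matrix m m G.alg}

theorem isIntertwiner_iff {m n : Type*} [Fintype m] [Fintype n] {v : Matrix m m G.alg}
    {w : Matrix n n G.alg} {S : Matrix n m ℂ} :
    IsIntertwiner v w S ↔ scal G.alg S * v = w * scal G.alg S := Iff.rfl

theorem IsIntertwiner.conjTranspose {n : Type*} [Fintype n] [DecidableEq n]
    {v : Matrix n n G.alg} (hv : v ∈ unitary (Matrix n n G.alg))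
    (hw : w ∈ unitary (Matrix m m G.alg)) {S : Matrix m n ℂ} (hS : IsIntertwiner v w S) :
    IsIntertwiner w v S.conjTranspose := by
  rw [isIntertwiner_iff] at hS ⊢
  have h := congrArg Matrix.conjTranspose hS
  rw [Matrix.conjTranspose_mul, Matrix.conjTranspose_mul, scal_conjTranspose] at h
  have hv1 : v * v.conjTranspose = 1 := (Unitary.mem_iff.1 hv).2
  have hw1 : w.conjTranspose * w = 1 := (Unitary.mem_iff.1 hw).1
  calc scal G.alg S.conjTranspose * w
      = v * (v.conjTranspose * scal G.alg S.conjTranspose) * w := by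
        rw [← Matrix.mul_assoc, hv1, Matrix.one_mul]
    _ = v * scal G.alg S.conjTranspose := by
        rw [h, Matrix.mul_assoc, Matrix.mul_assoc, hw1, Matrix.mul_one]

/-- The `*`-algebra of self-intertwiners of a unitary representation. -/
def endAlg (hw : w ∈ unitary (Matrix m m G.alg)) : StarSubalgebra ℂ (Matrix m m ℂ) where
  carrier := {S | IsIntertwiner w w S}
  mul_mem' {a b} ha hb := by
    change IsIntertwiner _ _ _
    rw [Set.mem_ofPred_eq, isIntertwiner_iff] at *
    rw [scal_mul, Matrix.mul_assoc, hb, ← Matrix.mul_assoc, ha, Matrix.mul_assoc]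
  add_mem' {a b} ha hb := by
    change IsIntertwiner _ _ _
    rw [Set.mem_ofPred_eq, isIntertwiner_iff] at *
    rw [scal_add, Matrix.add_mul, Matrix.mul_add, ha, hb]
  algebraMap_mem' c := by
    change IsIntertwiner _ _ _
    rw [isIntertwiner_iff, Algebra.algebraMap_eq_smul_one, scal_smul, scal_one, smul_mul_assoc,
      mul_smul_comm, one_mul, mul_one]
  star_mem' {a} ha := IsIntertwiner.conjTranspose hw hw ha

/-- An orthogonal projection matrix factors as `T T*` with an isometry `T`. -/
theorem exists_isometry_of_projection {p : Matrix m m ℂ} (hs : p.conjTranspose = p)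
    (hp : p * p = p) : ∃ (k : ℕ) (T : Matrix m (Fin k) ℂ), T.conjTranspose * T = 1 ∧
      T * T.conjTranspose = p := by
  set U := LinearMap.range (Matrix.toEuclideanLin p) with hU
  set b := stdOrthonormalBasis ℂ U with hb
  -- The columns of `T` are an orthonormal basis of the range of `p`.
  set T : Matrix m (Fin (Module.finrank ℂ U)) ℂ := Matrix.of fun i j => (b j : EuclideanSpace ℂ m) i
    with hT
  have hTT : T.conjTranspose * T = 1 := by
    ext1 i j
    have h := orthonormal_iff_ite.1 b.orthonormal i j
    rw [Submodule.coe_inner, PiLp.inner_apply] at h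
    rw [Matrix.mul_apply, Matrix.one_apply, ← h]
    refine Finset.sum_congr rfl fun k _ => ?_
    simp [hT, mul_comm]
  have hTp : p = T * T.conjTranspose * p := by
    have key : ∀ (x : EuclideanSpace ℂ m) (i : m), (Matrix.toEuclideanLin p x) i =
        ∑ j, (∑ k, (starRingEnd ℂ) ((b j : EuclideanSpace ℂ m) k) * (Matrix.toEuclideanLin p x) k) *
          (b j : EuclideanSpace ℂ m) i := by
      intro x i
      have h1 := b.sum_repr' ⟨Matrix.toEuclideanLin p x, ⟨x, rfl⟩⟩
      have h2 := congrArg (fun u : U => (u : EuclideanSpace ℂ m) i) h1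
      simp only at h2
      rw [← h2]
      simp only [AddSubmonoidClass.coe_finsetSum, Submodule.coe_smul, Submodule.coe_inner,
        PiLp.inner_apply, RCLike.inner_apply, PiLp.smul_apply, smul_eq_mul, WithLp.ofLp_sum,
        Finset.sum_apply]
      refine Finset.sum_congr rfl fun j _ => ?_
      congr 1
      refine Finset.sum_congr rfl fun k _ => mul_comm _ _
    ext1 i j
    have h := key (WithLp.toLp 2 (Pi.single j 1)) i
    have e : ∀ k, (Matrix.toEuclideanLin p (WithLp.toLp 2 (Pi.single j 1))) k = p k j := fun k => by
      simp [Matrix.toLpLin_apply]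
    simp only [e] at h
    rw [h, Matrix.mul_assoc, Matrix.mul_apply]
    refine Finset.sum_congr rfl fun l _ => ?_
    rw [mul_comm, Matrix.mul_apply]
    rfl
  refine ⟨_, T, hTT, ?_⟩
  have hpT : p * T = T := by
    ext1 i j
    obtain ⟨x, hx⟩ := (b j).2
    have h1 : Matrix.toEuclideanLin p (b j : EuclideanSpace ℂ m) = b j := by
      rw [← hx, ← LinearMap.comp_apply]
      congr 1
      rw [Matrix.toEuclideanLin_eq_toLin_orthonormal, ← Matrix.toLin_mul, hp]
    have h2 := congrArg (fun x : EuclideanSpace ℂ m => x i) h1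
    simpa [Matrix.toLpLin_apply, Matrix.mul_apply, Matrix.mulVec, dotProduct, hT] using h2
  have h3 := congrArg Matrix.conjTranspose hTp
  rw [Matrix.conjTranspose_mul, Matrix.conjTranspose_mul, Matrix.conjTranspose_conjTranspose, hs,
    ← Matrix.mul_assoc, hpT] at h3
  exact h3.symm

/-- A minimal projection in the commutant of a unitary representation cuts out an irreducible
subrepresentation. -/
theorem IsUnitaryRep.exists_irrRep (hw : IsUnitaryRep G w) {p : Matrix m m ℂ}
    (hp : IsMinimalProjIn (endAlg hw.mem_unitary) p) (hp0 : p ≠ 0) :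
    ∃ (ρ : IrrRep G) (T : Matrix m (Fin ρ.dim) ℂ), IsIntertwiner ρ.mat w T ∧
      T * T.conjTranspose = p := by
  obtain ⟨⟨hpE, hps, hpp⟩, hmin⟩ := hp
  obtain ⟨k, T, hT1, hT2⟩ := exists_isometry_of_projection hps hpp
  have hpE' : scal G.alg p * w = w * scal G.alg p := hpE
  have hT1' : scal G.alg T.conjTranspose * scal G.alg T = 1 := by rw [← scal_mul, hT1, scal_one]
  have hT2' : scal G.alg T * scal G.alg T.conjTranspose = scal G.alg p := by rw [← scal_mul, hT2]
  have hpT : scal G.alg p * scal G.alg T = scal G.alg T := by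
    rw [← hT2', Matrix.mul_assoc, hT1', Matrix.mul_one]
  have hTp : scal G.alg T.conjTranspose * scal G.alg p = scal G.alg T.conjTranspose := by
    rw [← hT2', ← Matrix.mul_assoc, hT1', Matrix.one_mul]
  -- The subrepresentation is the compression of `w` by `T`; as `p` commutes with `w`, both `T` and
  -- its adjoint intertwine.
  set w' : Matrix (Fin k) (Fin k) G.alg := scal G.alg T.conjTranspose * w * scal G.alg T with hw'
  have hTw : scal G.alg T * w' = w * scal G.alg T := by
    rw [hw', ← Matrix.mul_assoc, ← Matrix.mul_assoc, hT2', hpE', Matrix.mul_assoc, hpT]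
  have hwT : w' * scal G.alg T.conjTranspose = scal G.alg T.conjTranspose * w := by
    rw [hw', Matrix.mul_assoc, Matrix.mul_assoc, hT2', ← hpE', ← Matrix.mul_assoc, hTp]
  have hstar : star w' = scal G.alg T.conjTranspose * star w * scal G.alg T := by
    simp only [Matrix.star_eq_conjTranspose]
    rw [hw', Matrix.conjTranspose_mul, Matrix.conjTranspose_mul, scal_conjTranspose,
      scal_conjTranspose, Matrix.conjTranspose_conjTranspose, Matrix.mul_assoc]
  obtain ⟨hu1, hu2⟩ := Unitary.mem_iff.1 hw.mem_unitary
  have hk : 0 < k := by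
    rcases Nat.eq_zero_or_pos k with rfl | h
    · refine absurd ?_ hp0
      rw [← hT2]
      ext1 i j
      simp [Matrix.mul_apply]
    · exact h
  have hentry : ∀ i j, w' i j = ∑ a, ∑ b, (star (T a i) * T b j) • w a b := by
    intro i j
    rw [hw', Matrix.mul_apply]
    simp only [Matrix.mul_apply, Finset.sum_mul, scal_apply, Matrix.conjTranspose_apply]
    rw [Finset.sum_comm]
    refine Finset.sum_congr rfl fun a _ => Finset.sum_congr rfl fun b _ => ?_
    rw [mul_smul, Algebra.smul_def, Algebra.smul_def, mul_assoc, ← Algebra.commutes (T b j)]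
  refine ⟨⟨k, hk, w', ?_, ?_, ?_⟩, T, hTw, hT2⟩
  · rw [Unitary.mem_iff, hstar]
    constructor
    · rw [Matrix.mul_assoc, Matrix.mul_assoc, hTw, ← Matrix.mul_assoc (star w), hu1,
        Matrix.one_mul, hT1']
    · rw [← Matrix.mul_assoc, ← Matrix.mul_assoc, hwT, Matrix.mul_assoc _ w, hu2,
        Matrix.mul_one, hT1']
  · intro i j
    have h1 : (G.comul (w' i j) : HilbertTensor L L →L[ℂ] HilbertTensor L L) =
        ∑ a, ∑ b, (star (T a i) * T b j) • ∑ c, tensorOp (w a c : L →L[ℂ] L) (w c b : L →L[ℂ] L) := by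
      simp only [← hw.comul_apply]
      rw [hentry, map_sum, AddSubmonoidClass.coe_finsetSum]
      refine Finset.sum_congr rfl fun a _ => ?_
      rw [map_sum, AddSubmonoidClass.coe_finsetSum]
      refine Finset.sum_congr rfl fun b _ => ?_
      rw [map_smul]
      rfl
    rw [h1]
    -- The comultiplication formula follows by pushing `T*` through `w` in the first leg, after
    -- which `T` and `T*` compress the second leg to `w'`.
    have hA : ∀ i c, (∑ a, star (T a i) • (w a c : L →L[ℂ] L)) =
        ∑ l, star (T c l) • (w' i l : L →L[ℂ] L) := by
      intro i c
      have := congrArg (fun x : G.alg => (x : L →L[ℂ] L)) (congrFun (congrFun hwT i) c)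
      simp only [Matrix.mul_apply, scal_apply, Matrix.conjTranspose_apply, ← Algebra.smul_def,
        ← Algebra.commutes, AddSubmonoidClass.coe_finsetSum] at this
      exact this.symm
    have hB : ∀ l j, (∑ c, star (T c l) • ∑ b, T b j • (w c b : L →L[ℂ] L)) = (w' l j : L →L[ℂ] L) := by
      intro l j
      rw [hentry, AddSubmonoidClass.coe_finsetSum]
      refine Finset.sum_congr rfl fun a _ => ?_
      rw [AddSubmonoidClass.coe_finsetSum, Finset.smul_sum]
      refine Finset.sum_congr rfl fun b _ => ?_
      rw [mul_smul]
      rfl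
    have h2 : ∑ a, ∑ b, (star (T a i) * T b j) • ∑ c, tensorOp (w a c : L →L[ℂ] L) (w c b : L →L[ℂ] L)
        = ∑ c, tensorOp (∑ a, star (T a i) • (w a c : L →L[ℂ] L))
            (∑ b, T b j • (w c b : L →L[ℂ] L)) := by
      have h3 : ∀ a, ∑ b, (star (T a i) * T b j) • ∑ c, tensorOp (w a c : L →L[ℂ] L)
          (w c b : L →L[ℂ] L) = ∑ c, ∑ b, (star (T a i) * T b j) • tensorOp (w a c : L →L[ℂ] L)
          (w c b : L →L[ℂ] L) := fun a => by
        simp only [Finset.smul_sum]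
        exact Finset.sum_comm
      simp only [h3]
      rw [Finset.sum_comm]
      refine Finset.sum_congr rfl fun c _ => ?_
      rw [tensorOp_sum_left]
      refine Finset.sum_congr rfl fun a _ => ?_
      rw [tensorOp_smul_left, tensorOp_sum_right, Finset.smul_sum]
      refine Finset.sum_congr rfl fun b _ => ?_
      rw [tensorOp_smul_right, smul_smul]
    rw [h2]
    simp only [hA, tensorOp_sum_left, tensorOp_smul_left]
    rw [Finset.sum_comm]
    refine Finset.sum_congr rfl fun l _ => ?_
    rw [← hB l j, tensorOp_sum_right]
    simp only [tensorOp_smul_right]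
  · intro S hS
    have hS' : scal G.alg S * w' = w' * scal G.alg S := hS
    -- A self-intertwiner `S` of `w'` is transported to one of `w`, where minimality of `p` makes it
    -- a multiple of `p`.
    have hmem : T * S * T.conjTranspose ∈ endAlg hw.mem_unitary := by
      change scal G.alg _ * w = w * scal G.alg _
      rw [scal_mul, scal_mul, Matrix.mul_assoc, ← hwT, Matrix.mul_assoc, ← Matrix.mul_assoc _ w',
        hS', Matrix.mul_assoc w', ← Matrix.mul_assoc, hTw]
      simp only [Matrix.mul_assoc]
    obtain ⟨c, hc⟩ := hmin _ hmem
    refine ⟨c, ?_⟩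
    have h1 : T.conjTranspose * (p * (T * S * T.conjTranspose) * p) * T = S := by
      rw [← hT2]
      simp only [Matrix.mul_assoc, hT1, Matrix.mul_one]
      simp only [← Matrix.mul_assoc, hT1, Matrix.one_mul]
    rw [← h1, hc, ← hT2]
    rw [Matrix.mul_smul, Matrix.smul_mul, ← Matrix.mul_assoc, hT1, Matrix.one_mul, hT1]

/-- Complete reducibility: the ranges of intertwiners from irreducible representations span. -/
theorem IsUnitaryRep.one_mem_span (hw : IsUnitaryRep G w) (R : IrrSystem G) :
    (1 : Matrix m m ℂ) ∈ Submodule.span ℂ {Z : Matrix m m ℂ | ∃ σ, ∃ S : Matrix m (R.Ix σ) ℂ,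
      IsIntertwiner (R.rep σ).mat w S ∧ Z = S * S.conjTranspose} := by
  have : FiniteDimensional ℂ (endAlg hw.mem_unitary) :=
    inferInstanceAs (FiniteDimensional ℂ (endAlg hw.mem_unitary).toSubalgebra.toSubmodule)
  obtain ⟨l, hl, hsum⟩ := exists_list_minimal_sum (N := endAlg hw.mem_unitary)
  rw [← hsum]
  refine list_sum_mem fun p hp => ?_
  by_cases hp0 : p = 0
  · rw [hp0]; exact zero_mem _
  obtain ⟨ρ, T, hT, hTp⟩ := hw.exists_irrRep (hl p hp) hp0
  -- Passing to the chosen representative of the class by a unitary `U` does not change `TT*`.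
  obtain ⟨U, hU, hU1, hU2⟩ :
      (R.rep (Quotient.mk _ ρ)).Equivalent ρ := Quotient.exact (R.mk_rep (Quotient.mk _ ρ))
  refine Submodule.subset_span ⟨Quotient.mk _ ρ, T * U, ?_, ?_⟩
  · rw [isIntertwiner_iff] at *
    rw [scal_mul, Matrix.mul_assoc, hU, ← Matrix.mul_assoc, hT, Matrix.mul_assoc]
  · rw [Matrix.conjTranspose_mul, Matrix.mul_assoc, ← Matrix.mul_assoc U, hU2, Matrix.one_mul, hTp]

end CompleteReducibility

/-! ### The trivial representation and invariant vectors -/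

section Trivial

variable {L : Type*} [NormedAddCommGroup L] [InnerProductSpace ℂ L] [CompleteSpace L]
  {G : CompactKacAlgebra L} (R : IrrSystem G)

theorem IrrSystem.exists_equivalence_triv :
    (R.rep (Irr.triv G)).Equivalent (trivialRep G) := Quotient.exact (R.mk_rep (Irr.triv G))

theorem IrrSystem.mat_triv : (R.rep (Irr.triv G)).mat = 1 := by
  obtain ⟨U, hU, hU1, -⟩ := R.exists_equivalence_triv
  have h1 : scal G.alg U.conjTranspose * scal G.alg U = 1 := by rw [← scal_mul, hU1, scal_one]
  have h2 : scal G.alg U * (R.rep (Irr.triv G)).mat = scal G.alg U := by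
    rw [isIntertwiner_iff] at hU
    rw [hU]
    exact Matrix.one_mul _
  calc _ = scal G.alg U.conjTranspose * (scal G.alg U * (R.rep (Irr.triv G)).mat) := by
        rw [← Matrix.mul_assoc, h1, Matrix.one_mul]
    _ = 1 := by rw [h2, h1]

/-- The equivalence `U` with the trivial representation has one row, so `U*U` has rank at most one
while being the identity. -/
instance IrrSystem.subsingleton_triv : Subsingleton (R.Ix (Irr.triv G)) := by
  obtain ⟨U, -, hU1, -⟩ := R.exists_equivalence_triv
  refine ⟨fun j k => ?_⟩
  by_contra hjk
  have e : ∀ a b, (U.conjTranspose * U) a b = star (U (0 : Fin 1) a) * U (0 : Fin 1) b :=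
    fun a b => by
      rw [Matrix.mul_apply]
      exact Fin.sum_univ_one _
  have h1 := e j k
  have h2 := e j j
  have h3 := e k k
  rw [hU1, Matrix.one_apply_ne hjk] at h1
  rw [hU1, Matrix.one_apply_eq] at h2 h3
  rcases mul_eq_zero.1 h1.symm with h | h
  · rw [h, zero_mul] at h2
    exact one_ne_zero h2
  · rw [h, mul_zero] at h3
    exact one_ne_zero h3

instance IrrSystem.nonempty_triv : Nonempty (R.Ix (Irr.triv G)) :=
  ⟨⟨0, (R.rep (Irr.triv G)).dim_pos⟩⟩

/-- A nontrivial irreducible representation has no nonzero invariant vector. -/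
theorem IrrSystem.eq_zero_of_invariant {τ : Irr G} (hτ : τ ≠ Irr.triv G) {κ : Type*}
    {F : Matrix κ (R.Ix τ) ℂ} (hF : scal G.alg F * (R.rep τ).mat = scal G.alg F) : F = 0 := by
  by_contra hne
  obtain ⟨i, j, hij⟩ : ∃ i j, F i j ≠ 0 := by
    by_contra hcon
    push Not at hcon
    exact hne (Matrix.ext hcon)
  apply hτ
  set f : Matrix (Fin 1) (R.Ix τ) ℂ := Matrix.of fun _ k => F i k with hf
  have hfv : scal G.alg f * (R.rep τ).mat = scal G.alg f := by
    ext1 a k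
    exact congrFun (congrFun hF i) k
  have hvu := Unitary.mem_iff.1 (R.rep τ).mat_unitary
  have hvf : (R.rep τ).mat * scal G.alg f.conjTranspose = scal G.alg f.conjTranspose := by
    have h := congrArg Matrix.conjTranspose hfv
    rw [Matrix.conjTranspose_mul, scal_conjTranspose] at h
    have h2 : (R.rep τ).mat * (R.rep τ).mat.conjTranspose = 1 := hvu.2
    calc _ = (R.rep τ).mat * ((R.rep τ).mat.conjTranspose * scal G.alg f.conjTranspose) := by rw [h]
      _ = _ := by rw [← Matrix.mul_assoc, h2, Matrix.one_mul]
  -- An invariant row `f` makes `f*f` a self-intertwiner, hence a scalar; being nonzero of rank one,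
  -- it forces dimension one.
  obtain ⟨c, hc⟩ := (R.rep τ).irreducible (f.conjTranspose * f) (by
    rw [isIntertwiner_iff, scal_mul, Matrix.mul_assoc, hfv, ← Matrix.mul_assoc, hvf])
  have e : ∀ a b, (f.conjTranspose * f) a b = star (F i a) * F i b := fun a b => by
    rw [Matrix.mul_apply]
    exact Fin.sum_univ_one _
  have hc0 : c ≠ 0 := by
    have h1 := e j j
    rw [hc, Matrix.smul_apply, Matrix.one_apply_eq, smul_eq_mul, mul_one] at h1
    rw [h1]
    exact mul_ne_zero (star_ne_zero.2 hij) hij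
  have hsub : ∀ k, k = j := by
    intro k
    by_contra hkj
    have h1 := e k j
    have h2 := e k k
    rw [hc, Matrix.smul_apply, Matrix.one_apply_ne hkj, smul_zero] at h1
    rw [hc, Matrix.smul_apply, Matrix.one_apply_eq, smul_eq_mul, mul_one] at h2
    rcases mul_eq_zero.1 h1.symm with h | h
    · rw [h, zero_mul] at h2
      exact hc0 h2
    · exact hij h
  rw [← R.mk_rep τ]
  -- In dimension one the invariance of `f` says that the only matrix entry is `1`, so the scalar
  -- `1` implements the equivalence with the trivial representation.
  refine Quotient.sound ⟨Matrix.of fun _ _ => 1, ?_, ?_, ?_⟩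
  · have hmat : (R.rep τ).mat j j = 1 := by
      have h1 := congrFun (congrFun hfv 0) j
      rw [Matrix.mul_apply, Fintype.sum_eq_single j (fun k hk => absurd (hsub k) hk)] at h1
      have h2 : ((F i j)⁻¹ • (algebraMap ℂ G.alg (F i j))) = (1 : G.alg) := by
        rw [Algebra.algebraMap_eq_smul_one, smul_smul, inv_mul_cancel₀ hij, one_smul]
      have h3 : algebraMap ℂ G.alg (F i j) * (R.rep τ).mat j j = algebraMap ℂ G.alg (F i j) := h1
      have h4 : ((F i j)⁻¹ • algebraMap ℂ G.alg (F i j)) * (R.rep τ).mat j j =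
          (F i j)⁻¹ • algebraMap ℂ G.alg (F i j) := by rw [smul_mul_assoc, h3]
      rwa [h2, one_mul] at h4
    rw [isIntertwiner_iff]
    ext1 a k
    rw [Matrix.mul_apply, Fintype.sum_eq_single j (fun k hk => absurd (hsub k) hk), hsub k, hmat,
      mul_one]
    exact (congrFun (congrFun (Matrix.one_mul
      (scal G.alg (Matrix.of fun (_ : Fin 1) (_ : R.Ix τ) => (1 : ℂ)))) a) j).symm
  · ext1 a b
    rw [hsub a, hsub b, Matrix.one_apply_eq, Matrix.mul_apply]
    refine (Fin.sum_univ_one _).trans ?_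
    change star (1 : ℂ) * 1 = 1
    rw [star_one, one_mul]
  · ext1 a b
    rw [show a = b from Subsingleton.elim (α := Fin 1) a b, Matrix.one_apply_eq, Matrix.mul_apply,
      Fintype.sum_eq_single j (fun k hk => absurd (hsub k) hk)]
    change (1 : ℂ) * star 1 = 1
    rw [star_one, one_mul]

end Trivial

/-! ### Tensor products and conjugate pairs of representations -/

section TensorProduct

variable {L : Type*} [NormedAddCommGroup L] [InnerProductSpace ℂ L] [CompleteSpace L]
  {G : CompactKacAlgebra L} {m n : Type*} [Fintype m] [DecidableEq m] [Fintype n] [DecidableEq n]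
  {v : Matrix m m G.alg} {w : Matrix n n G.alg}

theorem IsUnitaryRep.tensorRep (hv : IsUnitaryRep G v) (hw : IsUnitaryRep G w) :
    IsUnitaryRep G (tensorRep v w) := by
  refine ⟨Unitary.mem_iff.2 ⟨?_, ?_⟩, fun i j => ?_⟩
  · ext1 i j
    have h : ∀ k : m × n, star (v k.1 i.1 * w k.2 i.2) * (v k.1 j.1 * w k.2 j.2) =
      star (w k.2 i.2) * (star (v k.1 i.1) * v k.1 j.1) * w k.2 j.2 := fun k => by
        rw [star_mul]; simp only [mul_assoc]
    rw [Matrix.mul_apply]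
    change ∑ k : m × n, star (v k.1 i.1 * w k.2 i.2) * (v k.1 j.1 * w k.2 j.2) = _
    simp only [h]
    rw [Fintype.sum_prod_type_right]
    simp only [← Finset.sum_mul, ← Finset.mul_sum, hv.sum_star_mul]
    by_cases h1 : i.1 = j.1
    · simp only [h1, if_true, mul_one, hw.sum_star_mul, Matrix.one_apply, Prod.ext_iff, true_and]
    · simp [h1, Prod.ext_iff]
  · ext1 i j
    have h : ∀ k : m × n, v i.1 k.1 * w i.2 k.2 * star (v j.1 k.1 * w j.2 k.2) =
      v i.1 k.1 * (w i.2 k.2 * star (w j.2 k.2)) * star (v j.1 k.1) := fun k => by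
        rw [star_mul]; simp only [mul_assoc]
    rw [Matrix.mul_apply]
    change ∑ k : m × n, v i.1 k.1 * w i.2 k.2 * star (v j.1 k.1 * w j.2 k.2) = _
    simp only [h]
    rw [Fintype.sum_prod_type]
    simp only [← Finset.sum_mul, ← Finset.mul_sum, hw.sum_mul_star]
    by_cases h1 : i.2 = j.2
    · simp only [h1, if_true, mul_one, hv.sum_mul_star, Matrix.one_apply, Prod.ext_iff, and_true]
    · simp [h1, Prod.ext_iff]
  · change (G.comul (v i.1 j.1 * w i.2 j.2) : HilbertTensor L L →L[ℂ] HilbertTensor L L) = _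
    rw [coe_comul_mul, hv.comul_apply, hw.comul_apply, Finset.sum_mul_sum, Fintype.sum_prod_type]
    simp only [tensorOp_mul]
    rfl

end TensorProduct

section ConjugateEquations

variable {L : Type*} [NormedAddCommGroup L] [InnerProductSpace ℂ L] [CompleteSpace L]
  {G : CompactKacAlgebra L} (R : IrrSystem G)

/-- The conjugate class `π̄`, with a unitary `T : H_π → H_π̄` implementing the conjugation: it
defines invariant vectors in `π̄·π` and `π·π̄`. -/
theorem IrrSystem.exists_conj (π : Irr G) : ∃ (ρ : Irr G) (T : Matrix (R.Ix ρ) (R.Ix π) ℂ),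
    T.conjTranspose * T = 1 ∧
    (Matrix.of fun p _ => T p.1 p.2) ∈ R.Hom₂ (Irr.triv G) ρ π ∧
    (Matrix.of fun p _ => T p.2 p.1) ∈ R.Hom₂ (Irr.triv G) π ρ := by
  set ρ : Irr G := Quotient.mk _ (R.rep π).conj with hρ
  obtain ⟨T, hT1, hTe⟩ : ∃ T : Matrix (R.Ix ρ) (R.Ix π) ℂ, T.conjTranspose * T = 1 ∧
      ∀ (p : R.Ix ρ) (k : R.Ix π), ∑ q, (R.rep ρ).mat p q * algebraMap ℂ G.alg (T q k) =
        ∑ l, algebraMap ℂ G.alg (T p l) * star ((R.rep π).mat l k) := by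
    obtain ⟨T, hT, hT1, -⟩ : (R.rep π).conj.Equivalent (R.rep ρ) :=
      Quotient.exact (R.mk_rep (Quotient.mk _ (R.rep π).conj)).symm
    refine ⟨T, hT1, fun p k => ?_⟩
    exact (congrFun (congrFun hT p) k).symm
  have hv := (R.rep π).isUnitaryRep
  refine ⟨ρ, T, hT1, ?_, ?_⟩
  · change IsIntertwiner _ _ _
    rw [isIntertwiner_iff, R.mat_triv, Matrix.mul_one]
    ext1 p z
    rw [Matrix.mul_apply]
    change algebraMap ℂ G.alg (T p.1 p.2) = ∑ q : R.Ix ρ × R.Ix π,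
      (R.rep ρ).mat p.1 q.1 * (R.rep π).mat p.2 q.2 * algebraMap ℂ G.alg (T q.1 q.2)
    have h : ∀ q : R.Ix ρ × R.Ix π,
        (R.rep ρ).mat p.1 q.1 * (R.rep π).mat p.2 q.2 * algebraMap ℂ G.alg (T q.1 q.2) =
        ((R.rep ρ).mat p.1 q.1 * algebraMap ℂ G.alg (T q.1 q.2)) * (R.rep π).mat p.2 q.2 :=
      fun q => by rw [mul_assoc, mul_assoc, Algebra.commutes]
    simp only [h]
    rw [Fintype.sum_prod_type_right]
    simp only [← Finset.sum_mul, hTe]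
    simp only [Finset.sum_mul]
    rw [Finset.sum_comm]
    -- Invariance in `π̄·π` uses unitarity of the matrix of adjoints, hence traciality; invariance
    -- in `π·π̄` below uses only unitarity of `v`.
    simp only [mul_assoc, ← Finset.mul_sum, hv.sum_mul_conj]
    simp
  · change IsIntertwiner _ _ _
    rw [isIntertwiner_iff, R.mat_triv, Matrix.mul_one]
    ext1 p z
    rw [Matrix.mul_apply]
    change algebraMap ℂ G.alg (T p.2 p.1) = ∑ q : R.Ix π × R.Ix ρ,
      (R.rep π).mat p.1 q.1 * (R.rep ρ).mat p.2 q.2 * algebraMap ℂ G.alg (T q.2 q.1)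
    rw [Fintype.sum_prod_type]
    simp only [mul_assoc, ← Finset.mul_sum, hTe]
    simp only [Finset.mul_sum]
    rw [Finset.sum_comm]
    have h : ∀ l k, (R.rep π).mat p.1 k *
        (algebraMap ℂ G.alg (T p.2 l) * star ((R.rep π).mat l k)) =
        algebraMap ℂ G.alg (T p.2 l) * ((R.rep π).mat p.1 k * star ((R.rep π).mat l k)) :=
      fun l k => by rw [← mul_assoc, ← Algebra.commutes, mul_assoc]
    simp only [h, ← Finset.mul_sum, hv.sum_mul_star]
    simp

end ConjugateEquations

end KacAction
namespace KacAction

/-! ### Conjugate equations for a cocycle action -/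

section CocycleActions

variable {H : Type*} [NormedAddCommGroup H] [InnerProductSpace ℂ H] [CompleteSpace H]
  {L : Type*} [NormedAddCommGroup L] [InnerProductSpace ℂ L] [CompleteSpace L]
  {G : CompactKacAlgebra L} {R : IrrSystem G} {M : VonNeumannAlgebra H}

/-- By complete reducibility it is enough to test on `SS* ⊗ 1` with `S` an intertwiner from an
irreducible `τ`. For `τ` trivial the block is `u_{1,σ} = 1`; otherwise `FS` is an invariant row, and
so vanishes. -/
theorem IsComulBlockLeft.scal_mul_eq
    {u : ∀ π ρ, Matrix (R.Ix π × R.Ix ρ) (R.Ix π × R.Ix ρ) M} {π ρ σ : Irr G}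
    {Y : Matrix ((R.Ix π × R.Ix ρ) × R.Ix σ) ((R.Ix π × R.Ix ρ) × R.Ix σ) M}
    (hY : IsComulBlockLeft R M u π ρ σ Y) (hu : u (Irr.triv G) σ = 1) {κ : Type*}
    {F : Matrix κ (R.Ix π × R.Ix ρ) ℂ}
    (hF : scal G.alg F * tensorRep (R.rep π).mat (R.rep ρ).mat = scal G.alg F) :
    scal M (F ⊗ₖ (1 : Matrix (R.Ix σ) (R.Ix σ) ℂ)) * Y =
      scal M (F ⊗ₖ (1 : Matrix (R.Ix σ) (R.Ix σ) ℂ)) := by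
  have hspan := ((R.rep π).isUnitaryRep.tensorRep (R.rep ρ).isUnitaryRep).one_mem_span R
  have key : ∀ Z ∈ Submodule.span ℂ {Z : Matrix (R.Ix π × R.Ix ρ) (R.Ix π × R.Ix ρ) ℂ |
      ∃ σ, ∃ S : Matrix _ (R.Ix σ) ℂ, IsIntertwiner (R.rep σ).mat
        (tensorRep (R.rep π).mat (R.rep ρ).mat) S ∧ Z = S * S.conjTranspose},
      scal M (F ⊗ₖ (1 : Matrix (R.Ix σ) (R.Ix σ) ℂ)) * Y *
        scal M (Z ⊗ₖ (1 : Matrix (R.Ix σ) (R.Ix σ) ℂ)) =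
      scal M (F ⊗ₖ (1 : Matrix (R.Ix σ) (R.Ix σ) ℂ)) *
        scal M (Z ⊗ₖ (1 : Matrix (R.Ix σ) (R.Ix σ) ℂ)) := by
    intro Z hZ
    induction hZ using Submodule.span_induction with
    | mem Z hZ =>
      obtain ⟨τ, S, hS, rfl⟩ := hZ
      have e : scal M ((S * S.conjTranspose) ⊗ₖ (1 : Matrix (R.Ix σ) (R.Ix σ) ℂ)) =
          scal M (S ⊗ₖ (1 : Matrix (R.Ix σ) (R.Ix σ) ℂ)) *
            scal M (S.conjTranspose ⊗ₖ (1 : Matrix (R.Ix σ) (R.Ix σ) ℂ)) := by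
        rw [← scal_mul, ← Matrix.mul_kronecker_mul, Matrix.one_mul]
      rw [e, ← Matrix.mul_assoc, ← Matrix.mul_assoc]
      congr 1
      rw [Matrix.mul_assoc, hY τ S hS, ← Matrix.mul_assoc]
      by_cases hτ : τ = Irr.triv G
      · subst hτ
        rw [hu, Matrix.mul_one]
      · have h0 : F * S = 0 := by
          refine R.eq_zero_of_invariant hτ ?_
          rw [isIntertwiner_iff] at hS
          rw [scal_mul, Matrix.mul_assoc, hS, ← Matrix.mul_assoc, hF]
        rw [← scal_mul, ← Matrix.mul_kronecker_mul, h0, Matrix.zero_kronecker, scal_zero,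
          Matrix.zero_mul]
    | zero => simp only [Matrix.zero_kronecker, scal_zero, Matrix.mul_zero]
    | add a b _ _ ha hb => simp only [Matrix.add_kronecker, scal_add, Matrix.mul_add, ha, hb]
    | smul c a _ ha => simp only [Matrix.smul_kronecker, scal_smul, Matrix.mul_smul, ha]
  have h := key 1 hspan
  rwa [Matrix.one_kronecker_one, scal_one, Matrix.mul_one, Matrix.mul_one] at h

theorem sum_mul_algebraMap_ite {A ι κ : Type*} [Ring A] [Algebra ℂ A] [Fintype ι] [DecidableEq ι]
    [Fintype κ] [Subsingleton κ] (f : ι × κ → A) (z : κ) (j : ι) :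
    ∑ q, f q * algebraMap ℂ A (if q.1 = j then 1 else 0) = f (j, z) := by
  classical
  rw [Fintype.sum_eq_single (j, z) (fun q hq => ?_)]
  · simp
  · have : q.1 ≠ j := fun h => hq (Prod.ext h (Subsingleton.elim _ _))
    simp [this]

theorem sum_algebraMap_ite_mul {A ι κ : Type*} [Ring A] [Algebra ℂ A] [Fintype ι] [DecidableEq ι]
    (f : ι → A) (p : ι × κ) :
    ∑ k, algebraMap ℂ A (if p.1 = k then 1 else 0) * f k = f p.1 := by
  rw [Fintype.sum_eq_single p.1 (fun q hq => ?_)]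
  · simp
  · simp [hq.symm]

namespace CocycleAction

variable (c : CocycleAction R M)

/-- That `α` is the identity at the trivial class is not an axiom. Since `π·1` is equivalent to `π`
and `u_{π,1} = 1`, the elements `α_1(x)` and `x` have the same image under every `α_π`, and `α` is
faithful. -/
theorem α_triv_apply (x : M) (z z' : R.Ix (Irr.triv G)) : c.α (Irr.triv G) x z z' = x := by
  rw [Subsingleton.elim z' z]
  refine sub_eq_zero.1 (c.faithful _ fun π => ?_)
  rw [map_sub, sub_eq_zero]
  obtain ⟨Y, hY, h⟩ := c.twisted π (Irr.triv G) x
  rw [c.u_triv_right, Matrix.one_mul, star_one, Matrix.mul_one] at h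
  set S : Matrix (R.Ix π × R.Ix (Irr.triv G)) (R.Ix π) ℂ :=
    Matrix.of fun p j => if p.1 = j then 1 else 0
  have hmem : S ∈ R.Hom₂ π π (Irr.triv G) := by
    change _ = _
    ext1 p j
    refine (sum_algebraMap_ite_mul (fun k => (R.rep π).mat k j) p).trans ?_
    refine Eq.trans ?_ (sum_mul_algebraMap_ite
      (fun q => tensorRep (R.rep π).mat (R.rep (Irr.triv G)).mat p q) z j).symm
    change _ = (R.rep π).mat p.1 j * (R.rep (Irr.triv G)).mat p.2 z
    rw [R.mat_triv, Subsingleton.elim p.2 z, Matrix.one_apply_eq, mul_one]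
  ext1 i j
  have h1 := congrFun (congrFun (hY π S hmem) (i, z)) j
  have h2 := (sum_mul_algebraMap_ite (fun q => Y (i, z) q) z j).symm.trans
    (h1.trans (sum_algebraMap_ite_mul (fun k => c.α π x k j) (i, z)))
  have h3 := congrFun (congrFun h (i, z)) (j, z)
  exact h3.trans h2

/-- The column `u_{σ,ρ} (1 ⊗ S)` for an intertwiner `S ∈ (1, σ·ρ)`. -/
noncomputable def col (σ ρ : Irr G) (S : Matrix (R.Ix σ × R.Ix ρ) (R.Ix (Irr.triv G)) ℂ)
    (z : R.Ix (Irr.triv G)) (p : R.Ix σ × R.Ix ρ) : M :=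
  (c.u σ ρ * scal M S) p z

/-- The column `u(1 ⊗ S)` intertwines the identity with `α_σ α_ρ`: the unitary `u` turns the twisted
composition into the coproduct block, and `S` picks out its trivial component. -/
theorem sum_mul_col {σ ρ : Irr G} {S : Matrix (R.Ix σ × R.Ix ρ) (R.Ix (Irr.triv G)) ℂ}
    (hS : S ∈ R.Hom₂ (Irr.triv G) σ ρ) (z : R.Ix (Irr.triv G)) (x : M) (p : R.Ix σ × R.Ix ρ) :
    ∑ q : R.Ix σ × R.Ix ρ, c.α σ (c.α ρ x p.2 q.2) p.1 q.1 * c.col σ ρ S z q =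
      c.col σ ρ S z p * x := by
  obtain ⟨Y, hY, h⟩ := c.twisted σ ρ x
  have hu : star (c.u σ ρ) * c.u σ ρ = 1 := (Unitary.mem_iff.1 (c.unitary_u σ ρ)).1
  have h1 : applyFirst (c.α σ) (c.α ρ x) * (c.u σ ρ * scal M S) =
      (c.u σ ρ * scal M S) * c.α (Irr.triv G) x := by
    rw [h, Matrix.mul_assoc, ← Matrix.mul_assoc (star _), hu, Matrix.one_mul, Matrix.mul_assoc,
      hY _ S hS, Matrix.mul_assoc]
  have h2 := congrFun (congrFun h1 p) z
  refine Eq.trans ?_ (h2.trans ?_)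
  · rfl
  · refine (Fintype.sum_eq_single z fun z' hz' => absurd (Subsingleton.elim _ _) hz').trans ?_
    change (c.u σ ρ * scal M S) p z * c.α (Irr.triv G) x z z = _
    rw [c.α_triv_apply]
    rfl

theorem sum_star_col_mul {σ ρ : Irr G} {S : Matrix (R.Ix σ × R.Ix ρ) (R.Ix (Irr.triv G)) ℂ}
    (hS : S ∈ R.Hom₂ (Irr.triv G) σ ρ) (z : R.Ix (Irr.triv G)) (x : M) (p : R.Ix σ × R.Ix ρ) :
    ∑ q : R.Ix σ × R.Ix ρ, star (c.col σ ρ S z q) * c.α σ (c.α ρ x q.2 p.2) q.1 p.1 =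
      x * star (c.col σ ρ S z p) := by
  have h := congrArg star (c.sum_mul_col hS z (star x) p)
  rw [star_sum, star_mul, star_star] at h
  rw [← h]
  refine Finset.sum_congr rfl fun q _ => ?_
  rw [star_mul, ← map_star_apply, ← map_star_apply, star_star]

/-- The conjugate equation for the columns of a pair of conjugate representations. -/
theorem sum_star_col_mul_α_col {π ρ : Irr G} {T : Matrix (R.Ix ρ) (R.Ix π) ℂ}
    (hT : T.conjTranspose * T = 1)
    (hS : (Matrix.of fun p _ => T p.1 p.2) ∈ R.Hom₂ (Irr.triv G) ρ π)
    (hS' : (Matrix.of fun p _ => T p.2 p.1) ∈ R.Hom₂ (Irr.triv G) π ρ)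
    (z : R.Ix (Irr.triv G)) (l k : R.Ix π) :
    ∑ p : R.Ix π × R.Ix ρ, star (c.col π ρ (Matrix.of fun p _ => T p.2 p.1) z p) *
      c.α π (c.col ρ π (Matrix.of fun p _ => T p.1 p.2) z (p.2, l)) p.1 k =
      if l = k then 1 else 0 := by
  set S : Matrix (R.Ix ρ × R.Ix π) (R.Ix (Irr.triv G)) ℂ := Matrix.of fun p _ => T p.1 p.2 with hSdef
  set S' : Matrix (R.Ix π × R.Ix ρ) (R.Ix (Irr.triv G)) ℂ := Matrix.of fun p _ => T p.2 p.1
    with hSdef'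
  -- The cocycle identity at `(π, ρ, π)` is compressed by `1 ⊗ S` on the right and by `S'*u* ⊗ 1` on
  -- the left; the coproduct blocks of `u` then disappear and a scalar conjugate equation is left.
  obtain ⟨Y, Z, hY, hZ, h⟩ := c.cocycle π ρ π
  -- right multiplication by `1 ⊗ S`
  set K : Matrix (R.Ix π × (R.Ix ρ × R.Ix π)) (R.Ix π × R.Ix (Irr.triv G)) M :=
    scal M ((1 : Matrix (R.Ix π) (R.Ix π) ℂ) ⊗ₖ S) with hK
  set K' : Matrix ((R.Ix π × R.Ix ρ) × R.Ix π) (R.Ix π × R.Ix (Irr.triv G)) M :=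
    K.submatrix (Equiv.prodAssoc _ _ _) id with hK'
  have h1 : ampRight (R.Ix π) (c.u π ρ) * (Y * K') =
      (applyFirst (c.α π) (c.u ρ π) * K).submatrix (Equiv.prodAssoc _ _ _) id := by
    rw [← Matrix.mul_assoc, h, hK', Matrix.submatrix_mul_equiv, Matrix.mul_assoc,
      hZ _ S hS, c.u_triv_right, Matrix.mul_one]
  have hcol : ∀ (j : R.Ix π) (q : R.Ix ρ) (l k : R.Ix π),
      (applyFirst (c.α π) (c.u ρ π) * K) (j, (q, l)) (k, z) = c.α π (c.col ρ π S z (q, l)) j k := by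
    intro j q l k
    rw [Matrix.mul_apply, Fintype.sum_prod_type]
    rw [Fintype.sum_eq_single k (fun k' hk' => Finset.sum_eq_zero fun r _ => ?_)]
    · have e : c.col ρ π S z (q, l) = ∑ r, (S r z) • c.u ρ π (q, l) r := by
        rw [col, Matrix.mul_apply]
        refine Finset.sum_congr rfl fun r _ => ?_
        rw [scal_apply, ← Algebra.commutes, Algebra.smul_def]
      rw [e, map_sum, Matrix.sum_apply]
      refine Finset.sum_congr rfl fun r _ => ?_
      rw [map_smul, Matrix.smul_apply, hK, scal_apply, Matrix.kroneckerMap_apply,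
        Matrix.one_apply_eq, one_mul, ← Algebra.commutes, Algebra.smul_def]
      rfl
    · rw [hK, scal_apply, Matrix.kroneckerMap_apply, Matrix.one_apply_ne hk', zero_mul, map_zero,
        mul_zero]
  -- left multiplication by `S'* ⊗ 1`
  set B := scal M (S'.conjTranspose ⊗ₖ (1 : Matrix (R.Ix π) (R.Ix π) ℂ)) with hB
  have hF : scal G.alg S'.conjTranspose * tensorRep (R.rep π).mat (R.rep ρ).mat =
      scal G.alg S'.conjTranspose := by
    have := IsIntertwiner.conjTranspose (R.rep (Irr.triv G)).mat_unitary
      ((R.rep π).isUnitaryRep.tensorRep (R.rep ρ).isUnitaryRep).mem_unitary hS'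
    rw [isIntertwiner_iff, R.mat_triv, Matrix.one_mul] at this
    exact this
  have hBY : B * Y = B := hY.scal_mul_eq (c.u_triv_left π) hF
  have hu : star (c.u π ρ) * c.u π ρ = 1 := (Unitary.mem_iff.1 (c.unitary_u π ρ)).1
  have hamp : ampRight (R.Ix π) (star (c.u π ρ)) * ampRight (R.Ix π) (c.u π ρ) = 1 := by
    ext1 p q
    rw [Matrix.mul_apply, Fintype.sum_prod_type_right]
    have e := congrFun (congrFun hu p.1) q.1
    rw [Matrix.mul_apply] at e
    rw [Fintype.sum_eq_single p.2 (fun k' hk' => Finset.sum_eq_zero fun r _ => ?_)]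
    · by_cases hpq : p.2 = q.2
      · simp only [ampRight, Matrix.of_apply, hpq, if_true]
        rw [e, Matrix.one_apply, Matrix.one_apply]
        simp only [Prod.ext_iff, hpq, and_true]
      · have : p ≠ q := fun h => hpq (by rw [h])
        rw [Matrix.one_apply_ne this]
        simp [ampRight, hpq]
    · simp [ampRight, hk'.symm]
  have h2 : B * ampRight (R.Ix π) (star (c.u π ρ)) *
      (applyFirst (c.α π) (c.u ρ π) * K).submatrix (Equiv.prodAssoc _ _ _) id = B * K' := by
    rw [← h1, Matrix.mul_assoc, ← Matrix.mul_assoc (ampRight _ _), hamp, Matrix.one_mul,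
      ← Matrix.mul_assoc, hBY]
  have h3 := congrFun (congrFun h2 (z, l)) (k, z)
  have hleft : ∀ p : R.Ix π × R.Ix ρ, ∀ l' : R.Ix π,
      (B * ampRight (R.Ix π) (star (c.u π ρ))) (z, l) (p, l') =
        if l = l' then star (c.col π ρ S' z p) else 0 := by
    intro p l'
    rw [Matrix.mul_apply, Fintype.sum_prod_type_right]
    rw [Fintype.sum_eq_single l (fun k' hk' => Finset.sum_eq_zero fun r _ => ?_)]
    · split_ifs with hll
      · rw [col, Matrix.mul_apply, star_sum]
        refine Finset.sum_congr rfl fun r _ => ?_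
        simp only [ampRight, Matrix.of_apply, hll, if_true]
        rw [hB, scal_apply, Matrix.kroneckerMap_apply, Matrix.one_apply_eq, mul_one, star_mul,
          scal_apply]
        change algebraMap ℂ M (star (S' r z)) * star (c.u π ρ p r) =
          star (algebraMap ℂ M (S' r z)) * star (c.u π ρ p r)
        rw [algebraMap_star_comm]
      · refine Finset.sum_eq_zero fun r _ => ?_
        simp [ampRight, hll]
    · rw [hB, scal_apply, Matrix.kroneckerMap_apply, Matrix.one_apply_ne hk'.symm, mul_zero,
        map_zero, zero_mul]
  -- The scalar conjugate equation: this entry is an entry of `T*T`.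
  have hBK : (B * K') (z, l) (k, z) = if l = k then 1 else 0 := by
    have e1 : (B * K') (z, l) (k, z) = scal M ((S'.conjTranspose ⊗ₖ (1 : Matrix (R.Ix π) (R.Ix π) ℂ)) *
        ((1 : Matrix (R.Ix π) (R.Ix π) ℂ) ⊗ₖ S).submatrix (Equiv.prodAssoc _ _ _) id)
          (z, l) (k, z) := by
      rw [scal_mul]
      rfl
    rw [e1, scal_apply]
    have e2 := congrFun (congrFun hT k) l
    rw [Matrix.mul_apply, Matrix.one_apply] at e2
    have e3 : ((S'.conjTranspose ⊗ₖ (1 : Matrix (R.Ix π) (R.Ix π) ℂ)) *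
        ((1 : Matrix (R.Ix π) (R.Ix π) ℂ) ⊗ₖ S).submatrix (Equiv.prodAssoc _ _ _) id)
          (z, l) (k, z) = if k = l then 1 else 0 := by
      rw [← e2, Matrix.mul_apply, Fintype.sum_prod_type_right]
      rw [Fintype.sum_eq_single l (fun k' hk' => Finset.sum_eq_zero fun r _ => ?_)]
      · rw [Fintype.sum_prod_type]
        rw [Fintype.sum_eq_single k (fun k' hk' => Finset.sum_eq_zero fun r _ => ?_)]
        · refine Finset.sum_congr rfl fun q _ => ?_
          simp [hSdef, hSdef']
        · simp [hk']
      · simp [hk'.symm]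
    rw [e3]
    by_cases hlk : l = k
    · simp [hlk]
    · simp [hlk, Ne.symm hlk]
  rw [hBK, Matrix.mul_apply, Fintype.sum_prod_type] at h3
  rw [← h3]
  refine Finset.sum_congr rfl fun p _ => ?_
  simp only [hleft, ite_mul, zero_mul, Finset.sum_ite_eq, Finset.mem_univ, if_true]
  rw [Matrix.submatrix_apply]
  exact congrArg _ (hcol p.1 p.2 l k).symm

variable {ω : Ultrafilter ℕ}

/-- The components of a cocycle action map `M^ω` to matrices over `M^ω`. -/
theorem preservesNormalizer (π : Irr G) : PreservesNormalizer ω (c.α π) := by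
  obtain ⟨ρ, T, hT, hS, hS'⟩ := R.exists_conj π
  obtain ⟨z⟩ : Nonempty (R.Ix (Irr.triv G)) := inferInstance
  set W := c.col ρ π (Matrix.of fun p _ => T p.1 p.2) z with hW
  set W' := c.col π ρ (Matrix.of fun p _ => T p.2 p.1) z with hW'
  -- For null `t`, the product of `t` with an entry of `α_π(s)` is rewritten so that `s` itself
  -- stands next to a null sequence; products on the other side follow by adjoints.
  have main : ∀ s ∈ normalizerAlg ω M, ∀ i j, ∀ t, IsNullSeq ω t →
      IsNullSeq ω (t * fun n => c.α π (s n) i j) := by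
    intro s hs i k t ht
    -- `y_r = ∑ α_ρ(t α_π(s)_{il})_{rq} W_{ql}`
    have hy : ∀ r, IsNullSeq ω (fun n => ∑ q, c.α ρ (t n) r q * W (q, i) * s n) := fun r =>
      isNullSeq_sum fun q _ =>
        (hs.2 _ ((isNullSeq_map (c.normal ρ) ht r q).mul_const (W (q, i)))).2
    have hyeq : ∀ r n, ∑ q, c.α ρ (t n) r q * W (q, i) * s n =
        ∑ p : R.Ix ρ × R.Ix π, c.α ρ (t n * c.α π (s n) i p.2) r p.1 * W p := by
      intro r n
      have h1 : ∀ q, c.α ρ (t n) r q * W (q, i) * s n = ∑ p : R.Ix ρ × R.Ix π,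
          c.α ρ (t n) r q * (c.α ρ (c.α π (s n) i p.2) q p.1 * W p) := fun q => by
        rw [← Finset.mul_sum, c.sum_mul_col hS z (s n) (q, i), ← mul_assoc]
      simp only [h1]
      rw [Finset.sum_comm]
      refine Finset.sum_congr rfl fun p _ => ?_
      rw [map_mul_apply, Finset.sum_mul]
      simp only [mul_assoc]
    -- Applying `α_π` and pairing with `W'*` undoes `α_ρ`, and the conjugate equation removes the
    -- remaining columns.
    have hz : ∀ n, t n * c.α π (s n) i k = ∑ p : R.Ix π × R.Ix ρ, star (W' p) *
        c.α π (∑ q, c.α ρ (t n) p.2 q * W (q, i) * s n) p.1 k := by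
      intro n
      simp only [hyeq]
      have h1 : ∀ p : R.Ix π × R.Ix ρ, star (W' p) * c.α π (∑ r : R.Ix ρ × R.Ix π,
          c.α ρ (t n * c.α π (s n) i r.2) p.2 r.1 * W r) p.1 k =
          ∑ r : R.Ix ρ × R.Ix π, ∑ j, star (W' p) *
            c.α π (c.α ρ (t n * c.α π (s n) i r.2) p.2 r.1) p.1 j * c.α π (W r) j k := fun p => by
        rw [map_sum, Matrix.sum_apply, Finset.mul_sum]
        refine Finset.sum_congr rfl fun r _ => ?_
        rw [map_mul_apply, Finset.mul_sum]
        simp only [mul_assoc]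
      simp only [h1]
      rw [Finset.sum_comm]
      have h2 : ∀ r : R.Ix ρ × R.Ix π, ∑ p : R.Ix π × R.Ix ρ, ∑ j, star (W' p) *
          c.α π (c.α ρ (t n * c.α π (s n) i r.2) p.2 r.1) p.1 j * c.α π (W r) j k =
          ∑ j, (t n * c.α π (s n) i r.2) * (star (W' (j, r.1)) * c.α π (W r) j k) := fun r => by
        rw [Finset.sum_comm]
        refine Finset.sum_congr rfl fun j _ => ?_
        rw [← Finset.sum_mul, c.sum_star_col_mul hS' z _ (j, r.1), mul_assoc]
      simp only [h2]
      rw [Fintype.sum_prod_type_right]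
      have h3 : ∀ l, ∑ q, ∑ j, (t n * c.α π (s n) i l) * (star (W' (j, q)) * c.α π (W (q, l)) j k) =
          (t n * c.α π (s n) i l) * if l = k then 1 else 0 := fun l => by
        rw [← c.sum_star_col_mul_α_col hT hS hS' z l k, Fintype.sum_prod_type_right]
        simp only [Finset.mul_sum]
        rfl
      simp only [h3]
      simp
    have hfin : IsNullSeq ω (fun n => ∑ p : R.Ix π × R.Ix ρ, star (W' p) *
        c.α π (∑ q, c.α ρ (t n) p.2 q * W (q, i) * s n) p.1 k) :=
      isNullSeq_sum fun p _ => (isNullSeq_map (c.normal π) (hy p.2) p.1 k).const_mul _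
    convert hfin using 2 with n
    exact hz n
  intro s hs i j
  refine ⟨isBddSeq_map _ hs.1 i j, fun t ht => ⟨?_, main s hs i j t ht⟩⟩
  have h := (main (star s) (star_mem hs) j i (star t) ht.star).star
  convert h using 2 with n
  simp only [star_mul, star_star]
  congr 1
  funext n
  simp [map_star_apply]

end CocycleAction

end CocycleActions

end KacAction

namespace KacAction

/-! ### Normal functionals and the double commutant -/

section DoubleCommutant

variable {H : Type*} [NormedAddCommGroup H] [InnerProductSpace ℂ H] [CompleteSpace H]

/-- The amplification `x ⊗ 1` on `H ⊗ ℓ²(ℕ)`. -/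
noncomputable def ampL2 (x : H →L[ℂ] H) :
    lp (fun _ : ℕ => H) 2 →L[ℂ] lp (fun _ : ℕ => H) 2 :=
  lp.mapCLM 2 (fun _ => x) (norm_nonneg x) fun _ => le_rfl

omit [CompleteSpace H] in
theorem ampL2_apply (x : H →L[ℂ] H) (ξ : lp (fun _ : ℕ => H) 2) (i : ℕ) :
    ampL2 x ξ i = x (ξ i) := rfl

theorem inner_ampL2 (x : H →L[ℂ] H) (η ξ : lp (fun _ : ℕ => H) 2) :
    ⟪η, ampL2 x ξ⟫_ℂ = ⟪ampL2 (star x) η, ξ⟫_ℂ := by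
  rw [lp.inner_eq_tsum, lp.inner_eq_tsum]
  refine tsum_congr fun i => ?_
  rw [ampL2_apply, ampL2_apply, ContinuousLinearMap.star_eq_adjoint,
    ContinuousLinearMap.adjoint_inner_left]

omit [CompleteSpace H] in
theorem ampL2_single (x : H →L[ℂ] H) (j : ℕ) (v : H) :
    ampL2 x (lp.single 2 j v) = lp.single 2 j (x v) := by
  ext i
  rw [ampL2_apply]
  by_cases hij : i = j
  · subst hij
    rw [lp.single_apply_self, lp.single_apply_self]
  · rw [lp.single_apply_ne _ _ _ hij, lp.single_apply_ne _ _ _ hij, map_zero]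

/-- A normal functional vanishing on a unital `*`-algebra vanishes on its double commutant. -/
theorem tsum_inner_eq_zero_of_mem_centralizer_centralizer (N : StarSubalgebra ℂ (H →L[ℂ] H))
    {ξ η : ℕ → H} (hξ : Summable fun n => ‖ξ n‖ ^ 2) (hη : Summable fun n => ‖η n‖ ^ 2)
    (h : ∀ x ∈ N, ∑' n, ⟪η n, x (ξ n)⟫_ℂ = 0) {x : H →L[ℂ] H}
    (hx : x ∈ Set.centralizer (Set.centralizer (N : Set (H →L[ℂ] H)))) :
    ∑' n, ⟪η n, x (ξ n)⟫_ℂ = 0 := by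
  let ξ' : lp (fun _ : ℕ => H) 2 := ⟨ξ, memℓp_gen (by simpa using hξ)⟩
  let η' : lp (fun _ : ℕ => H) 2 := ⟨η, memℓp_gen (by simpa using hη)⟩
  have hinner : ∀ y : H →L[ℂ] H, ⟪η', ampL2 y ξ'⟫_ℂ = ∑' n, ⟪η n, y (ξ n)⟫_ℂ := fun y =>
    lp.inner_eq_tsum _ _
  -- `E` is the closed cyclic subspace of `ξ'` under `N ⊗ 1`. The hypothesis says that `η'` is
  -- orthogonal to it, so it suffices that `(x ⊗ 1)ξ'` stays in `E`.
  set E : Submodule ℂ (lp (fun _ : ℕ => H) 2) :=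
    (Submodule.span ℂ {v | ∃ y ∈ N, v = ampL2 y ξ'}).topologicalClosure with hE
  have : CompleteSpace E := (Submodule.isClosed_topologicalClosure _).completeSpace_coe
  have hinv : ∀ y ∈ N, ∀ v ∈ E, ampL2 y v ∈ E := by
    intro y hy v hv
    refine map_mem_closure (ampL2 y).continuous hv fun w hw => ?_
    induction hw using Submodule.span_induction with
    | mem w hw =>
      obtain ⟨z, hz, rfl⟩ := hw
      exact Submodule.subset_span ⟨y * z, mul_mem hy hz, rfl⟩
    | zero => rw [map_zero]; exact zero_mem _
    | add a b _ _ ha hb => rw [map_add]; exact add_mem ha hb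
    | smul c a _ ha => rw [map_smul]; exact Submodule.smul_mem _ c ha
  set P := E.starProjection with hP
  have hcomm : ∀ y ∈ N, ∀ v, P (ampL2 y v) = ampL2 y (P v) := by
    intro y hy v
    refine (Submodule.eq_starProjection_of_mem_orthogonal
      (hinv y hy _ (Submodule.starProjection_apply_mem E v)) fun w hw => ?_)
    rw [← map_sub, inner_ampL2]
    exact (Submodule.mem_orthogonal _ _).1 (Submodule.sub_starProjection_mem_orthogonal v) _
      (hinv _ (star_mem hy) _ hw)
  have hmem : P ξ' = ξ' := by
    refine Submodule.starProjection_eq_self_iff.2 (Submodule.le_topologicalClosure _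
      (Submodule.subset_span ⟨1, one_mem _, ?_⟩))
    ext i
    rfl
  -- The projection onto `E` commutes with `N ⊗ 1`, so its matrix entries lie in the commutant of
  -- `N` and commute with `x`.
  let ent : ℕ → ℕ → H →L[ℂ] H := fun i j =>
    (lp.evalCLM ℂ (fun _ : ℕ => H) 2 i) ∘L P ∘L
      (lp.singleContinuousLinearMap ℂ (fun _ : ℕ => H) 2 j)
  have hent : ∀ i j v, ent i j v = P (lp.single 2 j v) i := fun _ _ _ => rfl
  have hcent : ∀ i j, ent i j ∈ Set.centralizer (N : Set (H →L[ℂ] H)) := by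
    intro i j y hy
    ext v
    change y (ent i j v) = ent i j (y v)
    rw [hent, hent, ← ampL2_single, hcomm y hy, ampL2_apply]
  have hxP : P ∘L ampL2 x = ampL2 x ∘L P := by
    refine lp.ext_continuousLinearMap (by simp) fun j => ?_
    ext v i
    change P (ampL2 x (lp.single 2 j v)) i = x (P (lp.single 2 j v) i)
    rw [ampL2_single, ← hent, ← hent]
    exact congrArg (fun t : H →L[ℂ] H => t v) (hx _ (hcent i j))
  have hxE : ampL2 x ξ' ∈ E := by
    have := congrArg (fun t => t ξ') hxP
    change P (ampL2 x ξ') = ampL2 x (P ξ') at this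
    rw [hmem] at this
    exact Submodule.starProjection_eq_self_iff.1 this
  have hη0 : E ≤ (Submodule.span ℂ {η'})ᗮ := by
    refine Submodule.topologicalClosure_minimal _ (Submodule.span_le.2 ?_)
      (Submodule.isClosed_orthogonal _)
    rintro _ ⟨y, hy, rfl⟩
    rw [SetLike.mem_coe, Submodule.mem_orthogonal_singleton_iff_inner_right, hinner]
    exact h y hy
  rw [← hinner]
  exact Submodule.mem_orthogonal_singleton_iff_inner_right.1 (hη0 hxE)

end DoubleCommutant

/-! ### Faithful normal traces -/

section Trace

variable {H : Type*} [NormedAddCommGroup H] [InnerProductSpace ℂ H] [CompleteSpace H]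
  {M : VonNeumannAlgebra H}

/-- `τ` is a faithful normal tracial state on `M`. -/
structure IsFaithfulTrace (τ : M →ₗ[ℂ] ℂ) : Prop where
  normal : IsNormalFunctional M τ
  one : τ 1 = 1
  comm : ∀ x y, τ (x * y) = τ (y * x)
  nonneg : ∀ x, ∃ r : ℝ, 0 ≤ r ∧ τ (star x * x) = (r : ℂ)
  faithful : ∀ x, τ (star x * x) = 0 → x = 0

variable {τ : M →ₗ[ℂ] ℂ} {ω : Ultrafilter ℕ}

namespace IsFaithfulTrace

/-- If `τ(· z)` vanishes on a `*`-algebra generating `M`, then `z = 0`. -/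
theorem eq_zero_of_generating (hτ : IsFaithfulTrace τ) {N : StarSubalgebra ℂ (H →L[ℂ] H)}
    (hN : Set.centralizer (Set.centralizer (N : Set (H →L[ℂ] H))) = (M : Set (H →L[ℂ] H)))
    {z : M} (hz : ∀ x : M, (x : H →L[ℂ] H) ∈ N → τ (x * z) = 0) : z = 0 := by
  obtain ⟨ξ, η, hξ, hη, hφ⟩ := hτ.normal
  refine hτ.faithful z ?_
  have hξ' : Summable fun n => ‖(z : H →L[ℂ] H) (ξ n)‖ ^ 2 := by
    refine Summable.of_nonneg_of_le (fun n => sq_nonneg _) (fun n => ?_)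
      (hξ.mul_left (‖(z : H →L[ℂ] H)‖ ^ 2))
    rw [← mul_pow]
    exact pow_le_pow_left₀ (norm_nonneg _) ((z : H →L[ℂ] H).le_opNorm _) 2
  -- `τ(· z)` is the normal functional given by the vectors `zξₙ` and `ηₙ`; vanishing on `N`, it
  -- vanishes at `z*`.
  rw [hφ]
  refine tsum_inner_eq_zero_of_mem_centralizer_centralizer N hξ' hη (fun x hx => ?_)
    (x := ((star z : M) : H →L[ℂ] H)) (hN ▸ (star z).2)
  have hxM : x ∈ M := by
    change x ∈ (M : Set (H →L[ℂ] H))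
    rw [← hN]
    exact Set.subset_centralizer_centralizer hx
  have := hz ⟨x, hxM⟩ hx
  rwa [hφ] at this

/-- A weak limit of `t*t` is positive with trace zero, so its square root is zero by faithfulness.
Traciality gives the same for `tt*`. -/
theorem isNullSeq (hτ : IsFaithfulTrace τ) {s : ℕ → M} (hs : IsBddSeq s)
    (h : Tendsto (fun n => τ (star (s n) * s n)) ω (𝓝 0)) : IsNullSeq ω s := by
  have key : ∀ t : ℕ → M, IsBddSeq t → Tendsto (fun n => τ (star (t n) * t n)) ω (𝓝 0) →
      WeakTendsto ω (fun n => star (t n) * t n) 0 := by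
    intro t ht h0
    have hb : IsBddSeq (star t * t) := ht.star.mul ht
    obtain ⟨z, hz⟩ := exists_weakTendsto ω hb
    have hτz : τ z = 0 := tendsto_nhds_unique (hz.map_normal hb hτ.normal) h0
    have hpos : ∀ ξ, ∃ r : ℝ, 0 ≤ r ∧ ⟪(z : H →L[ℂ] H) ξ, ξ⟫_ℂ = r := by
      intro ξ
      have h1 : Tendsto (fun n => ((‖(t n : H →L[ℂ] H) ξ‖ ^ 2 : ℝ) : ℂ)) ω
          (𝓝 ⟪ξ, (z : H →L[ℂ] H) ξ⟫_ℂ) := (hz ξ ξ).congr fun n => inner_star_mul_self _ _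
      have h2 : ⟪ξ, (z : H →L[ℂ] H) ξ⟫_ℂ ∈ {w : ℂ | 0 ≤ w.re ∧ w.im = 0} := by
        refine IsClosed.mem_of_tendsto ?_ h1 (Eventually.of_forall fun n => ?_)
        · exact (isClosed_le continuous_const Complex.continuous_re).inter
            (isClosed_eq Complex.continuous_im continuous_const)
        · exact ⟨by rw [Complex.ofReal_re]; positivity, Complex.ofReal_im _⟩
      refine ⟨_, h2.1, ?_⟩
      rw [← inner_conj_symm, Complex.conj_eq_iff_im.2 h2.2]
      exact Complex.ext rfl h2.2
    obtain ⟨y, hy, hyy, -⟩ := exists_sqrt_mem z hpos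
    have hy0 : y = 0 := hτ.faithful y (by rw [hy, hyy, hτz])
    rw [← hyy, hy0, mul_zero] at hz
    exact hz
  refine WeakTendsto.isNullSeq_of_star_mul hs (key s hs h) ?_
  have h' := key (star s) hs.star (h.congr fun n => ?_)
  · simpa using h'
  · rw [hτ.comm]
    simp

/-- Bounded sequences which asymptotically commute with an increasing sequence of generating
`*`-algebras are centralizing. -/
theorem isCentralizingSeq (hτ : IsFaithfulTrace τ) (hω : (ω : Filter ℕ) ≤ Filter.cofinite)
    {N : ℕ → StarSubalgebra ℂ (H →L[ℂ] H)} (hmono : Monotone N)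
    (hN : Set.centralizer (Set.centralizer (⋃ n, (N n : Set (H →L[ℂ] H)))) =
      (M : Set (H →L[ℂ] H))) {s : ℕ → M} (hs : IsBddSeq s)
    (h : ∀ n, ∀ x ∈ N n, x * (s n : H →L[ℂ] H) = s n * x) : IsCentralizingSeq ω s := by
  refine isCentralizingSeq_of_weakTendsto hs fun y hy => ?_
  have hyb : IsBddSeq y := ⟨1, hy⟩
  have hb : IsBddSeq (s * y - y * s) := (hs.mul hyb).sub (hyb.mul hs)
  obtain ⟨z, hz⟩ := exists_weakTendsto ω hb
  have hcoe : ((⨆ n, N n : StarSubalgebra ℂ (H →L[ℂ] H)) : Set (H →L[ℂ] H)) =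
      ⋃ n, (N n : Set (H →L[ℂ] H)) := StarSubalgebra.coe_iSup_of_directed hmono.directed_le
  have hz0 : z = 0 := by
    refine hτ.eq_zero_of_generating (N := ⨆ n, N n) (by rw [hcoe]; exact hN) fun x hx => ?_
    have hx' : (x : H →L[ℂ] H) ∈ ⋃ n, (N n : Set (H →L[ℂ] H)) := hcoe ▸ hx
    obtain ⟨k, hk⟩ := Set.mem_iUnion.1 hx'
    have h1 := (hz.const_mul x).map_normal ((isBddSeq_const x).mul hb) hτ.normal
    -- For `n ≥ k` the element `x` of `N k` commutes with `s n`, and traciality makes `τ(x[s n, y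
    -- n])` zero.
    refine tendsto_nhds_unique h1 (tendsto_const_nhds.congr' ?_)
    have h2 : ∀ᶠ n in (ω : Filter ℕ), k ≤ n := by
      refine hω ?_
      rw [Nat.cofinite_eq_atTop]
      exact eventually_ge_atTop k
    filter_upwards [h2] with n hn
    have h3 : x * s n = s n * x := Subtype.ext (h n x (hmono hn hk))
    change (0 : ℂ) = τ (x * (s n * y n - y n * s n))
    rw [mul_sub, map_sub, ← mul_assoc, h3, mul_assoc, hτ.comm (s n), ← mul_assoc, sub_self]
  rw [← hz0]
  exact hz

end IsFaithfulTrace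

end Trace

end KacAction

namespace KacAction

/-! ### Minimizing sequences and the 2-norm -/

section Averaging

/-- In a convex set, a minimizing sequence for a quadratic form is asymptotically invariant under
all isometries preserving the set. -/
theorem exists_seq_asymptotically_invariant {V : Type*} [AddCommGroup V] [Module ℝ V] (q : V → ℝ)
    (hq : ∀ x, 0 ≤ q x)
    (hpar : ∀ x y, q (x - y) = 2 * q x + 2 * q y - 4 * q ((1 / 2 : ℝ) • x + (1 / 2 : ℝ) • y))
    {S : Set V} (hS : Convex ℝ S) (hne : S.Nonempty) :
    ∃ k : ℕ → V, (∀ n, k n ∈ S) ∧ ∀ γ : V → V, (∀ x ∈ S, γ x ∈ S) → (∀ x, q (γ x) = q x) →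
      Tendsto (fun n => q (γ (k n) - k n)) atTop (𝓝 0) := by
  set I := sInf (q '' S) with hI
  have hbdd : BddBelow (q '' S) := ⟨0, by rintro _ ⟨x, _, rfl⟩; exact hq x⟩
  have hex : ∀ n : ℕ, ∃ x ∈ S, q x < I + 1 / ((n : ℝ) + 1) := fun n => by
    obtain ⟨_, ⟨x, hx, rfl⟩, h⟩ := Real.lt_sInf_add_pos (hne.image q)
      (Nat.one_div_pos_of_nat (α := ℝ) (n := n))
    exact ⟨x, hx, h⟩
  choose k hkS hk using hex
  refine ⟨k, hkS, fun γ hγS hγ => ?_⟩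
  have hlim : Tendsto (fun n : ℕ => 4 * (1 / ((n : ℝ) + 1))) atTop (𝓝 0) := by
    simpa using (tendsto_one_div_add_atTop_nhds_zero_nat (𝕜 := ℝ)).const_mul 4
  refine squeeze_zero (fun n => hq _) (fun n => ?_) hlim
  -- The midpoint lies in the convex set, so the parallelogram law bounds `q(γk - k)` by `4(q(k) -
  -- I)`; no completion of `V` is needed.
  have hmid : I ≤ q ((1 / 2 : ℝ) • γ (k n) + (1 / 2 : ℝ) • k n) :=
    csInf_le hbdd ⟨_, hS (hγS _ (hkS n)) (hkS n) (by norm_num) (by norm_num) (by norm_num), rfl⟩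
  rw [hpar, hγ]
  linarith [hk n]

variable {H : Type*} [NormedAddCommGroup H] [InnerProductSpace ℂ H] [CompleteSpace H]
  {M : VonNeumannAlgebra H} {m : Type*} [Fintype m] [DecidableEq m]

/-- Elements of `M` commuting with a `*`-algebra `N` are linear combinations of unitaries of `M`
commuting with `N`. -/
theorem mem_span_unitary_of_commute (N : StarSubalgebra ℂ (H →L[ℂ] H)) {x : M}
    (hx : ∀ d ∈ N, d * (x : H →L[ℂ] H) = x * d) :
    x ∈ Submodule.span ℂ {v : M | v ∈ unitary M ∧ ∀ d ∈ N, d * (v : H →L[ℂ] H) = v * d} := by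
  set W : StarSubalgebra ℂ (H →L[ℂ] H) := M.toStarSubalgebra ⊓
    StarSubalgebra.centralizer ℂ (N : Set (H →L[ℂ] H)) with hW
  have hcomm : ∀ y : W, ∀ d ∈ N, d * (y : H →L[ℂ] H) = y * d := fun y d hd =>
    ((StarSubalgebra.mem_centralizer_iff ℂ).1 y.2.2 d hd).1
  -- Being norm closed, `W` is a C*-algebra, and it is spanned by its unitaries.
  have hclosed : IsClosed (W : Set (H →L[ℂ] H)) := by
    have h1 : (W : Set (H →L[ℂ] H)) = (M : Set (H →L[ℂ] H)) ∩
      (StarSubalgebra.centralizer ℂ (N : Set (H →L[ℂ] H)) : Set (H →L[ℂ] H)) := rfl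
    rw [h1]
    refine IsClosed.inter ?_ (Set.isClosed_centralizer _)
    rw [← M.centralizer_centralizer]
    exact Set.isClosed_centralizer _
  let f : W →ₗ[ℂ] M :=
    { toFun := fun y => ⟨y, y.2.1⟩
      map_add' := fun _ _ => rfl
      map_smul' := fun _ _ => rfl }
  have hxW : (x : H →L[ℂ] H) ∈ W := ⟨x.2, (StarSubalgebra.mem_centralizer_iff ℂ).2 fun d hd =>
    ⟨hx d hd, hx _ (star_mem hd)⟩⟩
  have htop : (⟨x, hxW⟩ : W) ∈ Submodule.span ℂ (unitary W : Set W) := by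
    rw [CStarAlgebra.span_unitary]
    trivial
  have := Submodule.mem_map_of_mem (f := f) htop
  rw [Submodule.map_span] at this
  refine Submodule.span_mono ?_ this
  rintro _ ⟨v, hv, rfl⟩
  refine ⟨Unitary.mem_iff.2 ⟨?_, ?_⟩, hcomm v⟩
  · exact Subtype.ext (congrArg (fun y : W => (y : H →L[ℂ] H)) (Unitary.mem_iff.1 hv).1)
  · exact Subtype.ext (congrArg (fun y : W => (y : H →L[ℂ] H)) (Unitary.mem_iff.1 hv).2)

/-- The trace `τ ⊗ Tr` on matrices over `M`. -/
noncomputable def mtr (τ : M →ₗ[ℂ] ℂ) (X : Matrix m m M) : ℂ := ∑ i, τ (X i i)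

omit [DecidableEq m] in
theorem mtr_add (τ : M →ₗ[ℂ] ℂ) (X Y : Matrix m m M) : mtr τ (X + Y) = mtr τ X + mtr τ Y := by
  simp [mtr, Finset.sum_add_distrib]

omit [DecidableEq m] in
theorem mtr_mul_comm {τ : M →ₗ[ℂ] ℂ} (hτ : IsFaithfulTrace τ) (X Y : Matrix m m M) :
    mtr τ (X * Y) = mtr τ (Y * X) := by
  simp only [mtr, Matrix.mul_apply, map_sum]
  rw [Finset.sum_comm]
  exact Finset.sum_congr rfl fun i _ => Finset.sum_congr rfl fun j _ => hτ.comm _ _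

omit [DecidableEq m] in
theorem mtr_star_mul (τ : M →ₗ[ℂ] ℂ) (X Y : Matrix m m M) :
    mtr τ (star X * Y) = ∑ i, ∑ j, τ (star (X j i) * Y j i) := by
  simp only [mtr, Matrix.mul_apply, map_sum]
  rfl

/-- The square of the norm `‖·‖₂` on `(M ⊗ B(ℂᵐ)) ⊕ M`. -/
noncomputable def sqNorm (τ : M →ₗ[ℂ] ℂ) (x : Matrix m m M × M) : ℝ :=
  (mtr τ (star x.1 * x.1)).re + (τ (star x.2 * x.2)).re

/-- The action of `v` on `(M ⊗ B(ℂᵐ)) ⊕ M` by `(k, r) ↦ (β(v) k (v* ⊗ 1), v r v*)`. -/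
noncomputable def conjAct (β : M →⋆ₐ[ℂ] Matrix m m M) (v : M) (x : Matrix m m M × M) :
    Matrix m m M × M :=
  (β v * x.1 * amp m (star v), v * x.2 * star v)

variable {τ : M →ₗ[ℂ] ℂ} (hτ : IsFaithfulTrace τ)

include hτ

theorem IsFaithfulTrace.re_nonneg (x : M) : 0 ≤ (τ (star x * x)).re := by
  obtain ⟨r, hr, h⟩ := hτ.nonneg x
  rw [h]
  exact hr

theorem IsFaithfulTrace.eq_ofReal (x : M) : τ (star x * x) = ((τ (star x * x)).re : ℂ) := by
  obtain ⟨r, hr, h⟩ := hτ.nonneg x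
  rw [h]
  simp

theorem IsFaithfulTrace.re_pos {x : M} (hx : x ≠ 0) : 0 < (τ (star x * x)).re := by
  refine (hτ.re_nonneg x).lt_of_ne fun h => hx (hτ.faithful x ?_)
  rw [hτ.eq_ofReal, ← h, Complex.ofReal_zero]

omit [DecidableEq m] in
theorem mtr_re_pos {X : Matrix m m M} (hX : X ≠ 0) : 0 < (mtr τ (star X * X)).re := by
  rw [mtr_star_mul]
  simp only [Complex.re_sum]
  have : ∃ i j, X j i ≠ 0 := by
    by_contra! h
    exact hX (Matrix.ext fun i j => h j i)
  obtain ⟨i, j, hij⟩ := this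
  refine Finset.sum_pos' (fun i _ => Finset.sum_nonneg fun j _ => hτ.re_nonneg _)
    ⟨i, Finset.mem_univ _, ?_⟩
  exact Finset.sum_pos' (fun j _ => hτ.re_nonneg _) ⟨j, Finset.mem_univ _, hτ.re_pos hij⟩

omit [DecidableEq m] hτ in
theorem sqNorm_eq (x : Matrix m m M × M) : sqNorm τ x =
    ∑ i, ∑ j, (τ (star (x.1 j i) * x.1 j i)).re + (τ (star x.2 * x.2)).re := by
  rw [sqNorm, mtr_star_mul]
  simp only [Complex.re_sum]

omit [DecidableEq m] in
theorem sqNorm_nonneg (x : Matrix m m M × M) : 0 ≤ sqNorm τ x := by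
  rw [sqNorm_eq]
  exact add_nonneg (Finset.sum_nonneg fun i _ => Finset.sum_nonneg fun j _ => hτ.re_nonneg _)
    (hτ.re_nonneg _)

omit [DecidableEq m] in
theorem re_apply_le_sqNorm (x : Matrix m m M × M) (i j : m) :
    (τ (star (x.1 j i) * x.1 j i)).re ≤ sqNorm τ x := by
  rw [sqNorm_eq]
  refine le_add_of_le_of_nonneg ?_ (hτ.re_nonneg _)
  refine le_trans ?_ (Finset.single_le_sum (fun i _ => Finset.sum_nonneg fun j _ =>
    hτ.re_nonneg _) (Finset.mem_univ i))
  exact Finset.single_le_sum (f := fun j => (τ (star (x.1 j i) * x.1 j i)).re)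
    (fun j _ => hτ.re_nonneg _) (Finset.mem_univ j)

omit [DecidableEq m] in
theorem re_snd_le_sqNorm (x : Matrix m m M × M) :
    (τ (star x.2 * x.2)).re ≤ sqNorm τ x := by
  rw [sqNorm_eq]
  exact le_add_of_nonneg_left (Finset.sum_nonneg fun i _ => Finset.sum_nonneg fun j _ =>
    hτ.re_nonneg _)

omit hτ in
theorem re_parallelogram (x y : M) : (τ (star (x - y) * (x - y))).re =
    2 * (τ (star x * x)).re + 2 * (τ (star y * y)).re -
      4 * (τ (star ((1 / 2 : ℝ) • x + (1 / 2 : ℝ) • y) *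
        ((1 / 2 : ℝ) • x + (1 / 2 : ℝ) • y))).re := by
  have h : (1 / 2 : ℝ) • x + (1 / 2 : ℝ) • y = (1 / 2 : ℂ) • (x + y) := by
    rw [← smul_add, ← Complex.coe_smul]
    norm_num
  have h2 : star ((1 / 2 : ℂ) • (x + y)) = (1 / 2 : ℂ) • star (x + y) := by
    rw [star_smul]
    norm_num
  rw [h, h2, smul_mul_assoc, mul_smul_comm, smul_smul, map_smul]
  simp only [star_sub, star_add, sub_mul, mul_sub, add_mul, mul_add, map_sub, map_add,
    smul_eq_mul]
  have : (1 / 2 * (1 / 2) : ℂ) = ((1 / 4 : ℝ) : ℂ) := by norm_num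
  rw [this]
  simp only [Complex.re_ofReal_mul, Complex.sub_re, Complex.add_re]
  ring

omit [DecidableEq m] hτ in
theorem sqNorm_parallelogram (x y : Matrix m m M × M) : sqNorm τ (x - y) =
    2 * sqNorm τ x + 2 * sqNorm τ y -
      4 * sqNorm τ ((1 / 2 : ℝ) • x + (1 / 2 : ℝ) • y) := by
  simp only [sqNorm_eq, Prod.fst_sub, Prod.snd_sub, Matrix.sub_apply, re_parallelogram,
    Prod.fst_add, Prod.snd_add, Prod.smul_fst, Prod.smul_snd, Matrix.add_apply, Matrix.smul_apply,
    Finset.sum_sub_distrib, Finset.sum_add_distrib, ← Finset.mul_sum]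
  ring

theorem sqNorm_conjAct (β : M →⋆ₐ[ℂ] Matrix m m M) {v : M} (hv : v ∈ unitary M)
    (x : Matrix m m M × M) : sqNorm τ (conjAct β v x) = sqNorm τ x := by
  have hv1 := (Unitary.mem_iff.1 hv).1
  have hamp : star (amp m (star v)) = amp m v := by
    change (Matrix.diagonal _).conjTranspose = _
    rw [Matrix.diagonal_conjTranspose]
    congr 1
    funext i
    exact star_star v
  have hamp1 : amp m (star v) * amp m v = 1 := by
    ext i j
    rw [amp_mul_apply]
    by_cases hij : i = j
    · subst hij
      simp [amp, hv1]
    · simp [amp, hij]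
  have hβ : star (β v) * β v = 1 := by rw [← map_star, ← map_mul, hv1, map_one]
  have h1 : mtr τ (star (β v * x.1 * amp m (star v)) * (β v * x.1 * amp m (star v))) =
      mtr τ (star x.1 * x.1) := by
    rw [star_mul, star_mul, hamp, mtr_mul_comm hτ]
    have : β v * x.1 * amp m (star v) * (amp m v * (star x.1 * star (β v))) =
        β v * (x.1 * star x.1 * star (β v)) := by
      rw [Matrix.mul_assoc, ← Matrix.mul_assoc (amp m (star v)), hamp1, Matrix.one_mul,
        Matrix.mul_assoc, Matrix.mul_assoc]
    rw [this, mtr_mul_comm hτ, Matrix.mul_assoc, hβ, Matrix.mul_one, mtr_mul_comm hτ]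
  have h2 : τ (star (v * x.2 * star v) * (v * x.2 * star v)) = τ (star x.2 * x.2) := by
    rw [star_mul, star_mul, star_star, hτ.comm]
    have : v * x.2 * star v * (v * (star x.2 * star v)) = v * (x.2 * star x.2 * star v) := by
      rw [mul_assoc, ← mul_assoc (star v), hv1, one_mul, mul_assoc, mul_assoc]
    rw [this, hτ.comm, mul_assoc, hv1, mul_one, hτ.comm]
  simp only [sqNorm, conjAct, h1, h2]

end Averaging

end KacAction

namespace KacAction

/-! ### Averaging over the unitaries of a relative commutant -/

section Average

variable {H : Type*} [NormedAddCommGroup H] [InnerProductSpace ℂ H] [CompleteSpace H]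
  {M : VonNeumannAlgebra H} {m : Type*} [Fintype m] [DecidableEq m]

theorem map_mem_convexHull {V : Type*} [AddCommGroup V] [Module ℝ V] {γ : V → V}
    (hγ : IsLinearMap ℝ γ) {O : Set V} (h : ∀ x ∈ O, γ x ∈ convexHull ℝ O) :
    ∀ x ∈ convexHull ℝ O, γ x ∈ convexHull ℝ O :=
  convexHull_min h ((convex_convexHull ℝ O).is_linear_preimage hγ)

theorem amp_mul_amp (x y : M) : amp m x * amp m y = amp m (x * y) := by
  ext i j
  rw [amp_mul_apply]
  by_cases hij : i = j
  · subst hij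
    simp [amp]
  · simp [amp, hij]

omit [Fintype m] in
theorem amp_one : amp m (1 : M) = 1 := Matrix.diagonal_one

theorem conjAct_mul (β : M →⋆ₐ[ℂ] Matrix m m M) (v w : M) (x : Matrix m m M × M) :
    conjAct β v (conjAct β w x) = conjAct β (v * w) x := by
  simp only [conjAct, map_mul, star_mul, ← amp_mul_amp, mul_assoc]

theorem isLinearMap_conjAct (β : M →⋆ₐ[ℂ] Matrix m m M) (v : M) :
    IsLinearMap ℝ (conjAct β v) where
  map_add x y := by
    simp only [conjAct, Prod.fst_add, Prod.snd_add, mul_add, add_mul, Prod.mk_add_mk]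
  map_smul r x := by
    refine Prod.ext ?_ ?_
    · change β v * (r • x.1) * amp m (star v) = r • (β v * x.1 * amp m (star v))
      rw [Matrix.mul_smul, Matrix.smul_mul]
    · change v * (r • x.2) * star v = r • (v * x.2 * star v)
      rw [mul_smul_comm, smul_mul_assoc]

theorem norm_le_one_of_mem_unitary {v : M} (hv : v ∈ unitary M) : ‖(v : H →L[ℂ] H)‖ ≤ 1 := by
  have h : star (v : H →L[ℂ] H) * v = 1 := congrArg Subtype.val (Unitary.mem_iff.1 hv).1
  have h1 := CStarRing.norm_star_mul_self (x := (v : H →L[ℂ] H))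
  rw [h] at h1
  have h2 : ‖(1 : H →L[ℂ] H)‖ ≤ 1 := ContinuousLinearMap.norm_id_le
  nlinarith [norm_nonneg (v : H →L[ℂ] H)]

/-- The bound is crude but uniform in `v`, which is what weak limits of sequences in the convex hull
of an orbit require. -/
theorem norm_conjAct_le (β : M →⋆ₐ[ℂ] Matrix m m M) {v : M} (hv : v ∈ unitary M)
    (x : Matrix m m M × M) : (∀ i j, ‖(((conjAct β v x).1 i j : M) : H →L[ℂ] H)‖ ≤
      ∑ k, ∑ l, ‖(x.1 k l : H →L[ℂ] H)‖ + ‖(x.2 : H →L[ℂ] H)‖) ∧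
    ‖((conjAct β v x).2 : H →L[ℂ] H)‖ ≤
      ∑ k, ∑ l, ‖(x.1 k l : H →L[ℂ] H)‖ + ‖(x.2 : H →L[ℂ] H)‖ := by
  have hv1 := norm_le_one_of_mem_unitary hv
  have hv2 : ‖((star v : M) : H →L[ℂ] H)‖ ≤ 1 := norm_le_one_of_mem_unitary (Unitary.star_mem hv)
  constructor
  · intro i j
    change ‖(((β v * x.1 * amp m (star v)) i j : M) : H →L[ℂ] H)‖ ≤ _
    rw [mul_amp_apply, Matrix.mul_apply]
    refine le_add_of_le_of_nonneg ?_ (norm_nonneg _)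
    have h1 : ‖((∑ k, β v i k * x.1 k j : M) : H →L[ℂ] H)‖ ≤
        ∑ k, ∑ l, ‖(x.1 k l : H →L[ℂ] H)‖ := by
      refine (norm_sum_le (E := M) _ _).trans (Finset.sum_le_sum fun k _ => ?_)
      refine le_trans ?_ (Finset.single_le_sum (f := fun l => ‖(x.1 k l : H →L[ℂ] H)‖)
        (fun _ _ => norm_nonneg _) (Finset.mem_univ j))
      refine (norm_mul_le (β v i k : H →L[ℂ] H) _).trans ?_
      exact mul_le_of_le_one_left (norm_nonneg _) ((norm_map_apply_le β v i k).trans hv1)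
    refine (norm_mul_le _ ((star v : M) : H →L[ℂ] H)).trans ?_
    exact (mul_le_of_le_one_right (norm_nonneg _) hv2).trans h1
  · change ‖(v : H →L[ℂ] H) * x.2 * ((star v : M) : H →L[ℂ] H)‖ ≤ _
    refine le_add_of_nonneg_of_le (Finset.sum_nonneg fun _ _ => Finset.sum_nonneg fun _ _ =>
      norm_nonneg _) ?_
    refine (norm_mul_le _ _).trans ((mul_le_of_le_one_right (norm_nonneg _) hv2).trans ?_)
    exact (norm_mul_le _ _).trans (mul_le_of_le_one_left (norm_nonneg _) hv1)

theorem weakTendsto_conjAct_fst {ω : Ultrafilter ℕ} (β : M →⋆ₐ[ℂ] Matrix m m M) (v : M)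
    {s : ℕ → Matrix m m M × M} {k : m → m → M}
    (hk : ∀ i j, WeakTendsto ω (fun n => (s n).1 i j) (k i j)) (i j : m) :
    WeakTendsto ω (fun n => (conjAct β v (s n)).1 i j)
      ((β v * Matrix.of k * amp m (star v)) i j) := by
  have he : ∀ y : Matrix m m M, (β v * y * amp m (star v)) i j =
      (∑ l, β v i l * y l j) * star v := fun y => by
    rw [mul_amp_apply, Matrix.mul_apply]
  have hs : (fun n => (conjAct β v (s n)).1 i j) =
      fun n => (∑ l, β v i l * (s n).1 l j) * star v := funext fun n => he (s n).1
  rw [he, hs]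
  exact WeakTendsto.mul_const (WeakTendsto.sum fun l _ => (hk l j).const_mul _) _

variable {τ : M →ₗ[ℂ] ℂ} (hτ : IsFaithfulTrace τ)

include hτ

/-- A weak limit of an asymptotically `v`-invariant bounded sequence is `v`-invariant. -/
theorem conjAct_limit {ω : Ultrafilter ℕ} (β : M →⋆ₐ[ℂ] Matrix m m M) {v : M}
    (hv : v ∈ unitary M) {s : ℕ → Matrix m m M × M} {k : m → m → M} {r : M}
    (hb1 : ∀ i j, IsBddSeq fun n => (s n).1 i j) (hb2 : IsBddSeq fun n => (s n).2)
    (hbv1 : ∀ i j, IsBddSeq fun n => (conjAct β v (s n)).1 i j)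
    (hbv2 : IsBddSeq fun n => (conjAct β v (s n)).2)
    (hk : ∀ i j, WeakTendsto ω (fun n => (s n).1 i j) (k i j))
    (hr : WeakTendsto ω (fun n => (s n).2) r)
    (hlim : Tendsto (fun n => sqNorm τ (conjAct β v (s n) - s n)) ω (𝓝 0)) :
    β v * Matrix.of k = Matrix.of k * amp m v ∧ v * r = r * v := by
  have hre : ∀ t : ℕ → M, (∀ n, (τ (star (t n) * t n)).re ≤ sqNorm τ (conjAct β v (s n) - s n)) →
      Tendsto (fun n => τ (star (t n) * t n)) ω (𝓝 0) := fun t ht => by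
    have h1 := squeeze_zero (fun n => hτ.re_nonneg (t n)) ht hlim
    have h2 := (Complex.continuous_ofReal.tendsto 0).comp h1
    rw [Complex.ofReal_zero] at h2
    exact h2.congr fun n => (hτ.eq_ofReal (t n)).symm
  have hv1 := (Unitary.mem_iff.1 hv).1
  constructor
  · have hentry : ∀ i j, (β v * Matrix.of k * amp m (star v)) i j = k i j := by
      intro i j
      have hnull : IsNullSeq ω fun n => (conjAct β v (s n)).1 i j - (s n).1 i j :=
        hτ.isNullSeq ((hbv1 i j).sub (hb1 i j))
          (hre _ fun n => re_apply_le_sqNorm hτ (conjAct β v (s n) - s n) j i)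
      exact sub_eq_zero.1
        (((weakTendsto_conjAct_fst β v hk i j).sub (hk i j)).unique hnull.weakTendsto)
    have h2 : β v * Matrix.of k * amp m (star v) = Matrix.of k := Matrix.ext hentry
    have h3 : β v * Matrix.of k * amp m (star v) * amp m v = β v * Matrix.of k := by
      rw [Matrix.mul_assoc, amp_mul_amp, hv1, amp_one, Matrix.mul_one]
    rw [← h3, h2]
  · have hnull : IsNullSeq ω fun n => (conjAct β v (s n)).2 - (s n).2 :=
      hτ.isNullSeq (hbv2.sub hb2)
        (hre _ fun n => re_snd_le_sqNorm hτ (conjAct β v (s n) - s n))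
    have hw : WeakTendsto ω (fun n => (conjAct β v (s n)).2) (v * r * star v) :=
      (hr.const_mul v).mul_const _
    have h2 : v * r * star v = r := sub_eq_zero.1 ((hw.sub hr).unique hnull.weakTendsto)
    have h3 : v * r * star v * v = v * r := by rw [mul_assoc, hv1, mul_one]
    rw [← h3, h2]

/-- Averaging `(c, p)` over the unitaries of `M` commuting with `N`. -/
theorem exists_average (β : M →⋆ₐ[ℂ] Matrix m m M) (N : StarSubalgebra ℂ (H →L[ℂ] H))
    (c : Matrix m m M) (p : M) : ∃ (k : Matrix m m M) (r : M),
      (∀ x : M, (∀ d ∈ N, d * (x : H →L[ℂ] H) = x * d) →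
        β x * k = k * amp m x ∧ x * r = r * x) ∧
      ∀ (d : Matrix m m M) (e : M) (κ : ℝ),
        (∀ v ∈ unitary M, (∀ y ∈ N, y * (v : H →L[ℂ] H) = v * y) →
          κ ≤ (mtr τ (d * (β v * c * amp m (star v)))).re + (τ (e * (v * p * star v))).re) →
        κ ≤ (mtr τ (d * k)).re + (τ (e * r)).re := by
  let U : Set M := {v : M | v ∈ unitary M ∧ ∀ d ∈ N, d * (v : H →L[ℂ] H) = v * d}
  have hU : ∀ v ∈ U, ∀ w ∈ U, v * w ∈ U := fun v hv w hw => ⟨mul_mem hv.1 hw.1, fun d hd => by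
    change d * ((v : H →L[ℂ] H) * w) = v * w * d
    rw [← mul_assoc, hv.2 d hd, mul_assoc, hw.2 d hd, mul_assoc]⟩
  have hU1 : (1 : M) ∈ U := ⟨one_mem _, fun d _ => (mul_one d).trans (one_mul d).symm⟩
  let O : Set (Matrix m m M × M) := (fun v => conjAct β v (c, p)) '' U
  obtain ⟨s, hsS, hs⟩ := exists_seq_asymptotically_invariant (sqNorm τ) (sqNorm_nonneg hτ)
    sqNorm_parallelogram (convex_convexHull ℝ O)
    (Set.Nonempty.convexHull ⟨_, 1, hU1, rfl⟩)
  set C := ∑ i, ∑ j, ‖(c i j : H →L[ℂ] H)‖ + ‖(p : H →L[ℂ] H)‖ with hC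
  have hbd : ∀ x ∈ convexHull ℝ O, (∀ i j, ‖(x.1 i j : H →L[ℂ] H)‖ ≤ C) ∧
      ‖(x.2 : H →L[ℂ] H)‖ ≤ C := by
    have hconv : ∀ (x y : M) (a b : ℝ), 0 ≤ a → 0 ≤ b → a + b = 1 → ‖(x : H →L[ℂ] H)‖ ≤ C →
        ‖(y : H →L[ℂ] H)‖ ≤ C → ‖((a • x + b • y : M) : H →L[ℂ] H)‖ ≤ C := by
      intro x y a b ha hb hab hx hy
      refine (norm_add_le (a • x) (b • y)).trans ?_
      rw [norm_smul, norm_smul, Real.norm_of_nonneg ha, Real.norm_of_nonneg hb]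
      calc a * ‖x‖ + b * ‖y‖ ≤ a * C + b * C :=
            add_le_add (mul_le_mul_of_nonneg_left hx ha) (mul_le_mul_of_nonneg_left hy hb)
        _ = C := by rw [← add_mul, hab, one_mul]
    refine convexHull_min (t := {x : Matrix m m M × M | (∀ i j, ‖(x.1 i j : H →L[ℂ] H)‖ ≤ C) ∧
      ‖(x.2 : H →L[ℂ] H)‖ ≤ C}) ?_ ?_
    · rintro _ ⟨v, hv, rfl⟩
      exact norm_conjAct_le β hv.1 (c, p)
    · intro x hx y hy a b ha hb hab
      exact ⟨fun i j => hconv _ _ a b ha hb hab (hx.1 i j) (hy.1 i j),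
        hconv _ _ a b ha hb hab hx.2 hy.2⟩
  have hb1 : ∀ i j, IsBddSeq fun n => (s n).1 i j := fun i j => ⟨C, fun n => (hbd _ (hsS n)).1 i j⟩
  have hb2 : IsBddSeq fun n => (s n).2 := ⟨C, fun n => (hbd _ (hsS n)).2⟩
  -- An auxiliary ultrafilter, used only to extract weak limits of the minimizing sequence.
  set ω : Ultrafilter ℕ := hyperfilter ℕ with hω
  have hk : ∀ i j, ∃ x, WeakTendsto ω (fun n => (s n).1 i j) x := fun i j =>
    exists_weakTendsto ω (hb1 i j)
  choose k hk using hk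
  obtain ⟨r, hr⟩ := exists_weakTendsto ω hb2
  have hinvU : ∀ v ∈ U, β v * Matrix.of k = Matrix.of k * amp m v ∧ v * r = r * v := by
    intro v hv
    have hpres : ∀ x ∈ convexHull ℝ O, conjAct β v x ∈ convexHull ℝ O := by
      refine map_mem_convexHull (isLinearMap_conjAct β v) ?_
      rintro _ ⟨w, hw, rfl⟩
      change conjAct β v (conjAct β w (c, p)) ∈ convexHull ℝ O
      rw [conjAct_mul]
      exact subset_convexHull ℝ O ⟨v * w, hU v hv w hw, rfl⟩
    exact conjAct_limit hτ β hv.1 hb1 hb2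
      (fun i j => ⟨C, fun n => (hbd _ (hpres _ (hsS n))).1 i j⟩)
      ⟨C, fun n => (hbd _ (hpres _ (hsS n))).2⟩ hk hr
      ((hs (conjAct β v) hpres (sqNorm_conjAct hτ β hv.1)).mono_left Nat.hyperfilter_le_atTop)
  refine ⟨Matrix.of k, r, fun x hx => ?_, fun d e κ hκ => ?_⟩
  -- The relations are linear in `x`, so they extend from the unitaries to their span.
  · have hspan := mem_span_unitary_of_commute N hx
    have hampadd : ∀ a b : M, amp m (a + b) = amp m a + amp m b := fun a b =>
      (Matrix.diagonal_add _ _).symm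
    have hampsmul : ∀ (z : ℂ) (a : M), amp m (z • a) = z • amp m a := fun z a =>
      Matrix.diagonal_smul z _
    clear hx
    induction hspan using Submodule.span_induction with
    | mem v hv => exact hinvU v hv
    | zero =>
      refine ⟨?_, by rw [zero_mul, mul_zero]⟩
      have : amp m (0 : M) = 0 := Matrix.diagonal_zero
      rw [map_zero, this, Matrix.zero_mul, Matrix.mul_zero]
    | add a b _ _ ha hb =>
      refine ⟨?_, by rw [add_mul, mul_add, ha.2, hb.2]⟩
      rw [map_add, hampadd, Matrix.add_mul, Matrix.mul_add, ha.1, hb.1]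
    | smul z a _ ha =>
      refine ⟨?_, by rw [smul_mul_assoc, mul_smul_comm, ha.2]⟩
      rw [map_smul, hampsmul, Matrix.smul_mul, Matrix.mul_smul, ha.1]
  -- The inequality cuts out a half-space containing the orbit, hence its convex hull, and it passes
  -- to the weak limit by normality of `τ`.
  · have hall : ∀ x ∈ convexHull ℝ O, κ ≤ (mtr τ (d * x.1)).re + (τ (e * x.2)).re := by
      refine convexHull_min (t := {x : Matrix m m M × M | κ ≤ (mtr τ (d * x.1)).re + (τ (e * x.2)).re}) ?_ ?_
      · rintro _ ⟨v, hv, rfl⟩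
        exact hκ v hv.1 hv.2
      · refine convex_halfSpace_ge ⟨fun x y => ?_, fun t x => ?_⟩ κ
        · simp only [Prod.fst_add, Prod.snd_add, mtr_add, mul_add, map_add,
            Complex.add_re]
          ring
        · have h1 : mtr τ (d * (t • x).1) = (t : ℂ) * mtr τ (d * x.1) := by
            have : d * (t • x).1 = t • (d * x.1) := Matrix.mul_smul _ _ _
            rw [this, mtr, mtr, Finset.mul_sum]
            refine Finset.sum_congr rfl fun i _ => ?_
            rw [Matrix.smul_apply, ← Complex.coe_smul, map_smul, smul_eq_mul]
          have h2 : τ (e * (t • x).2) = (t : ℂ) * τ (e * x.2) := by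
            have : e * (t • x).2 = t • (e * x.2) := mul_smul_comm _ _ _
            rw [this, ← Complex.coe_smul, map_smul, smul_eq_mul]
          rw [h1, h2, Complex.re_ofReal_mul, Complex.re_ofReal_mul, smul_eq_mul, mul_add]
    have hl1 : Tendsto (fun n => mtr τ (d * (s n).1)) ω (𝓝 (mtr τ (d * Matrix.of k))) := by
      refine tendsto_finsetSum _ fun i _ => ?_
      simp only [Matrix.mul_apply]
      exact (WeakTendsto.sum fun j _ => (hk j i).const_mul (d i j)).map_normal
        (isBddSeq_sum fun j _ => (isBddSeq_const (d i j)).mul (hb1 j i)) hτ.normal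
    have hl2 : Tendsto (fun n => τ (e * (s n).2)) ω (𝓝 (τ (e * r))) :=
      (hr.const_mul e).map_normal ((isBddSeq_const e).mul hb2) hτ.normal
    refine ge_of_tendsto' (((Complex.continuous_re.tendsto _).comp hl1).add
      ((Complex.continuous_re.tendsto _).comp hl2)) fun n => hall _ (hsS n)

end Average

end KacAction

namespace KacAction

/-! ### Matrix units below a minimal projection -/

section MinimalProjection

variable {H : Type*} [NormedAddCommGroup H] [InnerProductSpace ℂ H] [CompleteSpace H]

/-- For a minimal projection `p` of a finite-dimensional `N`, the space `N p` has a basis of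
partial isometries `w i` with `(w i)* (w j) = δᵢⱼ p`. -/
theorem IsMinimalProjIn.exists_basis {N : StarSubalgebra ℂ (H →L[ℂ] H)} [FiniteDimensional ℂ N]
    {p : H →L[ℂ] H} (hp : IsMinimalProjIn N p) (hp0 : p ≠ 0) :
    ∃ (n : ℕ) (w : Fin n → H →L[ℂ] H), (∀ i, w i ∈ N ∧ w i * p = w i) ∧
      (∀ i j, star (w i) * w j = if i = j then p else 0) ∧
      ∀ v ∈ N, v * p = v → ∃ f : Fin n → ℂ, v = ∑ i, f i • w i := by
  obtain ⟨⟨hpN, hps, hpp⟩, hmin⟩ := hp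
  obtain ⟨ξ, hξ1, hξ⟩ : ∃ ξ : H, ‖ξ‖ = 1 ∧ p ξ = ξ := by
    obtain ⟨ζ, hζ⟩ : ∃ ζ, p ζ ≠ 0 := by
      by_contra! h
      exact hp0 (ContinuousLinearMap.ext h)
    refine ⟨((‖p ζ‖⁻¹ : ℝ) : ℂ) • p ζ, ?_, ?_⟩
    · rw [norm_smul, Complex.norm_real, norm_inv, norm_norm, inv_mul_cancel₀ (norm_ne_zero_iff.2 hζ)]
    · have : p (p ζ) = p ζ := congrArg (fun t : H →L[ℂ] H => t ζ) hpp
      rw [map_smul, this]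
  let V : Submodule ℂ (H →L[ℂ] H) :=
    { carrier := {v | v ∈ N ∧ v * p = v}
      add_mem' := fun ha hb => ⟨add_mem ha.1 hb.1, by rw [add_mul, ha.2, hb.2]⟩
      zero_mem' := ⟨zero_mem _, zero_mul _⟩
      smul_mem' := fun z a ha => ⟨N.smul_mem ha.1 z, by rw [smul_mul_assoc, ha.2]⟩ }
  have hfin : FiniteDimensional ℂ V := by
    have : FiniteDimensional ℂ N.toSubalgebra.toSubmodule := inferInstanceAs (FiniteDimensional ℂ N)
    exact Submodule.finiteDimensional_of_le (S₂ := N.toSubalgebra.toSubmodule) fun v hv => hv.1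
  -- Minimality makes `v*w` a multiple of `p`, and evaluation at a unit vector `ξ` fixed by `p`
  -- identifies the factor. So `v ↦ vξ` is injective on `Np` and an orthonormal basis of its range
  -- lifts to the `wᵢ`.
  have hinner : ∀ v ∈ V, ∀ w ∈ V, star v * w = ⟪v ξ, w ξ⟫_ℂ • p := by
    intro v hv w hw
    have hpv : p * star v = star v := by
      conv_rhs => rw [← hv.2, star_mul, hps]
    obtain ⟨z, hz⟩ := hmin (star v * w) (mul_mem (star_mem hv.1) hw.1)
    have h1 : star v * w = z • p := by rw [← hz, ← mul_assoc, hpv, mul_assoc, hw.2]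
    have h2 : ⟪v ξ, w ξ⟫_ℂ = z := by
      have h3 := congrArg (fun t : H →L[ℂ] H => ⟪ξ, t ξ⟫_ℂ) h1
      simp only [mul_apply_eq_comp, ContinuousLinearMap.star_eq_adjoint,
        ContinuousLinearMap.adjoint_inner_right, smul_apply, inner_smul_right,
        hξ, inner_self_eq_norm_sq_to_K, hξ1] at h3
      simpa using h3
    rw [h1, h2]
  have hinj : ∀ v ∈ V, v ξ = 0 → v = 0 := by
    intro v hv h0
    have := hinner v hv v hv
    rw [h0, inner_zero_left, zero_smul] at this
    exact CStarRing.star_mul_self_eq_zero_iff v |>.1 this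
  let ev : V →ₗ[ℂ] H :=
    { toFun := fun v => (v : H →L[ℂ] H) ξ
      map_add' := fun _ _ => rfl
      map_smul' := fun _ _ => rfl }
  let b := stdOrthonormalBasis ℂ (LinearMap.range ev)
  have hw : ∀ i, ∃ v : V, ev v = (b i : H) := fun i => (b i).2
  choose w hw using hw
  refine ⟨_, fun i => w i, fun i => (w i).2, fun i j => ?_, fun v hvN hv => ?_⟩
  · rw [hinner _ (w i).2 _ (w j).2]
    have h1 : ⟪(w i : H →L[ℂ] H) ξ, (w j : H →L[ℂ] H) ξ⟫_ℂ = if i = j then 1 else 0 := by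
      rw [← orthonormal_iff_ite.1 b.orthonormal i j]
      exact congrArg₂ (fun x y : H => ⟪x, y⟫_ℂ) (hw i) (hw j)
    rw [h1]
    split_ifs <;> simp
  · let v' : V := ⟨v, hvN, hv⟩
    refine ⟨fun i => ⟪b i, ⟨ev v', v', rfl⟩⟫_ℂ, ?_⟩
    have h1 := b.sum_repr' ⟨ev v', v', rfl⟩
    have h2 := congrArg (fun t : LinearMap.range ev => (t : H)) h1
    simp only [AddSubmonoidClass.coe_finsetSum, Submodule.coe_smul] at h2
    refine sub_eq_zero.1 (hinj _ (sub_mem (show v ∈ V from v'.2) (sum_mem fun i _ =>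
      Submodule.smul_mem _ _ (w i).2)) ?_)
    rw [sub_apply, sum_apply, sub_eq_zero]
    refine h2.symm.trans (Finset.sum_congr rfl fun i _ => ?_)
    rw [← hw i]
    rfl

/-- For `x ∈ p B(H)` the operator `∑ᵢ wᵢ x wᵢ*` commutes with `N`. -/
theorem commute_sum_conj {N : StarSubalgebra ℂ (H →L[ℂ] H)} {p : H →L[ℂ] H} {n : ℕ}
    {w : Fin n → H →L[ℂ] H} (hw : ∀ i, w i ∈ N ∧ w i * p = w i)
    (horth : ∀ i j, star (w i) * w j = if i = j then p else 0)
    (hspan : ∀ v ∈ N, v * p = v → ∃ f : Fin n → ℂ, v = ∑ i, f i • w i)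
    {x : H →L[ℂ] H} (hx : p * x = x) {y : H →L[ℂ] H} (hy : y ∈ N) :
    y * ∑ i, w i * x * star (w i) = (∑ i, w i * x * star (w i)) * y := by
  have hex : ∀ y ∈ N, ∀ i, ∃ f : Fin n → ℂ, y * w i = ∑ j, f j • w j := fun y hy i =>
    hspan _ (mul_mem hy (hw i).1) (by rw [mul_assoc, (hw i).2])
  have hcoef : ∀ (f : Fin n → ℂ) (v : H →L[ℂ] H) (j : Fin n), v = ∑ l, f l • w l →
      star (w j) * v = f j • p := by
    rintro f _ j rfl
    rw [Finset.mul_sum, Finset.sum_eq_single j]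
    · rw [mul_smul_comm, horth, if_pos rfl]
    · intro l _ hl
      rw [mul_smul_comm, horth, if_neg hl.symm, smul_zero]
    · simp
  choose f hf using fun i => hex y hy i
  choose g hg using fun i => hex (star y) (star_mem hy) i
  have hl : ∀ i, y * (w i * x * star (w i)) = ∑ j, (f i j • (w j * x)) * star (w i) := fun i => by
    rw [← mul_assoc, ← mul_assoc, hf i, Finset.sum_mul, Finset.sum_mul]
    exact Finset.sum_congr rfl fun j _ => by rw [smul_mul_assoc]
  have hr : ∀ j, w j * x * star (w j) * y = ∑ i, (w j * x) * star (g j i • w i) := fun j => by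
    rw [mul_assoc, ← star_star y, ← star_mul, hg j, star_sum, Finset.mul_sum]
  rw [Finset.mul_sum, Finset.sum_mul]
  simp only [hl, hr]
  rw [Finset.sum_comm]
  refine Finset.sum_congr rfl fun j _ => Finset.sum_congr rfl fun i _ => ?_
  have h1 : star (w j) * (y * w i) = f i j • p := hcoef _ _ j (hf i)
  have h2 : star (w i) * (star y * w j) = g j i • p := hcoef _ _ i (hg j)
  -- The matrices of left multiplication by `y` and by `y*` in the basis `w` are adjoint to each
  -- other, which is exactly what commutation requires.
  have h3 : f i j • p = star (g j i • p) := by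
    rw [← h1, ← h2, star_mul, star_mul, star_star, star_star, mul_assoc]
  by_cases hp0 : p = 0
  · have hx0 : x = 0 := by rw [← hx, hp0, zero_mul]
    simp [hx0]
  · have hps : star p = p := by
      have := horth j j
      rw [if_pos rfl] at this
      rw [← this, star_mul, star_star]
    rw [star_smul, hps, ← sub_eq_zero, ← sub_smul] at h3
    have h4 := sub_eq_zero.1 ((smul_eq_zero.1 h3).resolve_right hp0)
    rw [star_smul, mul_smul_comm, smul_mul_assoc, h4]

end MinimalProjection

end KacAction

namespace KacAction

/-! ### Freeness implies central freeness on the AFD factor of type II₁ -/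

section AFD

variable {H : Type*} [NormedAddCommGroup H] [InnerProductSpace ℂ H] [CompleteSpace H]
  {M : VonNeumannAlgebra H} {m : Type*} [Fintype m] [DecidableEq m]

section

variable {τ : M →ₗ[ℂ] ℂ} (hτ : IsFaithfulTrace τ) {ω : Ultrafilter ℕ}

include hτ

/-- If `a` intertwines `β^ω` and the inclusion on `M_ω`, then `β(v) a (v* ⊗ 1)` is uniformly close
to `a` for the unitaries `v` commuting with a large finite-dimensional subalgebra. -/
theorem exists_forall_half_le (hω : (ω : Filter ℕ) ≤ Filter.cofinite)
    {N : ℕ → StarSubalgebra ℂ (H →L[ℂ] H)} (hmono : Monotone N)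
    (hN : Set.centralizer (Set.centralizer (⋃ n, (N n : Set (H →L[ℂ] H)))) =
      (M : Set (H →L[ℂ] H)))
    {β : M →⋆ₐ[ℂ] Matrix m m M} (hβ : IsNormalMap M β) (hp : PreservesNormalizer ω β)
    {a : Matrix m m M} (ha : a ≠ 0) (h : ∀ x ∈ centralPart ω M,
      ultraLift ω β x * a.map (constEmb ω M) = amp m x * a.map (constEmb ω M)) :
    ∃ n, ∀ v ∈ unitary M, (∀ y ∈ N n, y * (v : H →L[ℂ] H) = v * y) →
      (mtr τ (star a * a)).re / 2 ≤ (mtr τ (star a * (β v * a * amp m (star v)))).re := by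
  by_contra! hcon
  choose v hv hcomm hlt using hcon
  have hb : IsBddSeq v := ⟨1, fun n => norm_le_one_of_mem_unitary (hv n)⟩
  -- If every `n` had a bad unitary, these would form a centralizing sequence, along which `β(v)a(v*
  -- ⊗ 1)` tends weakly to `a`.
  have hcent := hτ.isCentralizingSeq hω hmono hN hb hcomm
  let s : normalizerAlg ω M := ⟨v, hcent.mem_normalizerAlg⟩
  have hs : Ultraproduct.mk s ∈ centralPart ω M := ⟨s, hcent, rfl⟩
  have hentry : ∀ i j, IsNullSeq ω fun n => (β (v n) * a) i j - a i j * v n := by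
    intro i j
    have h1 := h _ hs
    rw [amp_mul_map_constEmb hs] at h1
    have h2 := congrFun (congrFun h1 i) j
    rw [ultraLift_mul_map_constEmb_apply hβ hp s a i j (mul_apply_mem_normalizerAlg hp s a i j),
      mul_amp_apply, Matrix.map_apply, constEmb, ← map_mul, ← sub_eq_zero, ← map_sub,
      Ultraproduct.mk_eq_zero] at h2
    exact h2
  have hweak : ∀ i j, WeakTendsto ω (fun n => (β (v n) * a * amp m (star (v n))) i j) (a i j) := by
    intro i j
    have h1 := (hentry i j).weakTendsto_mul hb.star
    have h2 := h1.add (WeakTendsto.const (ω := ω) (a i j))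
    rw [zero_add] at h2
    have h3 : (fun n => (β (v n) * a * amp m (star (v n))) i j) =
        fun n => ((β (v n) * a) i j - a i j * v n) * star (v n) + a i j := by
      funext n
      rw [mul_amp_apply, sub_mul, mul_assoc (a i j), (Unitary.mem_iff.1 (hv n)).2, mul_one,
        sub_add_cancel]
    rw [h3]
    exact h2
  have hbdd : ∀ i j, IsBddSeq fun n => (β (v n) * a * amp m (star (v n))) i j := fun i j =>
    ⟨_, fun n => (norm_conjAct_le β (hv n) (a, 0)).1 i j⟩
  have hlim : Tendsto (fun n => mtr τ (star a * (β (v n) * a * amp m (star (v n))))) ω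
      (𝓝 (mtr τ (star a * a))) := by
    refine tendsto_finsetSum _ fun i _ => ?_
    simp only [Matrix.mul_apply (M := star a)]
    exact (WeakTendsto.sum fun j _ => (hweak j i).const_mul (star a i j)).map_normal
      (isBddSeq_sum fun j _ => (isBddSeq_const (star a i j)).mul (hbdd j i)) hτ.normal
  have hle := le_of_tendsto' ((Complex.continuous_re.tendsto _).comp hlim) fun n => (hlt n).le
  have hpos := mtr_re_pos hτ ha
  linarith

end

/-- An intertwiner on the relative commutant of a finite-dimensional algebra yields an
intertwiner on a corner. -/
theorem exists_corner_intertwiner {N : StarSubalgebra ℂ (H →L[ℂ] H)} [FiniteDimensional ℂ N]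
    (hNM : ∀ x ∈ N, x ∈ M) {β : M →⋆ₐ[ℂ] Matrix m m M} {b : Matrix m m M} (hb : b ≠ 0)
    (h : ∀ x : M, (∀ d ∈ N, d * (x : H →L[ℂ] H) = x * d) → β x * b = b * amp m x) :
    ∃ (c : Matrix m m M) (p : M), c ≠ 0 ∧ star p = p ∧ p * p = p ∧ c * amp m p = c ∧
      ∀ x : M, p * x = x → x * p = x → β x * c = c * amp m x := by
  -- Not being annihilated by `b` passes from a projection to one of the two pieces of any
  -- splitting, so some minimal projection has it.
  obtain ⟨p, hp, hTp⟩ := IsProjIn.exists_minimal (N := N)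
    (T := fun p => ∃ i j, ((b i j : M) : H →L[ℂ] H) * p ≠ 0) (fun p q ⟨i, j, hij⟩ => by
      by_cases hq : (b i j : H →L[ℂ] H) * q = 0
      · exact Or.inr ⟨i, j, by rwa [mul_sub, hq, sub_zero]⟩
      · exact Or.inl ⟨i, j, hq⟩) (p := 1) ⟨one_mem _, star_one _, one_mul _⟩ (by
      by_contra! h0
      refine hb (Matrix.ext fun i j => Subtype.ext ?_)
      rw [← mul_one (b i j : H →L[ℂ] H), h0]
      rfl)
  obtain ⟨i₀, j₀, hij⟩ := hTp
  have hp0 : p ≠ 0 := by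
    rintro rfl
    exact hij (mul_zero _)
  obtain ⟨n, w, hw, horth, hspan⟩ := hp.exists_basis hp0
  let P : M := ⟨p, hNM p hp.1.1⟩
  let W : Fin n → M := fun i => ⟨w i, hNM _ (hw i).1⟩
  have hWP : ∀ i, W i * P = W i := fun i => Subtype.ext (hw i).2
  have horth' : ∀ i j, star (W i) * W j = if i = j then P else 0 := fun i j => by
    refine Subtype.ext ((horth i j).trans ?_)
    split_ifs <;> rfl
  -- The map `x ↦ ∑ᵢ Wᵢ x Wᵢ*` sends the corner `pMp` into the relative commutant of `N`, where `b`
  -- intertwines.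
  have hconj : ∀ x : M, P * x = x → x * P = x →
      β (∑ i, W i * x * star (W i)) * b = b * amp m (∑ i, W i * x * star (W i)) := by
    intro x hx hx'
    refine h _ fun d hd => ?_
    have hcoe : ((∑ i, W i * x * star (W i) : M) : H →L[ℂ] H) =
        ∑ i, w i * (x : H →L[ℂ] H) * star (w i) := AddSubmonoidClass.coe_finsetSum _ _
    rw [hcoe]
    exact commute_sum_conj hw horth hspan (congrArg Subtype.val hx) hd
  have hleft : ∀ (x : M) (i : Fin n), P * x = x →
      star (W i) * (∑ l, W l * x * star (W l)) = x * star (W i) := by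
    intro x i hx
    rw [Finset.mul_sum, Finset.sum_eq_single i]
    · rw [← mul_assoc, ← mul_assoc, horth', if_pos rfl, hx]
    · intro l _ hl
      rw [← mul_assoc, ← mul_assoc, horth', if_neg hl.symm, zero_mul, zero_mul]
    · simp
  have hright : ∀ (x : M) (j : Fin n), x * P = x →
      (∑ l, W l * x * star (W l)) * W j = W j * x := by
    intro x j hx
    rw [Finset.sum_mul, Finset.sum_eq_single j]
    · rw [mul_assoc, horth', if_pos rfl, mul_assoc, hx]
    · intro l _ hl
      rw [mul_assoc, horth', if_neg hl, mul_zero]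
    · simp
  have hPP : P * P = P := Subtype.ext hp.1.2.2
  -- one of the `β(wᵢ*) b wⱼ` is nonzero
  obtain ⟨i, j, hc⟩ : ∃ i j, β (star (W i)) * b * amp m (W j) ≠ 0 := by
    by_contra! h0
    have hbW : ∀ j, b * amp m (W j) = 0 := by
      intro j
      have h1 := hconj P hPP hPP
      have h2 := hright P j hPP
      have h3 : b * amp m (W j) = β (∑ i, W i * P * star (W i)) * b * amp m (W j) := by
        rw [h1, Matrix.mul_assoc, amp_mul_amp, h2, hWP]
      rw [h3, map_sum, Finset.sum_mul, Finset.sum_mul]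
      refine Finset.sum_eq_zero fun i _ => ?_
      rw [hWP, map_mul, Matrix.mul_assoc, Matrix.mul_assoc, ← Matrix.mul_assoc (β (star (W i))),
        h0, Matrix.mul_zero]
    obtain ⟨f, hf⟩ := hspan p hp.1.1 hp.1.2.2
    refine hij ?_
    rw [hf, Finset.mul_sum]
    refine Finset.sum_eq_zero fun l _ => ?_
    have h1 := congrFun (congrFun (hbW l) i₀) j₀
    rw [mul_amp_apply] at h1
    have h2 : (b i₀ j₀ : H →L[ℂ] H) * w l = 0 := congrArg Subtype.val h1
    rw [mul_smul_comm, h2, smul_zero]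
  refine ⟨_, P, hc, Subtype.ext hp.1.2.1, hPP, ?_, fun x hx hx' => ?_⟩
  · rw [Matrix.mul_assoc, amp_mul_amp, hWP]
  · have h1 : β x * β (star (W i)) = β (star (W i)) * β (∑ l, W l * x * star (W l)) := by
      rw [← map_mul, ← map_mul, hleft x i hx]
    have h2 : amp m (∑ l, W l * x * star (W l)) * amp m (W j) = amp m (W j) * amp m x := by
      rw [amp_mul_amp, amp_mul_amp, hright x j hx']
    rw [← Matrix.mul_assoc, ← Matrix.mul_assoc, h1, Matrix.mul_assoc (β (star (W i))),
      hconj x hx hx', Matrix.mul_assoc, Matrix.mul_assoc, Matrix.mul_assoc, h2]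
    simp only [Matrix.mul_assoc]

/-- In a finite factor, an intertwiner on a corner yields a global intertwiner. -/
theorem exists_intertwiner_of_corner {τ : M →ₗ[ℂ] ℂ} (hτ : IsFaithfulTrace τ)
    (hfac : ∀ z : M, (∀ x : M, z * x = x * z) → ∃ c : ℂ, z = algebraMap ℂ M c)
    {β : M →⋆ₐ[ℂ] Matrix m m M} {c : Matrix m m M} {p : M} (hc : c ≠ 0) (hps : star p = p)
    (hpp : p * p = p) (hcp : c * amp m p = c)
    (h : ∀ x : M, p * x = x → x * p = x → β x * c = c * amp m x) :
    ∃ k : Matrix m m M, k ≠ 0 ∧ ∀ x : M, k * amp m x = β x * k := by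
  -- With `N = ⊥` all unitaries are averaged over. The projection `p` is averaged along with `c`:
  -- its average is a scalar by factoriality, and serves to show that the average of `c` is nonzero.
  obtain ⟨k, r, hk, hlim⟩ := exists_average hτ β ⊥ c p
  have hk' : ∀ x : M, β x * k = k * amp m x ∧ x * r = r * x := fun x => hk x fun d hd => by
    obtain ⟨z, rfl⟩ := StarSubalgebra.mem_bot.1 hd
    exact Algebra.commutes z _
  refine ⟨k, ?_, fun x => (hk' x).1.symm⟩
  rintro rfl
  obtain ⟨z, hz⟩ := hfac r fun x => (hk' x).2.symm
  have hp0 : p ≠ 0 := by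
    rintro rfl
    refine hc ?_
    rw [← hcp]
    have : amp m (0 : M) = 0 := Matrix.diagonal_zero
    rw [this, Matrix.mul_zero]
  have hτp : 0 < (τ p).re := by
    have := hτ.re_pos hp0
    rwa [hps, hpp] at this
  have hunit : ∀ v ∈ unitary M, ∀ x, τ (v * x * star v) = τ x := fun v hv x => by
    rw [hτ.comm, ← mul_assoc, (Unitary.mem_iff.1 hv).1, one_mul]
  have hτr : ∀ e : M, τ (e * r) = z * τ e := fun e => by
    rw [hz, ← Algebra.commutes, ← Algebra.smul_def, map_smul, smul_eq_mul]
  -- Pairing with `(0, 1)`: the trace of `vpv*` is `τ(p)` for every `v`.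
  have hzpos : 0 < z.re := by
    have h1 := hlim 0 1 (τ p).re fun v hv _ => by
      rw [one_mul, hunit v hv, Matrix.zero_mul]
      simp [mtr]
    rw [hτr, hτ.one, mul_one, Matrix.zero_mul] at h1
    refine hτp.trans_le (h1.trans_eq ?_)
    simp [mtr]
  -- the pairing of `β(v) c v*` with `c`
  have hpair : ∀ v ∈ unitary M, mtr τ (star c * (β v * c * amp m (star v))) =
      τ ((∑ i, (star c * c) i i) * (v * p * star v)) := by
    intro v hv
    have h1 : β p * c = c := by rw [h p hpp hpp, hcp]
    have h2 : star c * β p = star c := by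
      rw [← hps, map_star, ← star_mul, h1]
    have h3 : β (p * v * p) * c = c * amp m (p * v * p) := by
      refine h _ ?_ ?_
      · rw [← mul_assoc, ← mul_assoc, hpp]
      · rw [mul_assoc, hpp]
    -- As `c = β(p)c = c(p ⊗ 1)`, the unitary may be cut down to `pvp` in the corner, where `c`
    -- intertwines.
    have h4 : star c * (β v * c) = star c * c * amp m (v * p) := by
      have e0 : β (p * v * p) * c = β p * (β v * c) := by
        rw [map_mul, map_mul, Matrix.mul_assoc, h1, Matrix.mul_assoc]
      have e1 : star c * (β v * c) = star c * (β (p * v * p) * c) := by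
        rw [e0, ← Matrix.mul_assoc (star c) (β p), h2]
      rw [e1, h3, ← Matrix.mul_assoc]
      have e2 : amp m (p * v * p) = amp m p * amp m (v * p) := by rw [amp_mul_amp, mul_assoc]
      rw [e2, ← Matrix.mul_assoc, Matrix.mul_assoc (star c) c, hcp]
    rw [← Matrix.mul_assoc, h4, Matrix.mul_assoc, amp_mul_amp, mtr, ← map_sum]
    simp only [mul_amp_apply, ← Finset.sum_mul]
  -- This pairing is zero on the whole orbit, so it is nonnegative at the average; with `k = 0` it
  -- would equal minus the positive number `Re z · ‖c‖₂²`.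
  have h1 := hlim (star c) (-∑ i, (star c * c) i i) 0 fun v hv _ => by
    rw [hpair v hv, neg_mul, map_neg, Complex.neg_re, add_neg_cancel]
  have h2 : τ (∑ i, (star c * c) i i) = ((mtr τ (star c * c)).re : ℂ) := by
    have h3 : τ (∑ i, (star c * c) i i) = mtr τ (star c * c) := map_sum _ _ _
    rw [h3, mtr_star_mul]
    simp only [Complex.re_sum, Complex.ofReal_sum]
    exact Finset.sum_congr rfl fun i _ => Finset.sum_congr rfl fun j _ => hτ.eq_ofReal _
  rw [neg_mul, map_neg, hτr, h2, Matrix.mul_zero] at h1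
  have h3 : mtr τ (0 : Matrix m m M) = 0 := by simp [mtr]
  rw [h3, Complex.neg_re, mul_comm, Complex.re_ofReal_mul] at h1
  have h4 := mul_pos (mtr_re_pos hτ hc) hzpos
  simp at h1
  linarith

/-- On the AFD factor of type II₁, a homomorphism without nonzero intertwiners is properly
centrally nontrivial. -/
theorem IsAFDFactorTypeIIOne.isProperlyCentrallyNontrivial {ω : Ultrafilter ℕ}
    (hM : IsAFDFactorTypeIIOne M) (hω : (ω : Filter ℕ) ≤ Filter.cofinite)
    {β : M →⋆ₐ[ℂ] Matrix m m M} (hβ : IsNormalMap M β) (hp : PreservesNormalizer ω β)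
    (h : ¬ ∃ a : Matrix m m M, a ≠ 0 ∧ ∀ x : M, a * amp m x = β x * a) :
    IsProperlyCentrallyNontrivial ω β := by
  rintro ⟨a, ha, hx⟩
  obtain ⟨τ, hτn, hτ1, hτc, hτp, hτf⟩ := hM.exists_trace
  have hτ : IsFaithfulTrace τ := ⟨hτn, hτ1, hτc, hτp, hτf⟩
  obtain ⟨N, hmono, hfin, hN⟩ := hM.approximately_finite
  obtain ⟨n, hn⟩ := exists_forall_half_le hτ hω hmono hN hβ hp ha hx
  -- Only the first component of the average matters here; the lower bound on its pairing with `a`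
  -- keeps it away from zero.
  obtain ⟨k, r, hk, hlim⟩ := exists_average hτ β (N n) a 1
  have hk0 : k ≠ 0 := by
    rintro rfl
    have h1 := hlim (star a) 0 _ fun v hv hcomm => by
      rw [zero_mul, map_zero, Complex.zero_re, add_zero]
      exact hn v hv hcomm
    have h2 := mtr_re_pos hτ ha
    have h3 : mtr τ (0 : Matrix m m M) = 0 := by simp [mtr]
    rw [Matrix.mul_zero, h3, zero_mul, map_zero] at h1
    simp at h1
    linarith
  have := hfin n
  obtain ⟨c, p, hc, hps, hpp, hcp, hcor⟩ := exists_corner_intertwiner (N := N n) (fun x hx => by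
    change x ∈ (M : Set (H →L[ℂ] H))
    rw [← hN]
    exact Set.subset_centralizer_centralizer (Set.mem_iUnion.2 ⟨n, hx⟩)) hk0
    fun x hx => (hk x hx).1
  exact h (exists_intertwiner_of_corner hτ hM.factor hc hps hpp hcp hcor)

end AFD

end KacAction


open KacAction in
theorem mainTheorem10
    {H : Type*} [NormedAddCommGroup H] [InnerProductSpace ℂ H] [CompleteSpace H]
    [TopologicalSpace.SeparableSpace H] (M : VonNeumannAlgebra H)
    {L : Type*} [NormedAddCommGroup L] [InnerProductSpace ℂ L] [CompleteSpace L]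
    [TopologicalSpace.SeparableSpace L] (G : CompactKacAlgebra L) (R : IrrSystem G)
    (c : CocycleAction R M) (ω : Ultrafilter ℕ) (hω : (ω : Filter ℕ) ≤ Filter.cofinite) :
    (c.IsCentrallyFree ω ↔ c.IsStronglyFree ω) ∧
      (IsAFDFactorTypeIIOne M →
        [c.IsCentrallyFree ω, c.IsStronglyFree ω, c.IsFree].TFAE) := by
  have h12 : c.IsCentrallyFree ω ↔ c.IsStronglyFree ω :=
    ⟨fun h π hπ => (h π hπ).isStronglyOuter hω (c.normal π) (c.preservesNormalizer π),
      fun h π hπ => (h π hπ).isProperlyCentrallyNontrivial⟩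
  refine ⟨h12, fun hM => ?_⟩
  have h13 : c.IsCentrallyFree ω ↔ c.IsFree :=
    ⟨fun h π hπ => (h π hπ).not_exists_intertwiner (c.normal π) (c.preservesNormalizer π),
      fun h π hπ => hM.isProperlyCentrallyNontrivial hω (c.normal π) (c.preservesNormalizer π)
        (h π hπ)⟩
  tfae_have 1 ↔ 2 := h12
  tfae_have 1 ↔ 3 := h13
  tfae_finish
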